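/- Let $k\in\mathbb Z$ and let $E\to\mathbb{CP}^1$ be the holomorphic vector bundle of rank $3$ with frames $\xi_1,\xi_2,\xi_3$ over $U_0$ (coordinate $x$) and $\eta_1,\eta_2,\eta_3$ over $U_1$ (coordinate $y=1/x$), where $\eta_i=x^{-k}\xi_i$ on $U_0\cap U_1$. Let $(\mathbb{CP}^1,\bigwedge\mathcal E)$ be the corresponding split supermanifold, denoted $(k,k,k)$, where $\mathcal E$ is the sheaf of holomorphic sections of $E$. Let $\mathcal T_2$ be the sheaf of its vector fields of degree $2$, i.e. of those derivations $v$ of the sheaf of algebras $\bigwedge\mathcal E$ with $v(\bigwedge^q\mathcal E)\subset\bigwedge^{q+2}\mathcal E$ for all $q$. Let $\operatorname{Aut}E$ be the group of automorphisms of the vector bundle $E$ over the identity of $\mathbb{CP}^1$, acting on $\mathcal T_2$, and hence on $H^1(\mathbb{CP}^1,\mathcal T_2)$, by $\operatorname{Int}A: v\mapsto AvA^{-1}$. Then: 1. Assigning to $A$ its matrix $(a_{ij})$, defined by $A(\xi_j)=\sum_i a_{ij}\xi_i$, whose entries are constant (and which is also the matrix of $A$ in the frame $\eta$), gives a group isomorphism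 $\operatorname{Aut}E\simeq\operatorname{GL}_3(\mathbb C)$. 2. There is an isomorphism of complex vector spaces $$\Phi: H^1(\mathbb{CP}^1,\mathcal T_2)\;\simeq\;\operatorname{Mat}_{3\times(4k-4)}(\mathbb C)$$ (for $k\le 1$ the right-hand side is read as the zero space) such that $$\Phi(\operatorname{Int}A\,(c))=D_A\,\Phi(c),\qquad D_A=\det(A)\,(A^{-1})^{T},$$ for all $A\in\operatorname{Aut}E$ and $c\in H^1(\mathbb{CP}^1,\mathcal T_2)$, where the product on the right is matrix multiplication. 3. The map $A\mapsto D_A$ is a surjective group homomorphism $\operatorname{Aut}E\to\operatorname{GL}_3(\mathbb C)$. Thus, through it, the action $\operatorname{Int}$ is the standard action $W\mapsto DW$ of $\operatorname{GL}_3(\mathbb C)$ on $\operatorname{Mat}_{3\times(4k-4)}(\mathbb C)$; in particular the two actions have the same orbits. -/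

import Mathlib

open CategoryTheory TopologicalSpace Opposite
open scoped ExteriorAlgebra

noncomputable section

namespace SuperCP1

/-- The Riemann sphere `ℂ ∪ {∞}`, i.e. the topological space underlying the complex projective
line. Its complex structure is given by the two charts `chartZero` and `chartInf` below. -/
abbrev CP1 : TopCat.{0} := TopCat.of (OnePoint ℂ)

/-- The inverse of the standard chart `U₀ = CP1 \ {∞} → ℂ` with coordinate `x`. -/
def chartZero (x : ℂ) : CP1 := (x : OnePoint ℂ)

/-- The inverse of the standard chart `U₁ = CP1 \ {0} → ℂ` with coordinate `y = 1 / x`. -/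
def chartInf (y : ℂ) : CP1 := if y = 0 then OnePoint.infty else ((y⁻¹ : ℂ) : OnePoint ℂ)

lemma continuous_chartZero : Continuous chartZero := OnePoint.continuous_coe

lemma continuous_chartInf : Continuous chartInf := by
  rw [continuous_iff_continuousAt]
  intro y
  by_cases hy : y = 0
  · subst hy
    have h1 : Filter.Tendsto chartInf (nhdsWithin 0 {0}ᶜ) (nhds (chartInf 0)) := by
      have h2 : Filter.Tendsto (fun y : ℂ => ((y⁻¹ : ℂ) : OnePoint ℂ)) (nhdsWithin 0 {0}ᶜ)
          (nhds OnePoint.infty) := by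
        have h3 := OnePoint.tendsto_coe_infty (X := ℂ)
        rw [Filter.coclosedCompact_eq_cocompact, ← Metric.cobounded_eq_cocompact] at h3
        exact h3.comp Filter.tendsto_inv₀_nhdsNE_zero
      have h4 : chartInf 0 = OnePoint.infty := if_pos rfl
      rw [h4]
      refine h2.congr' ?_
      filter_upwards [self_mem_nhdsWithin] with z hz
      exact (if_neg hz).symm
    exact continuousAt_iff_punctured_nhds.2 h1
  · have h : (fun z : ℂ => ((z⁻¹ : ℂ) : OnePoint ℂ)) =ᶠ[nhds y] chartInf := by
      filter_upwards [isOpen_ne.mem_nhds hy] with z hz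
      exact (if_neg hz).symm
    refine ContinuousAt.congr ?_ h
    exact OnePoint.continuous_coe.continuousAt.comp (continuousAt_inv₀ hy)

/-- A map from a subset of `ℂ` to a finite-dimensional complex vector space is holomorphic if
all its coordinates (with respect to any linear form) are. -/
def HolOn {F : Type} [AddCommGroup F] [Module ℂ F] (g : ℂ → F) (S : Set ℂ) : Prop :=
  ∀ l : Module.Dual ℂ F, DifferentiableOn ℂ (fun z => l (g z)) S

/-- Extension by zero of a function on an open set (only its values on the open set are used). -/
def extendZero {F : Type} [Zero F] {U : Opens CP1} (s : U → F) (p : CP1) : F :=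
  open Classical in if h : p ∈ U then s ⟨p, h⟩ else 0

/-- The factor relating the frame used at the point `chartInf y` to the frame `η` over `U₁`:
over `U₀ ∩ U₁` one has `ξ_i = y ^ (-k) η_i`, while at `∞` the frame `η` itself is used. -/
def frameFactor (k : ℤ) (y : ℂ) : ℂ := if y = 0 then 1 else y ^ (-k)

/-- Let `F` be a vector space on which `c : ℂ` acts by `ρ c`. A function `s : U → F` is read as a
section over `U` of the vector bundle with fibre `F` whose fibre coordinates are given by the
frame `ξ` at the points `≠ ∞` and by the frame `η` at `∞`, and whose transition from the frame
`ξ` to the frame `η` is `ρ (y ^ (-k))`. The section is holomorphic if it is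
holomorphic in the frame `ξ` over `U₀` and in the frame `η` over `U₁`. -/
def IsHolSection {F : Type} [AddCommGroup F] [Module ℂ F] (ρ : ℂ → F →ₗ[ℂ] F) (k : ℤ)
    {U : Opens CP1} (s : U → F) : Prop :=
  HolOn (fun x => extendZero s (chartZero x)) (chartZero ⁻¹' (U : Set CP1)) ∧
  HolOn (fun y => ρ (frameFactor k y) (extendZero s (chartInf y))) (chartInf ⁻¹' (U : Set CP1))

/-- The typical fibre of the bundle `E`; the standard basis is `ξ_1, ξ_2, ξ_3`
(respectively `η_1, η_2, η_3`). -/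
abbrev FibE : Type := Fin 3 → ℂ

/-- The typical fibre of the bundle `⋀ E`. -/
abbrev FibL : Type := ExteriorAlgebra ℂ FibE

/-- Scalars acting on the fibre of `E`. -/
def scaleE (c : ℂ) : FibE →ₗ[ℂ] FibE := c • LinearMap.id

/-- Scalars acting on the fibre of `⋀ E`, by functoriality of the exterior algebra. -/
def scaleL (c : ℂ) : FibL →ₗ[ℂ] FibL := (ExteriorAlgebra.map (scaleE c)).toLinearMap

section hol

variable {F : Type} [AddCommGroup F] [Module ℂ F]

instance : Module.Finite ℂ FibL :=
  Module.Finite.of_basis (Pi.basisFun ℂ (Fin 3)).ExteriorAlgebra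

lemma HolOn.add {f g : ℂ → F} {S : Set ℂ} (hf : HolOn f S) (hg : HolOn g S) :
    HolOn (fun z => f z + g z) S := fun l => by
  simpa only [map_add] using (hf l).fun_add (hg l)

lemma HolOn.smul {c : ℂ → ℂ} {f : ℂ → F} {S : Set ℂ} (hc : DifferentiableOn ℂ c S)
    (hf : HolOn f S) : HolOn (fun z => c z • f z) S := fun l => by
  simpa only [map_smul, smul_eq_mul] using hc.fun_mul (hf l)

lemma holOn_const (v : F) (S : Set ℂ) : HolOn (fun _ => v) S :=
  fun _ => differentiableOn_const _

lemma HolOn.sum {ι : Type} {f : ι → ℂ → F} {S : Set ℂ} (t : Finset ι)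
    (hf : ∀ i ∈ t, HolOn (f i) S) : HolOn (fun z => ∑ i ∈ t, f i z) S := fun l => by
  simp only [map_sum]
  exact DifferentiableOn.fun_sum fun i hi => hf i hi l

lemma HolOn.congr {f g : ℂ → F} {S : Set ℂ} (hf : HolOn f S) (h : ∀ z ∈ S, g z = f z) :
    HolOn g S := fun l => (hf l).congr fun z hz => by rw [h z hz]

lemma HolOn.mono {f : ℂ → F} {S T : Set ℂ} (hf : HolOn f S) (h : T ⊆ S) : HolOn f T :=
  fun l => (hf l).mono h

lemma HolOn.linear {G : Type} [AddCommGroup G] [Module ℂ G] {f : ℂ → F} {S : Set ℂ}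
    (hf : HolOn f S) (L : F →ₗ[ℂ] G) : HolOn (fun z => L (f z)) S :=
  fun l => hf (l.comp L)

/-- A pointwise linear operator that maps constants to holomorphic maps preserves holomorphy. -/
lemma HolOn.apply {G : Type} [AddCommGroup G] [Module ℂ G] [Module.Finite ℂ F]
    {f : ℂ → F} {S : Set ℂ} (hf : HolOn f S) (L : ℂ → F →ₗ[ℂ] G)
    (hL : ∀ v, HolOn (fun z => L z v) S) : HolOn (fun z => L z (f z)) S := by
  let b := Module.finBasis ℂ F
  have h : ∀ z, L z (f z) = ∑ i, b.coord i (f z) • L z (b i) := fun z => by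
    conv_lhs => rw [← b.sum_repr (f z)]
    simp only [map_sum, map_smul, Module.Basis.coord_apply]
  simp only [h]
  exact HolOn.sum _ fun i _ => (hL (b i)).smul (hf (b.coord i))

lemma HolOn.mul {f g : ℂ → FibL} {S : Set ℂ} (hf : HolOn f S) (hg : HolOn g S) :
    HolOn (fun z => f z * g z) S :=
  hg.apply (fun z => LinearMap.mulLeft ℂ (f z)) fun v => hf.linear (LinearMap.mulRight ℂ v)

lemma HolOn.exteriorMap {f : ℂ → FibL} {S : Set ℂ} (hf : HolOn f S) (A : ℂ → FibE →ₗ[ℂ] FibE)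
    (hA : ∀ v, HolOn (fun z => A z v) S) :
    HolOn (fun z => ExteriorAlgebra.map (A z) (f z)) S := by
  refine hf.apply (fun z => (ExteriorAlgebra.map (A z)).toLinearMap) fun v => ?_
  induction v using ExteriorAlgebra.induction with
  | algebraMap r => simpa using holOn_const _ S
  | ι x => simpa using (hA x).linear (ExteriorAlgebra.ι ℂ)
  | mul a b ha hb => simpa using HolOn.mul ha hb
  | add a b ha hb => simpa using HolOn.add ha hb

/-- Holomorphy is local. -/
lemma holOn_of_local {f : ℂ → F} {S : Set ℂ}
    (h : ∀ z ∈ S, ∃ N : Set ℂ, IsOpen N ∧ z ∈ N ∧ HolOn f N) : HolOn f S := fun l z hz => by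
  obtain ⟨N, hN, hzN, hf⟩ := h z hz
  exact ((hf l).differentiableAt (hN.mem_nhds hzN)).differentiableWithinAt

end hol

lemma extendZero_of_mem {F : Type} [Zero F] {U : Opens CP1} (s : U → F) {p : CP1} (h : p ∈ U) :
    extendZero s p = s ⟨p, h⟩ := dif_pos h

/-- Sections of the structure sheaf `O = ⋀ E` of the split supermanifold `(k, k, k)` over `U`. -/
def StrSheaf (k : ℤ) (U : Opens CP1) : Subalgebra ℂ (U → FibL) where
  carrier := {s | IsHolSection scaleL k s}
  mul_mem' {s t} hs ht := by
    refine ⟨(hs.1.mul ht.1).congr fun z hz => ?_, (hs.2.mul ht.2).congr fun z hz => ?_⟩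
    · simp [extendZero_of_mem _ (show chartZero z ∈ U from hz)]
    · simp [extendZero_of_mem _ (show chartInf z ∈ U from hz), scaleL]
  add_mem' {s t} hs ht := by
    refine ⟨(hs.1.add ht.1).congr fun z hz => ?_, (hs.2.add ht.2).congr fun z hz => ?_⟩
    · simp [extendZero_of_mem _ (show chartZero z ∈ U from hz)]
    · simp [extendZero_of_mem _ (show chartInf z ∈ U from hz)]
  algebraMap_mem' c := by
    refine ⟨(holOn_const (algebraMap ℂ FibL c) _).congr fun z hz => ?_,
      (holOn_const (algebraMap ℂ FibL c) _).congr fun z hz => ?_⟩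
    · simp [extendZero_of_mem _ (show chartZero z ∈ U from hz)]
    · simp [extendZero_of_mem _ (show chartInf z ∈ U from hz), scaleL]

lemma isHolSection_of_local {F : Type} [AddCommGroup F] [Module ℂ F] (ρ : ℂ → F →ₗ[ℂ] F) (k : ℤ)
    {U : Opens CP1} (s : U → F)
    (h : ∀ p ∈ U, ∃ (V : Opens CP1) (_ : p ∈ V) (hV : V ≤ U),
      IsHolSection ρ k (fun q : V => s ⟨q, hV q.2⟩)) : IsHolSection ρ k s := by
  constructor
  · refine holOn_of_local fun z hz => ?_
    obtain ⟨V, hpV, hV, hs⟩ := h _ hz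
    refine ⟨_, V.isOpen.preimage continuous_chartZero, hpV, hs.1.congr fun w hw => ?_⟩
    rw [extendZero_of_mem _ (hV hw), extendZero_of_mem _ (show chartZero w ∈ V from hw)]
  · refine holOn_of_local fun z hz => ?_
    obtain ⟨V, hpV, hV, hs⟩ := h _ hz
    refine ⟨_, V.isOpen.preimage continuous_chartInf, hpV, hs.2.congr fun w hw => ?_⟩
    rw [extendZero_of_mem _ (hV hw), extendZero_of_mem _ (show chartInf w ∈ V from hw)]

lemma IsHolSection.restrict {F : Type} [AddCommGroup F] [Module ℂ F] {ρ : ℂ → F →ₗ[ℂ] F} {k : ℤ}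
    {U V : Opens CP1} (hV : V ≤ U) {s : U → F} (hs : IsHolSection ρ k s) :
    IsHolSection ρ k (fun q : V => s ⟨q, hV q.2⟩) := by
  refine ⟨(hs.1.mono (Set.preimage_mono hV)).congr fun w hw => ?_,
    (hs.2.mono (Set.preimage_mono hV)).congr fun w hw => ?_⟩
  · rw [extendZero_of_mem _ (hV hw), extendZero_of_mem _ (show chartZero w ∈ V from hw)]
  · rw [extendZero_of_mem _ (hV hw), extendZero_of_mem _ (show chartInf w ∈ V from hw)]

/-- Restriction of sections of the structure sheaf. -/
def res (k : ℤ) {U V : Opens CP1} (h : V ≤ U) : StrSheaf k U →ₐ[ℂ] StrSheaf k V where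
  toFun s := ⟨fun q => s.1 ⟨q, h q.2⟩, IsHolSection.restrict h s.2⟩
  map_one' := rfl
  map_mul' _ _ := rfl
  map_zero' := rfl
  map_add' _ _ := rfl
  commutes' _ := rfl

/-- The `q`-th graded piece `O_q = ⋀^q E` of the structure sheaf. -/
def StrDeg (k : ℤ) (q : ℕ) (U : Opens CP1) : Submodule ℂ (StrSheaf k U) where
  carrier := {f | ∀ x, f.1 x ∈ ⋀[ℂ]^q FibE}
  add_mem' hf hg x := add_mem (hf x) (hg x)
  zero_mem' _ := zero_mem _
  smul_mem' c _ hf x := Submodule.smul_mem _ c (hf x)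

/-- Sections over `U` of `T_p` (`p ≥ 0`): the vector fields of degree `p`, i.e. the `ℂ`-linear
endomorphisms `v` of the sheaf `O` restricted to `U`, given by a family of maps over all open
`W ≤ U` that commutes with restrictions, with `v (O_q) ⊆ O_{p + q}` and with the Leibniz rule
of super derivations `v (f g) = v(f) g + (-1)^(p q) f v(g)` for `f` of degree `q`. -/
def VecFields (k : ℤ) (p : ℕ) (U : Opens CP1) :
    Submodule ℂ (∀ W : {W : Opens CP1 // W ≤ U}, StrSheaf k W.1 →ₗ[ℂ] StrSheaf k W.1) where
  carrier := {v |
    (∀ (W W' : {W : Opens CP1 // W ≤ U}) (h : W'.1 ≤ W.1) (f : StrSheaf k W.1),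
      v W' (res k h f) = res k h (v W f)) ∧
    (∀ (W : {W : Opens CP1 // W ≤ U}) (q : ℕ), ∀ f ∈ StrDeg k q W.1,
      v W f ∈ StrDeg k (p + q) W.1) ∧
    (∀ (W : {W : Opens CP1 // W ≤ U}) (q : ℕ), ∀ f ∈ StrDeg k q W.1, ∀ g : StrSheaf k W.1,
      v W (f * g) = v W f * g + (-1 : ℂ) ^ (p * q) • (f * v W g))}
  add_mem' {v w} hv hw := by
    refine ⟨fun W W' h f => ?_, fun W q f hf => ?_, fun W q f hf g => ?_⟩
    · simp [hv.1 W W' h f, hw.1 W W' h f]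
    · exact add_mem (hv.2.1 W q f hf) (hw.2.1 W q f hf)
    · simp only [Pi.add_apply, LinearMap.add_apply, hv.2.2 W q f hf g, hw.2.2 W q f hf g,
        add_mul, mul_add, smul_add]
      abel
  zero_mem' := by
    refine ⟨fun W W' h f => ?_, fun W q f hf => ?_, fun W q f hf g => ?_⟩
    · simp
    · exact zero_mem _
    · simp
  smul_mem' c v hv := by
    refine ⟨fun W W' h f => ?_, fun W q f hf => ?_, fun W q f hf g => ?_⟩
    · simp [hv.1 W W' h f]
    · exact Submodule.smul_mem _ c (hv.2.1 W q f hf)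
    · simp only [Pi.smul_apply, LinearMap.smul_apply, hv.2.2 W q f hf g, smul_add,
        smul_mul_assoc, mul_smul_comm]
      rw [smul_comm]

instance (k : ℤ) (p : ℕ) (U : Opens CP1) : AddCommGroup (VecFields k p U) :=
  Module.addCommMonoidToAddCommGroup ℂ

/-- Restriction of vector fields. -/
def resVec (k : ℤ) (p : ℕ) {U V : Opens CP1} (h : V ≤ U) :
    VecFields k p U →ₗ[ℂ] VecFields k p V where
  toFun v := ⟨fun W => v.1 ⟨W.1, W.2.trans h⟩,
    fun W W' h' f => v.2.1 ⟨W.1, W.2.trans h⟩ ⟨W'.1, W'.2.trans h⟩ h' f,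
    fun W q f hf => v.2.2.1 ⟨W.1, W.2.trans h⟩ q f hf,
    fun W q f hf g => v.2.2.2 ⟨W.1, W.2.trans h⟩ q f hf g⟩
  map_add' _ _ := rfl
  map_smul' _ _ := rfl

/-- The presheaf `U ↦ T_p(U)` of abelian groups. -/
def vecPresheaf (k : ℤ) (p : ℕ) : TopCat.Presheaf AddCommGrpCat.{0} CP1 where
  obj U := AddCommGrpCat.of (VecFields k p U.unop)
  map f := AddCommGrpCat.ofHom (resVec k p f.unop.le).toAddMonoidHom
  map_id _ := rfl
  map_comp _ _ := rfl

section glue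

variable {k : ℤ} {p : ℕ} {ι : Type} {U : ι → Opens CP1} (v : ∀ i, VecFields k p (U i))

/-- Application of the local vector fields `v i` to a section over `W ≤ ⨆ i, U i`, evaluated at a
point. -/
def glueVal (W : {W : Opens CP1 // W ≤ iSup U}) (f : StrSheaf k W.1) (q : W.1) : FibL :=
  have h := Opens.mem_iSup.1 (W.2 q.2)
  ((v h.choose).1 ⟨W.1 ⊓ U h.choose, inf_le_right⟩ (res k inf_le_left f)).1
    ⟨q, q.2, h.choose_spec⟩

/-- Compatibility of the local vector fields `v i` on common open subsets. -/
def Compat : Prop := ∀ i j (W : Opens CP1) (hi : W ≤ U i) (hj : W ≤ U j),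
  (v i).1 ⟨W, hi⟩ = (v j).1 ⟨W, hj⟩


lemma glueVal_eq (hv : Compat v) (W : {W : Opens CP1 // W ≤ iSup U}) (f : StrSheaf k W.1) (q : W.1) (i : ι)
    (V : Opens CP1) (hVW : V ≤ W.1) (hVi : V ≤ U i) (hq : q.1 ∈ V) :
    glueVal v W f q = ((v i).1 ⟨V, hVi⟩ (res k hVW f)).1 ⟨q, hq⟩ := by
  have h := Opens.mem_iSup.1 (W.2 q.2)
  have e1 := (v h.choose).2.1 ⟨W.1 ⊓ U h.choose, inf_le_right⟩ ⟨V ⊓ U h.choose, inf_le_right⟩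
    (inf_le_inf_right _ hVW) (res k inf_le_left f)
  have e2 := (v i).2.1 ⟨V, hVi⟩ ⟨V ⊓ U h.choose, inf_le_left.trans hVi⟩ inf_le_left
    (res k hVW f)
  rw [hv i h.choose (V ⊓ U h.choose) (inf_le_left.trans hVi) inf_le_right] at e2
  exact (congrArg (fun s => s.1 ⟨q.1, hq, h.choose_spec⟩) e1).symm.trans
    (congrArg (fun s => s.1 ⟨q.1, hq, h.choose_spec⟩) e2)

lemma glueVal_mem (hv : Compat v) (W : {W : Opens CP1 // W ≤ iSup U}) (f : StrSheaf k W.1) :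
    IsHolSection scaleL k (glueVal v W f) := by
  refine isHolSection_of_local _ _ _ fun q hq => ?_
  obtain ⟨i, hi⟩ := Opens.mem_iSup.1 (W.2 hq)
  refine ⟨W.1 ⊓ U i, ⟨hq, hi⟩, inf_le_left, ?_⟩
  have e : (fun x : (W.1 ⊓ U i : Opens CP1) => glueVal v W f ⟨x, x.2.1⟩) =
      ((v i).1 ⟨W.1 ⊓ U i, inf_le_right⟩ (res k inf_le_left f)).1 :=
    funext fun x => glueVal_eq v hv W f _ i _ inf_le_left inf_le_right x.2
  exact e ▸ ((v i).1 ⟨W.1 ⊓ U i, inf_le_right⟩ (res k inf_le_left f)).2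

lemma glueVal_deg (hv : Compat v) (W : {W : Opens CP1 // W ≤ iSup U}) (q : ℕ)
    (f : StrSheaf k W.1) (hf : f ∈ StrDeg k q W.1) (x : W.1) :
    glueVal v W f x ∈ ⋀[ℂ]^(p + q) FibE := by
  obtain ⟨i, hi⟩ := Opens.mem_iSup.1 (W.2 x.2)
  rw [glueVal_eq v hv W f x i (W.1 ⊓ U i) inf_le_left inf_le_right ⟨x.2, hi⟩]
  exact (v i).2.2.1 ⟨W.1 ⊓ U i, inf_le_right⟩ q (res k inf_le_left f)
    (fun y => hf ⟨y.1, y.2.1⟩) ⟨x.1, x.2, hi⟩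

lemma glueVal_mul (hv : Compat v) (W : {W : Opens CP1 // W ≤ iSup U}) (q : ℕ)
    (f : StrSheaf k W.1) (hf : f ∈ StrDeg k q W.1) (g : StrSheaf k W.1) (x : W.1) :
    glueVal v W (f * g) x =
      glueVal v W f x * g.1 x + (-1 : ℂ) ^ (p * q) • (f.1 x * glueVal v W g x) := by
  obtain ⟨i, hi⟩ := Opens.mem_iSup.1 (W.2 x.2)
  have e := (v i).2.2.2 ⟨W.1 ⊓ U i, inf_le_right⟩ q (res k inf_le_left f)
    (fun y => hf ⟨y.1, y.2.1⟩) (res k inf_le_left g)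
  rw [← map_mul (res k inf_le_left)] at e
  rw [glueVal_eq v hv W f x i (W.1 ⊓ U i) inf_le_left inf_le_right ⟨x.2, hi⟩,
    glueVal_eq v hv W g x i (W.1 ⊓ U i) inf_le_left inf_le_right ⟨x.2, hi⟩,
    glueVal_eq v hv W (f * g) x i (W.1 ⊓ U i) inf_le_left inf_le_right ⟨x.2, hi⟩, e]
  rfl

/-- The linear maps underlying the vector field glued from a compatible family. -/
def glueLin (hv : Compat v) (W : {W : Opens CP1 // W ≤ iSup U}) :
    StrSheaf k W.1 →ₗ[ℂ] StrSheaf k W.1 where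
  toFun := fun f => ⟨glueVal v W f, glueVal_mem v hv W f⟩
  map_add' := fun f g => by
    ext q
    simp [glueVal]
  map_smul' := fun c f => by
    ext q
    simp [glueVal]

/-- The vector field glued from a compatible family. -/
def glue (hv : Compat v) : VecFields k p (iSup U) :=
  ⟨glueLin v hv, by
    refine ⟨fun W W' h f => ?_, fun W q f hf x => ?_, fun W q f hf g => ?_⟩
    · refine Subtype.ext (funext fun x => ?_)
      obtain ⟨i, hi⟩ := Opens.mem_iSup.1 (W'.2 x.2)
      have e1 := glueVal_eq v hv W' (res k h f) x i (W'.1 ⊓ U i) inf_le_left inf_le_right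
        ⟨x.2, hi⟩
      have e2 := glueVal_eq v hv W f ⟨x, h x.2⟩ i (W'.1 ⊓ U i)
          (inf_le_left.trans h) inf_le_right ⟨x.2, hi⟩
      exact e1.trans e2.symm
    · exact glueVal_deg v hv W q f hf x
    · exact Subtype.ext (funext fun x => glueVal_mul v hv W q f hf g x)⟩

lemma VecFields.ext_cover {v w : VecFields k p (iSup U)}
    (h : ∀ i, resVec k p (le_iSup U i) v = resVec k p (le_iSup U i) w) : v = w := by
  refine Subtype.ext (funext fun W => LinearMap.ext fun f => ?_)
  ext x
  obtain ⟨i, hi⟩ := Opens.mem_iSup.1 (W.2 x.2)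
  have e1 := v.2.1 W ⟨W.1 ⊓ U i, inf_le_left.trans W.2⟩ inf_le_left f
  have e2 := w.2.1 W ⟨W.1 ⊓ U i, inf_le_left.trans W.2⟩ inf_le_left f
  have e4 : v.1 ⟨W.1 ⊓ U i, inf_le_left.trans W.2⟩ = w.1 ⟨W.1 ⊓ U i, inf_le_left.trans W.2⟩ :=
    congrFun (congrArg Subtype.val (h i)) (⟨W.1 ⊓ U i, inf_le_right⟩ : {V // V ≤ U i})
  rw [e4] at e1
  exact (congrArg (fun s => s.1 ⟨x.1, x.2, hi⟩) (e1.symm.trans e2))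

end glue

lemma vecPresheaf_isSheaf (k : ℤ) (p : ℕ) : (vecPresheaf k p).IsSheaf := by
  rw [TopCat.Presheaf.isSheaf_iff_isSheaf_comp (forget AddCommGrpCat)]
  refine TopCat.Presheaf.isSheaf_of_isSheafUniqueGluing_types _ fun ι U sf hsf => ?_
  let v : ∀ i, VecFields k p (U i) := sf
  have hv : Compat v := fun i j W hi hj => by
    have e : resVec k p inf_le_left (v i) = resVec k p inf_le_right (v j) := hsf i j
    exact congrFun (congrArg Subtype.val e) (⟨W, le_inf hi hj⟩ : {V // V ≤ U i ⊓ U j})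
  have hg : ∀ i, resVec k p (le_iSup U i) (glue v hv) = v i := fun i => by
    refine Subtype.ext (funext fun W => LinearMap.ext fun f => ?_)
    ext x
    exact glueVal_eq v hv ⟨W.1, W.2.trans (le_iSup U i)⟩ f x i W.1 le_rfl W.2 x.2
  exact ⟨glue v hv, hg, fun w hw => VecFields.ext_cover fun i =>
    (show resVec k p (le_iSup U i) w = v i from hw i).trans (hg i).symm⟩

/-- The sheaf `T_p` of vector fields of degree `p` on the split supermanifold `(k, k, k)`. -/
def vecSheaf (k : ℤ) (p : ℕ) : Sheaf (Opens.grothendieckTopology CP1) AddCommGrpCat.{0} :=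
  ⟨vecPresheaf k p, vecPresheaf_isSheaf k p⟩

/-- The group `Aut E` of automorphisms of the holomorphic vector bundle `E` over the identity of
`CP1`: families of linear automorphisms of the fibres such that a local section is holomorphic
if and only if its image is. -/
def AutE (k : ℤ) : Subgroup (CP1 → (FibE ≃ₗ[ℂ] FibE)) where
  carrier := {A | ∀ (U : Opens CP1) (s : U → FibE),
    IsHolSection scaleE k (fun x => A x (s x)) ↔ IsHolSection scaleE k s}
  mul_mem' {A B} hA hB U s := (hA U fun x => B x (s x)).trans (hB U s)
  one_mem' _ _ := Iff.rfl
  inv_mem' {A} hA U s := by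
    rw [← hA U]
    simp

section autos

variable {k : ℤ}

/-- The matrix of an automorphism of `E` is holomorphic in the chart `U₀`. -/
lemma AutE.hol_zero (A : AutE k) (v : FibE) :
    HolOn (fun x => A.1 (chartZero x) v) Set.univ := by
  let U : Opens CP1 := ⟨{OnePoint.infty}ᶜ, isOpen_compl_singleton⟩
  have hU : ∀ x, chartZero x ∈ U := fun x => OnePoint.coe_ne_infty x
  have h := ((A.2 U fun _ => v).2 ?_).1
  · refine (h.mono fun x _ => hU x).congr fun x _ => ?_
    rw [extendZero_of_mem _ (hU x)]
  · refine ⟨(holOn_const v _).congr fun x hx => extendZero_of_mem _ hx, ?_⟩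
    have h0 : ∀ y, chartInf y ∈ U → y ≠ 0 := fun y hy h0 => hy (if_pos h0)
    have : HolOn (fun y : ℂ => y ^ (-k) • v) (chartInf ⁻¹' (U : Set CP1)) :=
      HolOn.smul (fun y hy => (differentiableAt_zpow.2 (Or.inl (h0 y hy))).differentiableWithinAt)
        (holOn_const v _)
    refine this.congr fun y hy => ?_
    rw [extendZero_of_mem _ (show chartInf y ∈ U from hy)]
    simp [scaleE, frameFactor, h0 y hy]

/-- The matrix of an automorphism of `E` is holomorphic in the chart `U₁`. -/
lemma AutE.hol_inf (A : AutE k) (v : FibE) :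
    HolOn (fun y => A.1 (chartInf y) v) Set.univ := by
  let U : Opens CP1 := ⟨{chartZero 0}ᶜ, isOpen_compl_singleton⟩
  have hU : ∀ y, chartInf y ∈ U := fun y hy => by
    by_cases h0 : y = 0
    · exact OnePoint.infty_ne_coe (0 : ℂ) ((if_pos h0).symm.trans hy)
    · have h1 : ((y⁻¹ : ℂ) : OnePoint ℂ) = ((0 : ℂ) : OnePoint ℂ) := (if_neg h0).symm.trans hy
      exact inv_ne_zero h0 (OnePoint.coe_injective h1)
  let c : OnePoint ℂ → ℂ := fun p => p.elim 1 (fun x : ℂ => x⁻¹ ^ k)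
  have hc : ∀ y, frameFactor k y * c (chartInf y) = 1 := fun y => by
    by_cases h0 : y = 0
    · subst h0
      have : c (chartInf 0) = 1 := by
        have : chartInf 0 = OnePoint.infty := if_pos rfl
        rw [this]
        rfl
      simp [this, frameFactor]
    · have h1 : chartInf y = ((y⁻¹ : ℂ) : OnePoint ℂ) := if_neg h0
      have : c (chartInf y) = y⁻¹⁻¹ ^ k := by rw [h1]; rfl
      rw [this, frameFactor, if_neg h0, inv_inv, zpow_neg,
        inv_mul_cancel₀ (zpow_ne_zero _ h0)]
  have h := ((A.2 U fun x => c x.1 • v).2 ?_).2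
  · refine (h.mono fun x _ => hU x).congr fun y _ => ?_
    rw [extendZero_of_mem _ (hU y)]
    simp [scaleE, smul_smul, mul_comm _ (frameFactor k y), hc]
  · constructor
    · have h0 : ∀ x, chartZero x ∈ U → x ≠ 0 := fun x hx h0 => hx (by rw [h0]; rfl)
      have : HolOn (fun x : ℂ => x⁻¹ ^ k • v) (chartZero ⁻¹' (U : Set CP1)) := by
        refine HolOn.smul (fun x hx => ?_) (holOn_const v _)
        simp only [inv_zpow']
        exact (differentiableAt_zpow.2 (Or.inl (h0 x hx))).differentiableWithinAt
      exact this.congr fun x hx => extendZero_of_mem _ hx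
    · refine (holOn_const v _).congr fun y hy => ?_
      rw [extendZero_of_mem _ (hU y)]
      simp [scaleE, smul_smul, mul_comm _ (frameFactor k y), hc]

lemma scaleL_comm (c : ℂ) (A : FibE ≃ₗ[ℂ] FibE) (f : FibL) :
    scaleL c (ExteriorAlgebra.map A.toLinearMap f) =
      ExteriorAlgebra.map A.toLinearMap (scaleL c f) := by
  have h : scaleE c ∘ₗ A.toLinearMap = A.toLinearMap ∘ₗ scaleE c := by
    ext; simp [scaleE]
  have h1 := congrArg (fun L => ExteriorAlgebra.map L f) h
  simp only [← ExteriorAlgebra.map_comp_map] at h1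
  exact h1

lemma AutE.isHolSection_map (A : AutE k) {U : Opens CP1} {s : U → FibL}
    (hs : IsHolSection scaleL k s) :
    IsHolSection scaleL k
      (fun x => ExteriorAlgebra.map (A.1 x).toLinearMap (s x)) := by
  constructor
  · refine (hs.1.exteriorMap (fun x => (A.1 (chartZero x)).toLinearMap)
      fun v => (AutE.hol_zero A v).mono (Set.subset_univ _)).congr fun x hx => ?_
    simp only [extendZero_of_mem _ (show chartZero x ∈ U from hx)]
  · refine (hs.2.exteriorMap (fun x => (A.1 (chartInf x)).toLinearMap)
      fun v => (AutE.hol_inf A v).mono (Set.subset_univ _)).congr fun x hx => ?_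
    simp only [extendZero_of_mem _ (show chartInf x ∈ U from hx), scaleL_comm]

/-- The action of an automorphism of `E` on the structure sheaf `⋀ E`. -/
def act (A : AutE k) (U : Opens CP1) : StrSheaf k U →ₐ[ℂ] StrSheaf k U where
  toFun f := ⟨fun x => ExteriorAlgebra.map (A.1 x).toLinearMap (f.1 x), AutE.isHolSection_map A f.2⟩
  map_one' := by ext; simp
  map_mul' _ _ := by ext; simp
  map_zero' := by ext; simp
  map_add' _ _ := by ext; simp
  commutes' c := by ext; simp

lemma act_mul (A B : AutE k) (U : Opens CP1) (f : StrSheaf k U) :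
    act (A * B) U f = act A U (act B U f) := by
  refine Subtype.ext (funext fun x => ?_)
  have h : ((A.1 x * B.1 x : FibE ≃ₗ[ℂ] FibE)).toLinearMap =
    (A.1 x).toLinearMap ∘ₗ (B.1 x).toLinearMap := rfl
  change ExteriorAlgebra.map ((A.1 x * B.1 x : FibE ≃ₗ[ℂ] FibE)).toLinearMap (f.1 x) = _
  rw [h, ← ExteriorAlgebra.map_comp_map]
  rfl

lemma act_one (U : Opens CP1) (f : StrSheaf k U) : act (1 : AutE k) U f = f := by
  refine Subtype.ext (funext fun x => ?_)
  have h : (1 : FibE ≃ₗ[ℂ] FibE).toLinearMap = LinearMap.id := rfl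
  change ExteriorAlgebra.map (1 : FibE ≃ₗ[ℂ] FibE).toLinearMap (f.1 x) = _
  rw [h, ExteriorAlgebra.map_id]
  rfl

lemma act_inv_act (A : AutE k) (U : Opens CP1) (f : StrSheaf k U) :
    act A U (act A⁻¹ U f) = f := by
  rw [← act_mul, mul_inv_cancel, act_one]

lemma act_mem (A : AutE k) (q : ℕ) (U : Opens CP1) {f : StrSheaf k U} (hf : f ∈ StrDeg k q U) :
    act A U f ∈ StrDeg k q U := fun x => by
  have h : (⋀[ℂ]^q FibE).map (ExteriorAlgebra.map (A.1 x).toLinearMap).toLinearMap ≤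
      ⋀[ℂ]^q FibE := by
    rw [ExteriorAlgebra.exteriorPower, Submodule.map_pow]
    refine pow_le_pow_left' ?_ q
    rintro _ ⟨_, ⟨v, rfl⟩, rfl⟩
    exact ⟨A.1 x v, by simp⟩
  exact h ⟨_, hf x, rfl⟩

/-- The action `Int A : v ↦ A v A⁻¹` on vector fields. -/
def intVec (A : AutE k) (p : ℕ) (U : Opens CP1) : VecFields k p U →ₗ[ℂ] VecFields k p U where
  toFun v := ⟨fun W =>
    (act A W.1).toLinearMap ∘ₗ v.1 W ∘ₗ (act A⁻¹ W.1).toLinearMap, by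
    refine ⟨fun W W' h f => ?_, fun W q f hf => ?_, fun W q f hf g => ?_⟩
    · exact congrArg (act A W'.1) (v.2.1 W W' h (act A⁻¹ W.1 f))
    · exact act_mem A _ _ (v.2.2.1 W q _ (act_mem A⁻¹ q _ hf))
    · have e := congrArg (act A W.1)
        (v.2.2.2 W q _ (act_mem A⁻¹ q _ hf) (act A⁻¹ W.1 g))
      rw [← map_mul (act A⁻¹ W.1), map_add, map_mul (act A W.1), map_smul,
        map_mul (act A W.1), act_inv_act, act_inv_act] at e
      exact e⟩
  map_add' v w := by
    refine Subtype.ext (funext fun W => LinearMap.ext fun f => ?_)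
    exact map_add (act A W.1) _ _
  map_smul' c v := by
    refine Subtype.ext (funext fun W => LinearMap.ext fun f => ?_)
    exact map_smul (act A W.1) _ _

end autos

/-- The endomorphism of the sheaf `T_p` given by a family of linear maps compatible with
restrictions. -/
def sheafEnd (k : ℤ) (p : ℕ) (L : ∀ U : Opens CP1, VecFields k p U →ₗ[ℂ] VecFields k p U)
    (hL : ∀ (U V : Opens CP1) (h : V ≤ U) (v : VecFields k p U),
      L V (resVec k p h v) = resVec k p h (L U v)) : vecSheaf k p ⟶ vecSheaf k p :=
  ⟨{ app := fun U => AddCommGrpCat.ofHom (L U.unop).toAddMonoidHom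
     naturality := fun _ _ f => by
      ext v
      exact hL _ _ f.unop.le v }⟩

lemma vecSheaf_hom_ext {k : ℤ} {p : ℕ} {f g : vecSheaf k p ⟶ vecSheaf k p}
    (h : ∀ (U : (Opens CP1)ᵒᵖ) (v : VecFields k p U.unop),
      (f.hom.app U).hom v = (g.hom.app U).hom v) : f = g := by
  refine ObjectProperty.hom_ext _ (NatTrans.ext (funext fun U => ?_))
  exact AddCommGrpCat.hom_ext (AddMonoidHom.ext fun v => h U v)

/-- Multiplication by `c : ℂ` on the sheaf `T_p`. -/
def scalarEnd (k : ℤ) (p : ℕ) (c : ℂ) : vecSheaf k p ⟶ vecSheaf k p :=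
  sheafEnd k p (fun _ => c • LinearMap.id) fun _ _ h v =>
    (map_smul (resVec k p h) c v).symm

/-- The automorphism `Int A` of the sheaf `T_p`. -/
def intEnd (k : ℤ) (p : ℕ) (A : AutE k) : vecSheaf k p ⟶ vecSheaf k p :=
  sheafEnd k p (intVec A p) fun _ _ _ _ => Subtype.ext rfl

/-- The cohomology group `H¹(CP1, T_2)`. -/
abbrev H1T2 (k : ℤ) : Type := Sheaf.H (vecSheaf k 2) 1

/-- The complex vector space structure of `H¹(CP1, T_2)`, induced by that of `T_2`. -/
instance (k : ℤ) : Module ℂ (H1T2 k) where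
  smul c x := Sheaf.H.map (scalarEnd k 2 c) 1 x
  one_smul x := by
    have h : scalarEnd k 2 1 = 𝟙 _ := by
      refine vecSheaf_hom_ext fun U v => ?_
      exact one_smul ℂ (v : VecFields k 2 U.unop)
    change Sheaf.H.map (scalarEnd k 2 1) 1 x = x
    rw [h, Sheaf.H.map_id_apply]
  mul_smul c d x := by
    have h : scalarEnd k 2 (c * d) = scalarEnd k 2 d ≫ scalarEnd k 2 c := by
      refine vecSheaf_hom_ext fun U v => ?_
      exact mul_smul c d (v : VecFields k 2 U.unop)
    change Sheaf.H.map (scalarEnd k 2 (c * d)) 1 x = _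
    rw [h, Sheaf.H.map_comp_apply]
    rfl
  smul_zero c := map_zero (Sheaf.H.map (scalarEnd k 2 c) 1)
  smul_add c := map_add (Sheaf.H.map (scalarEnd k 2 c) 1)
  add_smul c d x := by
    have h : scalarEnd k 2 (c + d) = scalarEnd k 2 c + scalarEnd k 2 d := by
      refine vecSheaf_hom_ext fun U v => ?_
      exact add_smul c d (v : VecFields k 2 U.unop)
    change Sheaf.H.map (scalarEnd k 2 (c + d)) 1 x = _
    rw [h, Sheaf.H.map_add_apply]
    rfl
  zero_smul x := by
    have h : scalarEnd k 2 0 = 0 := by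
      refine vecSheaf_hom_ext fun U v => ?_
      exact zero_smul ℂ (v : VecFields k 2 U.unop)
    change Sheaf.H.map (scalarEnd k 2 0) 1 x = 0
    rw [h, Sheaf.H.map_apply, Abelian.Ext.mk₀_zero, Abelian.Ext.comp_zero]

lemma intEnd_one (k : ℤ) (p : ℕ) : intEnd k p 1 = 𝟙 _ := by
  refine vecSheaf_hom_ext fun U v => ?_
  refine Subtype.ext (funext fun W => LinearMap.ext fun f => ?_)
  change act 1 W.1 (v.1 W (act 1⁻¹ W.1 f)) = v.1 W f
  rw [inv_one, act_one, act_one]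

lemma intEnd_mul (k : ℤ) (p : ℕ) (A B : AutE k) :
    intEnd k p (A * B) = intEnd k p B ≫ intEnd k p A := by
  refine vecSheaf_hom_ext fun U v => ?_
  refine Subtype.ext (funext fun W => LinearMap.ext fun f => ?_)
  change act (A * B) W.1 (v.1 W (act (A * B)⁻¹ W.1 f)) =
    act A W.1 (act B W.1 (v.1 W (act B⁻¹ W.1 (act A⁻¹ W.1 f))))
  rw [mul_inv_rev, act_mul, act_mul]

lemma intEnd_scalar (k : ℤ) (p : ℕ) (A : AutE k) (c : ℂ) :
    scalarEnd k p c ≫ intEnd k p A = intEnd k p A ≫ scalarEnd k p c :=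
  vecSheaf_hom_ext fun U v => map_smul (intVec A p U.unop) c v

/-- The linear automorphism of `H¹(CP1, T_2)` induced by `Int A`. -/
def intMap (k : ℤ) (A : AutE k) : H1T2 k →ₗ[ℂ] H1T2 k where
  toFun x := Sheaf.H.map (intEnd k 2 A) 1 x
  map_add' := map_add (Sheaf.H.map (intEnd k 2 A) 1)
  map_smul' c x := by
    change Sheaf.H.map (intEnd k 2 A) 1 (Sheaf.H.map (scalarEnd k 2 c) 1 x) =
      Sheaf.H.map (scalarEnd k 2 c) 1 (Sheaf.H.map (intEnd k 2 A) 1 x)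
    rw [← Sheaf.H.map_comp_apply, intEnd_scalar, Sheaf.H.map_comp_apply]

/-- The action `Int` of `Aut E` on `H¹(CP1, T_2)`, a representation of the group `Aut E`. -/
def intRep (k : ℤ) : Representation ℂ (AutE k) (H1T2 k) where
  toFun A := intMap k A
  map_one' := by
    refine LinearMap.ext fun x => ?_
    change Sheaf.H.map (intEnd k 2 1) 1 x = x
    rw [intEnd_one, Sheaf.H.map_id_apply]
  map_mul' A B := by
    refine LinearMap.ext fun x => ?_
    change Sheaf.H.map (intEnd k 2 (A * B)) 1 x =
      Sheaf.H.map (intEnd k 2 A) 1 (Sheaf.H.map (intEnd k 2 B) 1 x)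
    rw [intEnd_mul, Sheaf.H.map_comp_apply]

end SuperCP1

end

/-!
Write `ω = ξ_1 ξ_2 ξ_3`. On a chart with coordinate `x` and frame `ξ`, a vector field of degree two
is determined by its values on `x` and on the `ξ_i`. The first is a bivector, which is recorded by
the vector `f` with `v(x) ξ_i = f_i ω`; the others are multiples of the top form,
`v(ξ_i) = g_i ω`. Conversely every pair `(f, g)` of holomorphic `ℂ³`-valued functions occurs, so
that `T_2` is, over a chart, the sheaf of such pairs (`SuperChart.field`, `SuperChart.coords`,
`SuperChart.eq_of_coordinates`). By Liouville's theorem an automorphism `A` of `E` is a constant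
matrix (`autMatrix`). It multiplies `ω` by `det A`, hence it acts on bivectors, seen as row vectors
through their pairing with `E`, by `D_A = det A • A⁻ᵀ`; for the same reason `Int A` multiplies both
`f` and `g` by `D_A` in every chart (`SuperChart.coords_intVec`). The map `A ↦ D_A` is surjective
because `A = t • B⁻ᵀ` with `t² = det B` has `D_A = B`.

The first cohomology of `T_2` over each of the two standard charts vanishes. Sheaf cohomology is
here defined through `Ext` groups, so one embeds `T_2` into an injective sheaf and has to lift a
section of the quotient. The local lifts form a torsor under pairs of holomorphic functions on the
plane (`SuperChart.liftTorsor`), and every such torsor is trivial (`HolTorsor.nonempty_sec_top`):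
Cauchy integrals over the boundary of a rectangle solve the additive Cousin problem for two adjacent
rectangles, which yields sections near every compact rectangle, and approximation by entire
functions lets one pass to the limit over an exhaustion by discs. The Mayer–Vietoris sequence
(`connecting_surjective`, `connecting_eq_zero_iff`) then gives
`H¹(CP1, T_2) = T_2(U₀ ∩ U₁) / (T_2(U₀) + T_2(U₁))`.

In the coordinates of `U₀`, the elements of `T_2(U₁)` with coordinates `(F, G)` become
`(-x^(2-2k) F(1/x), x^(-2k) G(1/x) - k x^(1-2k) F(1/x))` (`transition`, `coords_zero_eq`). The
quotient is computed with Laurent expansions on the punctured plane. If `k ≥ 2`, each class contains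
exactly one cocycle `(P, (k/x) P + R)` in which `P` and `R` are polynomials in `1/x` without
constant term, of degrees at most `2k - 3` and `2k - 1` (`exists_isCoboundary_sub_cocycle`,
`eq_zero_of_isCoboundary_cocycle`). The term `(k/x) P` could be absorbed into `R`; it gives the
cocycle the shape of `transition`, where `-x^(2-2k) F` comes with `k/x` times itself. The
coefficients of `P` and `R` are `4k - 4` vectors of
`ℂ³`, the columns of the matrix of the class, and `D_A` acts on each of them since the shape of the
cocycle is preserved by constant matrices. If `k ≤ 1` every pair is a coboundary
(`isCoboundary_of_le_one`).
-/

/-! ### Cauchy integrals and the additive Cousin problem -/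

section

open Complex MeasureTheory Set Filter Topology

namespace SuperCP1

section Cauchy

variable {E : Type*} [NormedAddCommGroup E] [NormedSpace ℂ E]

lemma differentiableOn_cauchy_kernel_integral [CompleteSpace E] {a b : ℝ} {γ : ℝ → ℂ} {g : ℝ → E}
    (hγ : Continuous γ) (hg : ContinuousOn g (uIcc a b)) {V : Set ℂ} (hV : IsOpen V)
    (h : ∀ t ∈ uIcc a b, γ t ∉ V) :
    DifferentiableOn ℂ (fun z => ∫ t in a..b, (γ t - z)⁻¹ • g t) V := by
  intro z hz
  obtain ⟨δ, hδ, hball⟩ := Metric.isOpen_iff.1 hV z hz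
  have hne : ∀ w ∈ Metric.ball z (δ / 2), ∀ t ∈ uIcc a b, δ / 2 ≤ ‖γ t - w‖ := by
    intro w hw t ht
    by_contra! hlt
    refine h t ht (hball ?_)
    rw [Metric.mem_ball, dist_eq_norm] at *
    calc ‖γ t - z‖ = ‖(γ t - w) + (w - z)‖ := by ring_nf
      _ ≤ ‖γ t - w‖ + ‖w - z‖ := norm_add_le _ _
      _ < δ := by linarith
  have hne0 : ∀ w ∈ Metric.ball z (δ / 2), ∀ t ∈ uIcc a b, γ t - w ≠ 0 := fun w hw t ht h0 => by
    have := hne w hw t ht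
    rw [h0, norm_zero] at this
    linarith
  have hcont : ∀ w ∈ Metric.ball z (δ / 2),
      ContinuousOn (fun t => (γ t - w)⁻¹ • g t) (uIcc a b) := fun w hw =>
    ((hγ.continuousOn.sub continuousOn_const).inv₀ (hne0 w hw)).smul hg
  have hzb : z ∈ Metric.ball z (δ / 2) := Metric.mem_ball_self (half_pos hδ)
  obtain ⟨M, hM⟩ := isCompact_uIcc.exists_bound_of_continuousOn hg
  have key := intervalIntegral.hasDerivAt_integral_of_dominated_loc_of_deriv_le
    (𝕜 := ℂ) (μ := volume) (a := a) (b := b) (F := fun w t => (γ t - w)⁻¹ • g t)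
    (F' := fun w t => ((γ t - w) ^ 2)⁻¹ • g t) (x₀ := z) (s := Metric.ball z (δ / 2))
    (bound := fun _ => ((δ / 2) ^ 2)⁻¹ * M) (Metric.ball_mem_nhds z (half_pos hδ))
    ?_ ?_ ?_ ?_ ?_ ?_
  · exact key.2.differentiableAt.differentiableWithinAt
  · filter_upwards [Metric.ball_mem_nhds z (half_pos hδ)] with w hw
    exact ((hcont w hw).mono uIoc_subset_uIcc).aestronglyMeasurable measurableSet_uIoc
  · exact (hcont z hzb).intervalIntegrable
  · refine ContinuousOn.aestronglyMeasurable ?_ measurableSet_uIoc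
    exact ((((hγ.continuousOn.sub continuousOn_const).pow 2).inv₀
      fun t ht => pow_ne_zero 2 (hne0 z hzb t ht)).smul hg).mono uIoc_subset_uIcc
  · refine Eventually.of_forall fun t ht w hw => ?_
    rw [norm_smul, norm_inv, norm_pow]
    have := hne w hw t (uIoc_subset_uIcc ht)
    gcongr
    exact hM t (uIoc_subset_uIcc ht)
  · exact intervalIntegrable_const
  · refine Eventually.of_forall fun t ht w hw => ?_
    have h0 := hne0 w hw t (uIoc_subset_uIcc ht)
    have h1 : HasDerivAt (fun w => γ t - w) (-1) w := by
      simpa using (hasDerivAt_id w).const_sub (γ t)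
    simpa using (h1.fun_inv h0).smul_const (g t)

/-- The integral of `dw / w` along a segment which stays, after multiplication by `u`, in the
slit plane, is a difference of logarithms. -/
lemma integral_inv_segment {p q u : ℂ} (hu : u ≠ 0) {s t : ℝ}
    (h : ∀ r ∈ uIcc s t, u * (p + r * q) ∈ slitPlane) :
    ∫ r in s..t, (p + r * q)⁻¹ * q = log (u * (p + t * q)) - log (u * (p + s * q)) := by
  have hne : ∀ r ∈ uIcc s t, p + (r : ℂ) * q ≠ 0 := fun r hr h0 => by
    have := h r hr
    rw [h0, mul_zero] at this
    exact zero_notMem_slitPlane this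
  refine intervalIntegral.integral_eq_sub_of_hasDerivAt (f := fun r : ℝ => log (u * (p + r * q)))
    (fun r hr => ?_) ?_
  · have h1 : HasDerivAt (fun r : ℝ => u * (p + (r : ℂ) * q)) (u * q) r := by
      have := (((hasDerivAt_id r).ofReal_comp.mul_const q).const_add p).const_mul u
      simpa using this
    have h2 := h1.clog_real (h r hr)
    rwa [mul_div_mul_left _ _ hu, div_eq_inv_mul] at h2
  · refine ContinuousOn.intervalIntegrable (ContinuousOn.mul (ContinuousOn.inv₀ ?_ hne) ?_) <;>
      fun_prop

lemma log_I_mul_of_re_pos {w : ℂ} (h : 0 < w.re) : log (I * w) = log w + Real.pi / 2 * I := by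
  have h0 : w ≠ 0 := fun h0 => by simp [h0] at h
  have h1 := abs_lt.1 (abs_arg_lt_pi_div_two_iff.2 (Or.inl h))
  rw [mul_comm, log_mul h0 I_ne_zero, log_I]
  rw [arg_I]
  constructor <;> linarith [Real.pi_pos]

/-- The winding number of the boundary of a rectangle around an interior point. -/
lemma integral_boundary_rect_inv {a b c d : ℝ} (ha : a < 0) (hb : 0 < b) (hc : c < 0)
    (hd : 0 < d) :
    (∫ x : ℝ in a..b, ((x : ℂ) + c * I)⁻¹) - (∫ x : ℝ in a..b, ((x : ℂ) + d * I)⁻¹) +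
      I * (∫ y : ℝ in c..d, ((b : ℂ) + y * I)⁻¹) -
      I * (∫ y : ℝ in c..d, ((a : ℂ) + y * I)⁻¹) = 2 * Real.pi * I := by
  have e1 := integral_inv_segment (p := c * I) (q := 1) I_ne_zero (s := a) (t := b)
    fun r _ => Or.inl (by simpa using hc)
  have e2 := integral_inv_segment (p := d * I) (q := 1) (u := -I) (neg_ne_zero.2 I_ne_zero)
    (s := a) (t := b) fun r _ => Or.inl (by simpa using hd)
  have e3 := integral_inv_segment (p := b) (q := I) one_ne_zero (s := c) (t := d)
    fun r _ => Or.inl (by simpa using hb)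
  have e4 := integral_inv_segment (p := a) (q := I) (u := -1) (neg_ne_zero.2 one_ne_zero)
    (s := c) (t := d) fun r _ => Or.inl (by simpa using ha)
  simp only [mul_one] at e1 e2
  rw [intervalIntegral.integral_mul_const, mul_comm] at e3 e4
  rw [e3, e4]
  simp only [add_comm _ ((_ : ℂ) * I)]
  rw [e1, e2]
  have l1 := log_I_mul_of_re_pos (w := b + c * I) (by simpa using hb)
  have l2 := log_I_mul_of_re_pos (w := -I * (d * I + b)) (by simpa using hd)
  have l3 := log_I_mul_of_re_pos (w := -1 * (a + d * I)) (by simpa using ha)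
  have l4 := log_I_mul_of_re_pos (w := I * (c * I + a)) (by simpa using hc)
  have m2 : I * (-I * ((d : ℂ) * I + b)) = b + d * I := by linear_combination (-d * I - b) * I_sq
  have m3 : I * (-1 * ((a : ℂ) + d * I)) = -I * (d * I + a) := by ring
  have m4 : I * (I * ((c : ℂ) * I + a)) = -1 * (a + c * I) := by
    linear_combination (c * I + a) * I_sq
  rw [m2] at l2
  rw [m3] at l3
  rw [m4] at l4
  simp only [one_mul, add_comm ((_ : ℂ) * I)] at *
  rw [l1, l2, l3, l4]
  ring

/-- The Cauchy integral formula for a rectangle. -/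
lemma cauchy_formula_rect [CompleteSpace E] {a b c d : ℝ} {f : ℂ → E} {s : Set ℂ}
    (hs : IsOpen s) (hf : DifferentiableOn ℂ f s) (hsub : Icc a b ×ℂ Icc c d ⊆ s) {z : ℂ}
    (hz : z ∈ Ioo a b ×ℂ Ioo c d) :
    (∫ x : ℝ in a..b, ((x : ℂ) + c * I - z)⁻¹ • f (x + c * I)) -
      (∫ x : ℝ in a..b, ((x : ℂ) + d * I - z)⁻¹ • f (x + d * I)) +
      I • (∫ y : ℝ in c..d, ((b : ℂ) + y * I - z)⁻¹ • f (b + y * I)) -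
      I • (∫ y : ℝ in c..d, ((a : ℂ) + y * I - z)⁻¹ • f (a + y * I)) =
      (2 * Real.pi * I) • f z := by
  obtain ⟨⟨hza, hzb⟩, hzc, hzd⟩ := hz
  have hab : a ≤ b := (hza.trans hzb).le
  have hcd : c ≤ d := (hzc.trans hzd).le
  have hzs : z ∈ s := hsub ⟨⟨hza.le, hzb.le⟩, hzc.le, hzd.le⟩
  have hds : DifferentiableOn ℂ (dslope f z) s := (differentiableOn_dslope (hs.mem_nhds hzs)).2 hf
  have h0 := integral_boundary_rect_eq_zero_of_differentiableOn (dslope f z) (a + c * I)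
    (b + d * I) (hds.mono (by simpa [uIcc_of_le, hab, hcd] using hsub))
  have hw := integral_boundary_rect_inv (a := a - z.re) (b := b - z.re) (c := c - z.im)
    (d := d - z.im) (by linarith) (by linarith) (by linarith) (by linarith)
  simp only [add_re, ofReal_re, mul_re, I_re, mul_zero, ofReal_im, I_im, mul_one,
    add_zero, add_im, mul_im, zero_add, sub_self] at h0
  have hsplit : ∀ w : ℂ, w ∈ s → w ≠ z →
      (w - z)⁻¹ • f w = dslope f z w + (w - z)⁻¹ • f z := fun w _ hw => by
    rw [dslope_of_ne _ hw, slope_def_module, ← smul_add, sub_add_cancel]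
  -- On a boundary segment avoiding `z` the integral is split accordingly.
  have hseg : ∀ (p q : ℝ) (hpq : p ≤ q) (γ : ℝ → ℂ), Continuous γ → (∀ t ∈ Icc p q, γ t ∈ s) →
      (∀ t ∈ Icc p q, γ t ≠ z) → ∫ t in p..q, (γ t - z)⁻¹ • f (γ t) =
        (∫ t in p..q, dslope f z (γ t)) + (∫ t in p..q, (γ t - z)⁻¹) • f z := by
    intro p q hpq γ hγ hs hne
    rw [← intervalIntegral.integral_smul_const, ← intervalIntegral.integral_add]
    · refine intervalIntegral.integral_congr fun t ht => ?_
      rw [uIcc_of_le hpq] at ht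
      exact hsplit _ (hs t ht) (hne t ht)
    · refine ContinuousOn.intervalIntegrable ?_
      rw [uIcc_of_le hpq]
      exact hds.continuousOn.comp hγ.continuousOn hs
    · refine ContinuousOn.intervalIntegrable ?_
      rw [uIcc_of_le hpq]
      exact ((hγ.continuousOn.sub continuousOn_const).inv₀
        fun t ht => sub_ne_zero.2 (hne t ht)).smul continuousOn_const
  rw [hseg a b hab (fun x => x + c * I), hseg a b hab (fun x => x + d * I),
    hseg c d hcd (fun y => b + y * I), hseg c d hcd (fun y => a + y * I)]
  rotate_left
  iterate 4
    · fun_prop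
    · intro t ht
      exact hsub (by simp [mem_reProdIm, hab, hcd, ht.1, ht.2])
    · rintro t ht rfl
      simp at hza hzb hzc hzd
  have t1 : ∀ r : ℝ, (∫ x : ℝ in a..b, ((x : ℂ) + r * I - z)⁻¹) =
      ∫ x : ℝ in (a - z.re)..(b - z.re), ((x : ℂ) + (r - z.im : ℝ) * I)⁻¹ := fun r => by
    rw [← intervalIntegral.integral_comp_sub_right (fun x : ℝ => ((x : ℂ) + (r - z.im : ℝ) * I)⁻¹)]
    refine intervalIntegral.integral_congr fun x _ => ?_
    congr 1
    apply Complex.ext <;> simp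
  have t2 : ∀ r : ℝ, (∫ y : ℝ in c..d, ((r : ℂ) + y * I - z)⁻¹) =
      ∫ y : ℝ in (c - z.im)..(d - z.im), ((r - z.re : ℝ) + y * I : ℂ)⁻¹ := fun r => by
    rw [← intervalIntegral.integral_comp_sub_right (fun y : ℝ => ((r - z.re : ℝ) + y * I : ℂ)⁻¹)]
    refine intervalIntegral.integral_congr fun x _ => ?_
    congr 1
    apply Complex.ext <;> simp
  rw [t1, t1, t2, t2, ← hw]
  simp only [smul_add, smul_smul, add_smul, sub_smul]
  rw [← sub_eq_zero]
  refine Eq.trans ?_ h0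
  abel

/-- Two sets form a Cousin pair if every holomorphic function near their intersection is a
difference of holomorphic functions near each of the two sets. -/
def IsCousinPair (E : Type*) [NormedAddCommGroup E] [NormedSpace ℂ E] (K₁ K₂ : Set ℂ) : Prop :=
  ∀ (N : Set ℂ) (f : ℂ → E), IsOpen N → K₁ ∩ K₂ ⊆ N → DifferentiableOn ℂ f N →
    ∃ (V₁ V₂ : Set ℂ) (f₁ f₂ : ℂ → E), IsOpen V₁ ∧ IsOpen V₂ ∧ K₁ ⊆ V₁ ∧ K₂ ⊆ V₂ ∧
      DifferentiableOn ℂ f₁ V₁ ∧ DifferentiableOn ℂ f₂ V₂ ∧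
      ∀ z ∈ V₁ ∩ V₂, f z = f₁ z - f₂ z

lemma IsCousinPair.comp_mul {K₁ K₂ : Set ℂ} {u : ℂ} (hu : u ≠ 0)
    (h : IsCousinPair E K₁ K₂) : IsCousinPair E ((u * ·) ⁻¹' K₁) ((u * ·) ⁻¹' K₂) := by
  intro N f hN hsub hf
  have hc : Continuous (u⁻¹ * · : ℂ → ℂ) := by fun_prop
  have hc' : Continuous (u * · : ℂ → ℂ) := by fun_prop
  have hd : Differentiable ℂ (u⁻¹ * · : ℂ → ℂ) := by fun_prop
  have hd' : Differentiable ℂ (u * · : ℂ → ℂ) := by fun_prop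
  obtain ⟨V₁, V₂, f₁, f₂, hV₁, hV₂, hK₁, hK₂, hf₁, hf₂, he⟩ :=
    h ((u⁻¹ * ·) ⁻¹' N) (fun z => f (u⁻¹ * z)) (hN.preimage hc)
      (fun z hz => hsub (by simpa [hu] using hz))
      (hf.comp hd.differentiableOn fun z hz => hz)
  refine ⟨(u * ·) ⁻¹' V₁, (u * ·) ⁻¹' V₂, fun z => f₁ (u * z), fun z => f₂ (u * z),
    hV₁.preimage hc', hV₂.preimage hc', preimage_mono hK₁, preimage_mono hK₂,
    hf₁.comp hd'.differentiableOn fun z hz => hz, hf₂.comp hd'.differentiableOn fun z hz => hz,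
    fun z hz => ?_⟩
  simpa [hu] using he (u * z) hz

lemma IsCousinPair.mono {K₁ K₂ L₁ L₂ : Set ℂ} (h : IsCousinPair E K₁ K₂) (h₁ : L₁ ⊆ K₁)
    (h₂ : L₂ ⊆ K₂) (h₃ : K₁ ∩ K₂ ⊆ L₁ ∩ L₂) : IsCousinPair E L₁ L₂ := by
  intro N f hN hsub hf
  obtain ⟨V₁, V₂, f₁, f₂, hV₁, hV₂, hK₁, hK₂, h⟩ := h N f hN (h₃.trans hsub) hf
  exact ⟨V₁, V₂, f₁, f₂, hV₁, hV₂, h₁.trans hK₁, h₂.trans hK₂, h⟩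

lemma exists_closed_rect_subset {m c d : ℝ} (hcd : c ≤ d) {N : Set ℂ} (hN : IsOpen N)
    (h : {m} ×ℂ Icc c d ⊆ N) :
    ∃ ε > 0, Icc (m - ε) (m + ε) ×ℂ Icc (c - ε) (d + ε) ⊆ N := by
  have hK : IsCompact ({m} ×ℂ Icc c d) := isCompact_singleton.reProdIm isCompact_Icc
  obtain ⟨ε, hε, hsub⟩ := hK.exists_thickening_subset_open hN h
  refine ⟨ε / 3, by positivity, fun z hz => hsub ?_⟩
  obtain ⟨⟨h1, h2⟩, h3, h4⟩ := hz
  rw [Metric.mem_thickening_iff]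
  refine ⟨⟨m, max c (min d z.im)⟩, ⟨rfl, le_max_left _ _, max_le hcd (min_le_left _ _)⟩, ?_⟩
  rw [dist_eq_norm]
  refine (norm_le_abs_re_add_abs_im _).trans_lt ?_
  have a1 : |z.re - m| ≤ ε / 3 := abs_le.2 ⟨by linarith, by linarith⟩
  have a2 : |z.im - max c (min d z.im)| ≤ ε / 3 := by
    rcases le_total d z.im with hd | hd
    · rw [min_eq_left hd, max_eq_right hcd]
      exact abs_le.2 ⟨by linarith, by linarith⟩
    · rw [min_eq_right hd]
      rcases le_total c z.im with hc | hc
      · rw [max_eq_right hc, sub_self, abs_zero]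
        positivity
      · rw [max_eq_left hc]
        exact abs_le.2 ⟨by linarith, by linarith⟩
  simp only [sub_re, sub_im]
  linarith

/-- Two half strips meeting along a segment form a Cousin pair: the contour in Cauchy's formula
for a rectangle around the segment is cut into its left and its right half. -/
lemma isCousinPair_vertical [CompleteSpace E] (m : ℝ) {c d : ℝ} (hcd : c ≤ d) :
    IsCousinPair E (Iic m ×ℂ Icc c d) (Ici m ×ℂ Icc c d) := by
  intro N f hN hsub hf
  obtain ⟨ε, hε, hR⟩ := exists_closed_rect_subset (m := m) hcd hN
    fun z hz => hsub ⟨⟨hz.1.le, hz.2⟩, ⟨hz.1.ge, hz.2⟩⟩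
  have hcont : ∀ (p q : ℝ) (_ : p ≤ q) (γ : ℝ → ℂ), Continuous γ →
      (∀ t ∈ Icc p q, γ t ∈ N) → ContinuousOn (fun t => f (γ t)) (uIcc p q) := by
    intro p q hpq γ hγ h
    rw [uIcc_of_le hpq]
    exact hf.continuousOn.comp hγ.continuousOn h
  have hsmul : ∀ (p q : ℝ) (_ : p ≤ q) (γ : ℝ → ℂ), Continuous γ →
      (∀ t ∈ Icc p q, γ t ∈ N) → ∀ z, (∀ t ∈ Icc p q, γ t ≠ z) →
      IntervalIntegrable (fun t => (γ t - z)⁻¹ • f (γ t)) volume p q := by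
    intro p q hpq γ hγ h z hz
    refine (ContinuousOn.smul (ContinuousOn.inv₀ (by fun_prop) fun t ht => ?_)
      (hcont p q hpq γ hγ h)).intervalIntegrable
    rw [uIcc_of_le hpq] at ht
    exact sub_ne_zero.2 (hz t ht)
  have hhor : ∀ (r : ℝ), c - ε ≤ r → r ≤ d + ε → ∀ x ∈ Icc (m - ε) (m + ε),
      (x : ℂ) + r * I ∈ N := fun r h1 h2 x hx => hR (by simp [mem_reProdIm, h1, h2, hx.1, hx.2])
  have hver : ∀ (r : ℝ), m - ε ≤ r → r ≤ m + ε → ∀ y ∈ Icc (c - ε) (d + ε),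
      (r : ℂ) + y * I ∈ N := fun r h1 h2 y hy => hR (by simp [mem_reProdIm, h1, h2, hy.1, hy.2])
  have e1 : c - ε ≤ d + ε := by linarith
  have e2 : m - ε ≤ m := by linarith
  have e3 : m ≤ m + ε := by linarith
  have hor : ∀ (r p q : ℝ), c - ε ≤ r → r ≤ d + ε → p ≤ q → m - ε ≤ p → q ≤ m + ε →
      ∀ V : Set ℂ, IsOpen V → (∀ x ∈ Icc p q, (x : ℂ) + r * I ∉ V) →
      DifferentiableOn ℂ (fun z => ∫ x : ℝ in p..q, ((x : ℂ) + r * I - z)⁻¹ • f (x + r * I)) V :=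
    fun r p q h1 h2 h3 h4 h5 V hV h => differentiableOn_cauchy_kernel_integral (by fun_prop)
      (hcont p q h3 (fun x => x + r * I) (by fun_prop)
        fun t ht => hhor r h1 h2 t ⟨h4.trans ht.1, ht.2.trans h5⟩) hV
      (by rwa [uIcc_of_le h3])
  have ver : ∀ (r : ℝ), m - ε ≤ r → r ≤ m + ε →
      ∀ V : Set ℂ, IsOpen V → (∀ y ∈ Icc (c - ε) (d + ε), (r : ℂ) + y * I ∉ V) →
      DifferentiableOn ℂ (fun z => ∫ y : ℝ in (c - ε)..(d + ε),
        ((r : ℂ) + y * I - z)⁻¹ • f (r + y * I)) V :=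
    fun r h1 h2 V hV h => differentiableOn_cauchy_kernel_integral (by fun_prop)
      (hcont _ _ e1 (fun y => r + y * I) (by fun_prop) (hver r h1 h2)) hV
      (by rwa [uIcc_of_le e1])
  have hV₁ : IsOpen (Iio (m + ε) ×ℂ Ioo (c - ε) (d + ε)) := isOpen_Iio.reProdIm isOpen_Ioo
  have hV₂ : IsOpen (Ioi (m - ε) ×ℂ Ioo (c - ε) (d + ε)) := isOpen_Ioi.reProdIm isOpen_Ioo
  refine ⟨Iio (m + ε) ×ℂ Ioo (c - ε) (d + ε), Ioi (m - ε) ×ℂ Ioo (c - ε) (d + ε),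
    fun z => (2 * Real.pi * I)⁻¹ •
      ((∫ x : ℝ in m..(m + ε), ((x : ℂ) + (c - ε : ℝ) * I - z)⁻¹ • f (x + (c - ε : ℝ) * I)) -
      (∫ x : ℝ in m..(m + ε), ((x : ℂ) + (d + ε : ℝ) * I - z)⁻¹ • f (x + (d + ε : ℝ) * I)) +
      I • ∫ y : ℝ in (c - ε)..(d + ε),
        (((m + ε : ℝ) : ℂ) + y * I - z)⁻¹ • f ((m + ε : ℝ) + y * I)),
    fun z => -((2 * Real.pi * I)⁻¹ •
      ((∫ x : ℝ in (m - ε)..m, ((x : ℂ) + (c - ε : ℝ) * I - z)⁻¹ • f (x + (c - ε : ℝ) * I)) -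
      (∫ x : ℝ in (m - ε)..m, ((x : ℂ) + (d + ε : ℝ) * I - z)⁻¹ • f (x + (d + ε : ℝ) * I)) -
      I • ∫ y : ℝ in (c - ε)..(d + ε),
        (((m - ε : ℝ) : ℂ) + y * I - z)⁻¹ • f ((m - ε : ℝ) + y * I))),
    hV₁, hV₂, ?_, ?_, ?_, ?_, ?_⟩
  · rintro z ⟨h1, h2, h3⟩
    rw [mem_preimage, mem_Iic] at h1
    exact ⟨show z.re < _ by linarith, show _ < z.im by linarith, show z.im < _ by linarith⟩
  · rintro z ⟨h1, h2, h3⟩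
    rw [mem_preimage, mem_Ici] at h1
    exact ⟨show _ < z.re by linarith, show _ < z.im by linarith, show z.im < _ by linarith⟩
  · refine DifferentiableOn.const_smul (.add (.sub ?_ ?_) (.const_smul ?_ _)) _
    · exact hor _ _ _ le_rfl e1 e3 e2 le_rfl _ hV₁ fun x hx h => by simp [mem_reProdIm] at h
    · exact hor _ _ _ e1 le_rfl e3 e2 le_rfl _ hV₁ fun x hx h => by simp [mem_reProdIm] at h
    · exact ver _ (e2.trans e3) le_rfl _ hV₁ fun x hx h => by simp [mem_reProdIm] at h
  · refine DifferentiableOn.neg (.const_smul (.sub (.sub ?_ ?_) (.const_smul ?_ _)) _)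
    · exact hor _ _ _ le_rfl e1 e2 le_rfl e3 _ hV₂ fun x hx h => by simp [mem_reProdIm] at h
    · exact hor _ _ _ e1 le_rfl e2 le_rfl e3 _ hV₂ fun x hx h => by simp [mem_reProdIm] at h
    · exact ver _ le_rfl (e2.trans e3) _ hV₂ fun x hx h => by simp [mem_reProdIm] at h
  · rintro z ⟨⟨h1, h2⟩, h3, -⟩
    have key := cauchy_formula_rect hN hf hR (z := z) ⟨⟨h3, h1⟩, h2⟩
    have hint : ∀ (r p q : ℝ), c - ε ≤ r → r ≤ d + ε → p ≤ q → m - ε ≤ p → q ≤ m + ε → z.im ≠ r →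
        IntervalIntegrable (fun x : ℝ => ((x : ℂ) + r * I - z)⁻¹ • f (x + r * I)) volume p q :=
      fun r p q h1 h2 h3 h4 h5 h6 => hsmul p q h3 (fun x => x + r * I) (by fun_prop)
        (fun t ht => hhor r h1 h2 t ⟨h4.trans ht.1, ht.2.trans h5⟩) z
        fun t ht he => h6 (by simp [← he])
    have hpi : (2 * Real.pi * I : ℂ) ≠ 0 := by simp [Real.pi_ne_zero]
    rw [← intervalIntegral.integral_add_adjacent_intervals
        (hint (c - ε) _ _ le_rfl e1 e2 le_rfl e3 h2.1.ne')
        (hint (c - ε) _ _ le_rfl e1 e3 e2 le_rfl h2.1.ne'),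
      ← intervalIntegral.integral_add_adjacent_intervals
        (hint (d + ε) _ _ e1 le_rfl e2 le_rfl e3 h2.2.ne)
        (hint (d + ε) _ _ e1 le_rfl e3 e2 le_rfl h2.2.ne)] at key
    rw [sub_neg_eq_add, ← smul_add, eq_inv_smul_iff₀ hpi, ← key]
    abel

lemma isCousinPair_horizontal [CompleteSpace E] (m : ℝ) {a b : ℝ} (hab : a ≤ b) :
    IsCousinPair E (Icc a b ×ℂ Iic m) (Icc a b ×ℂ Ici m) := by
  have h := (isCousinPair_vertical (E := E) m (neg_le_neg hab)).comp_mul (neg_ne_zero.2 I_ne_zero)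
  convert h using 1 <;>
  · ext z
    simp [mem_reProdIm, and_comm]

end Cauchy
end SuperCP1

end

/-! ### Torsors under sheaves of holomorphic functions on the plane -/

section

open Complex MeasureTheory Set Filter Topology

namespace SuperCP1

/-- A torsor over `ℂ` under the sheaf of holomorphic functions with values in `E`: a sheaf of
sets `sec`, locally nonempty, on which holomorphic functions act transitively. The action of
`f : ℂ → E` only depends on the values of `f` on the open set considered. Neither freeness of the
action nor uniqueness of glued sections is required. -/
structure HolTorsor (E : Type) [NormedAddCommGroup E] [NormedSpace ℂ E] where
  sec : Opens ℂ → Type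
  res {V W : Opens ℂ} (h : V ≤ W) : sec W → sec V
  res_res {U V W : Opens ℂ} (h : U ≤ V) (h' : V ≤ W) (s : sec W) :
    res h (res h' s) = res (h.trans h') s
  act {W : Opens ℂ} (f : ℂ → E) (hf : DifferentiableOn ℂ f W) : sec W → sec W
  res_act {V W : Opens ℂ} (h : V ≤ W) (f : ℂ → E) (hf : DifferentiableOn ℂ f W) (s : sec W) :
    res h (act f hf s) = act f (hf.mono h) (res h s)
  act_act {W : Opens ℂ} (f g : ℂ → E) (hf : DifferentiableOn ℂ f W)
    (hg : DifferentiableOn ℂ g W) (s : sec W) : act f hf (act g hg s) = act (f + g) (hf.add hg) s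
  act_congr {W : Opens ℂ} (f g : ℂ → E) (hf : DifferentiableOn ℂ f W)
    (hg : DifferentiableOn ℂ g W) (h : EqOn f g W) (s : sec W) : act f hf s = act g hg s
  exists_act {W : Opens ℂ} (s t : sec W) : ∃ f, ∃ hf : DifferentiableOn ℂ f W, act f hf s = t
  exists_glue {ι : Type} (U : ι → Opens ℂ) (s : ∀ i, sec (U i))
    (h : ∀ i j, res (inf_le_left : U i ⊓ U j ≤ U i) (s i) = res inf_le_right (s j)) :
    ∃ t : sec (iSup U), ∀ i, res (le_iSup U i) t = s i
  locally_nonempty (z : ℂ) : ∃ W : Opens ℂ, z ∈ W ∧ Nonempty (sec W)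

namespace HolTorsor

variable {E : Type} [NormedAddCommGroup E] [NormedSpace ℂ E] (T : HolTorsor E)

/-- The torsor has a section in a neighbourhood of the set `K`. -/
def TrivialNear (K : Set ℂ) : Prop := ∃ W : Opens ℂ, K ⊆ W ∧ Nonempty (T.sec W)

variable {T}

lemma TrivialNear.mono {K L : Set ℂ} (h : T.TrivialNear L) (hKL : K ⊆ L) : T.TrivialNear K :=
  let ⟨W, hW, hs⟩ := h
  ⟨W, hKL.trans hW, hs⟩

/-- Sections near the members of a Cousin pair differ by a holomorphic function near the
intersection; once it is split, the two sections can be corrected so that they glue. -/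
lemma TrivialNear.union {K₁ K₂ : Set ℂ} (hK : IsCousinPair E K₁ K₂) (h₁ : T.TrivialNear K₁)
    (h₂ : T.TrivialNear K₂) : T.TrivialNear (K₁ ∪ K₂) := by
  obtain ⟨W₁, hW₁, ⟨s₁⟩⟩ := h₁
  obtain ⟨W₂, hW₂, ⟨s₂⟩⟩ := h₂
  obtain ⟨f, hf, hfs⟩ := T.exists_act (T.res (inf_le_right : W₁ ⊓ W₂ ≤ W₂) s₂)
    (T.res inf_le_left s₁)
  obtain ⟨V₁, V₂, f₁, f₂, hV₁, hV₂, hKV₁, hKV₂, hf₁, hf₂, he⟩ :=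
    hK (W₁ ⊓ W₂ : Opens ℂ) f (W₁ ⊓ W₂).isOpen (inter_subset_inter hW₁ hW₂) hf
  let U : Bool → Opens ℂ := fun b => bif b then W₁ ⊓ ⟨V₁, hV₁⟩ else W₂ ⊓ ⟨V₂, hV₂⟩
  have d₁ : DifferentiableOn ℂ (-f₁) (W₁ ⊓ ⟨V₁, hV₁⟩ : Opens ℂ) :=
    hf₁.neg.mono inter_subset_right
  have d₂ : DifferentiableOn ℂ (-f₂) (W₂ ⊓ ⟨V₂, hV₂⟩ : Opens ℂ) :=
    hf₂.neg.mono inter_subset_right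
  let s : ∀ b, T.sec (U b) := fun b => match b with
    | true => T.act (-f₁) d₁ (T.res inf_le_left s₁)
    | false => T.act (-f₂) d₂ (T.res inf_le_left s₂)
  have hcompat : ∀ (V : Opens ℂ) (h1 : V ≤ U true) (h2 : V ≤ U false),
      T.res h1 (s true) = T.res h2 (s false) := by
    intro V h1 h2
    have h12 : V ≤ W₁ ⊓ W₂ := le_inf (h1.trans inf_le_left) (h2.trans inf_le_left)
    have e := congrArg (T.res h12) hfs
    rw [T.res_act, T.res_res, T.res_res] at e
    change T.res h1 (T.act (-f₁) d₁ (T.res inf_le_left s₁)) =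
      T.res h2 (T.act (-f₂) d₂ (T.res inf_le_left s₂))
    rw [T.res_act, T.res_act, T.res_res, T.res_res, ← e, T.act_act]
    refine T.act_congr _ _ _ _ (fun z hz => ?_) _
    have := he z ⟨(h1 hz).2, (h2 hz).2⟩
    simp only [Pi.add_apply, Pi.neg_apply, this]
    abel
  obtain ⟨t, -⟩ := T.exists_glue U s (by
    rintro (_ | _) (_ | _)
    · rfl
    · exact (hcompat _ _ _).symm
    · exact hcompat _ _ _
    · rfl)
  refine ⟨iSup U, union_subset (fun z hz => ?_) (fun z hz => ?_), ⟨t⟩⟩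
  · exact Opens.mem_iSup.2 ⟨true, hW₁ hz, hKV₁ hz⟩
  · exact Opens.mem_iSup.2 ⟨false, hW₂ hz, hKV₂ hz⟩

/-- A property of closed intervals that holds locally and is inherited by the union of two
adjacent intervals holds for all closed intervals. -/
lemma Icc_induction_of_local {P : Set ℝ → Prop} (hmono : ∀ s t, s ⊆ t → P t → P s)
    (hunion : ∀ a b c : ℝ, a ≤ b → b ≤ c → P (Icc a b) → P (Icc b c) → P (Icc a c))
    (hloc : ∀ x : ℝ, ∃ U, IsOpen U ∧ x ∈ U ∧ P U) {a b : ℝ} (hab : a ≤ b) : P (Icc a b) := by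
  choose U hU hxU hPU using hloc
  obtain ⟨t, ht0, htm, ⟨m, hm⟩, ht⟩ := exists_monotone_Icc_subset_open_cover_Icc hab
    (c := fun x : ℝ => (Subtype.val : Icc a b → ℝ) ⁻¹' (U x))
    (fun x => (hU x).preimage continuous_subtype_val)
    (fun x _ => mem_iUnion.2 ⟨x.1, hxU x.1⟩)
  have step : ∀ n, P (Icc (t n : ℝ) (t (n + 1))) := fun n => by
    obtain ⟨x, hx⟩ := ht n
    refine hmono _ _ (fun y hy => ?_) (hPU x)
    exact hx (a := ⟨y, (t n).2.1.trans hy.1, hy.2.trans (t (n + 1)).2.2⟩) ⟨hy.1, hy.2⟩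
  have all : ∀ n, P (Icc a (t n)) := fun n => by
    induction n with
    | zero =>
      refine hmono _ _ ?_ (hPU a)
      rw [ht0, Icc_self, singleton_subset_iff]
      exact hxU a
    | succ n ih => exact hunion _ _ _ (t n).2.1 (htm n.le_succ) ih (step n)
  have := all m
  rwa [hm m le_rfl] at this

/-- Sections exist near every rectangle: locally nonempty along the vertical segments, they are
glued first in the vertical and then in the horizontal direction. -/
lemma trivialNear_rect [CompleteSpace E] {a b c d : ℝ} (hab : a ≤ b) (hcd : c ≤ d) :
    T.TrivialNear (Icc a b ×ℂ Icc c d) := by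
  refine Icc_induction_of_local (P := fun s => T.TrivialNear (s ×ℂ Icc c d))
    (fun s t hst h => h.mono (reProdIm_subset_iff.2 (prod_mono hst subset_rfl))) ?_ ?_ hab
  · intro a b e hab hbe h₁ h₂
    refine (TrivialNear.union ?_ h₁ h₂).mono ?_
    · refine (isCousinPair_vertical b hcd).mono (fun z hz => ⟨hz.1.2, hz.2⟩)
        (fun z hz => ⟨hz.1.1, hz.2⟩) ?_
      rintro z ⟨⟨h1, h2⟩, h3, -⟩
      exact ⟨⟨⟨hab.trans h3, h1⟩, h2⟩, ⟨⟨h3, le_trans h1 hbe⟩, h2⟩⟩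
    · rintro z ⟨⟨h1, h2⟩, h3⟩
      rcases le_total z.re b with h | h
      · exact Or.inl ⟨⟨h1, h⟩, h3⟩
      · exact Or.inr ⟨⟨h, h2⟩, h3⟩
  · intro x
    have hx : T.TrivialNear ({x} ×ℂ Icc c d) := by
      refine Icc_induction_of_local (P := fun s => T.TrivialNear ({x} ×ℂ s))
        (fun s t hst h => h.mono (reProdIm_subset_iff.2 (prod_mono subset_rfl hst))) ?_ ?_ hcd
      · intro a b e hab hbe h₁ h₂
        refine (TrivialNear.union ?_ h₁ h₂).mono ?_
        · refine (isCousinPair_horizontal b (le_refl x)).mono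
            (fun z hz => ⟨⟨hz.1.ge, hz.1.le⟩, hz.2.2⟩)
            (fun z hz => ⟨⟨hz.1.ge, hz.1.le⟩, hz.2.1⟩) ?_
          rintro z ⟨⟨h1, h2⟩, h3, h4⟩
          have hzx : z.re = x := le_antisymm h1.2 h1.1
          exact ⟨⟨hzx, hab.trans h4, h2⟩, ⟨hzx, h4, le_trans h2 hbe⟩⟩
        · rintro z ⟨h1, h2, h3⟩
          rcases le_total z.im b with h | h
          · exact Or.inl ⟨h1, h2, h⟩
          · exact Or.inr ⟨h1, h, h3⟩
      · intro y
        obtain ⟨W, hzW, hs⟩ := T.locally_nonempty ⟨x, y⟩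
        have hc : Continuous fun t : ℝ => (⟨x, t⟩ : ℂ) :=
          equivRealProdCLM.symm.continuous.comp (Continuous.prodMk_right x)
        refine ⟨(fun t : ℝ => (⟨x, t⟩ : ℂ)) ⁻¹' W, W.isOpen.preimage hc, hzW, W, ?_, hs⟩
        rintro z ⟨h1, h2⟩
        have h3 : (⟨z.re, z.im⟩ : ℂ) ∈ W := (show z.re = x from h1) ▸ h2
        exact h3
    obtain ⟨W, hW, hs⟩ := hx
    have hc : Continuous fun p : ℝ × ℝ => (⟨p.1, p.2⟩ : ℂ) :=
      equivRealProdCLM.symm.continuous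
    obtain ⟨u, v, hu, -, hxu, hv, huv⟩ := generalized_tube_lemma (isCompact_singleton (x := x))
      (isCompact_Icc (a := c) (b := d)) (W.isOpen.preimage hc)
      fun p hp => hW (show (⟨p.1, p.2⟩ : ℂ) ∈ _ from hp)
    refine ⟨u, hu, hxu rfl, W, ?_, hs⟩
    rintro z ⟨h1, h2⟩
    exact huv (a := (z.re, z.im)) ⟨h1, hv h2⟩

/-- A holomorphic function on a disc can be approximated by entire functions on a smaller
concentric disc. -/
lemma exists_entire_approx [CompleteSpace E] {r R : ℝ} (hr : 0 < r) (hrR : r < R) {f : ℂ → E}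
    (hf : DifferentiableOn ℂ f (Metric.ball 0 R)) {ε : ℝ} (hε : 0 < ε) :
    ∃ p : ℂ → E, Differentiable ℂ p ∧ ∀ z ∈ Metric.ball 0 r, ‖f z - p z‖ ≤ ε := by
  obtain ⟨R', hrR', hR'⟩ := exists_between hrR
  lift R' to NNReal using (hr.trans hrR').le
  lift r to NNReal using hr.le
  have hR0 : 0 < R' := by exact_mod_cast hr.trans hrR'
  have hfp := (hf.mono (Metric.closedBall_subset_ball hR')).hasFPowerSeriesOnBall hR0
  have hu := hfp.tendstoUniformlyOn (r' := r) (by exact_mod_cast hrR')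
  obtain ⟨n, hn⟩ := (Metric.tendstoUniformlyOn_iff.1 hu ε hε).exists
  refine ⟨(cauchyPowerSeries f 0 R').partialSum n, ?_, fun z hz => ?_⟩
  rotate_left
  · have := (hn z hz).le
    rw [zero_add, dist_eq_norm] at this
    exact this
  · unfold FormalMultilinearSeries.partialSum
    simp only [FormalMultilinearSeries.apply_eq_pow_smul_coeff]
    fun_prop

variable (T) in
/-- Every torsor under the sheaf of holomorphic functions on the complex plane is trivial. -/
theorem nonempty_sec_top [CompleteSpace E] : Nonempty (T.sec ⊤) := by
  let B : ℕ → Opens ℂ := fun n => ⟨Metric.ball 0 (n + 1), Metric.isOpen_ball⟩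
  have hB : ∀ {m n}, m ≤ n → B m ≤ B n := fun h =>
    Metric.ball_subset_ball (by exact_mod_cast Nat.succ_le_succ h)
  have hs : ∀ n, Nonempty (T.sec (B n)) := fun n => by
    obtain ⟨W, hW, ⟨s⟩⟩ := T.trivialNear_rect (a := -(n + 1)) (b := n + 1) (c := -(n + 1))
      (d := n + 1) (by linarith [n.cast_nonneg (α := ℝ)]) (by linarith [n.cast_nonneg (α := ℝ)])
    refine ⟨T.res (fun z hz => hW ?_) s⟩
    have hz : ‖z‖ < n + 1 := by simpa [B] using hz
    exact ⟨abs_le.1 ((abs_re_le_norm z).trans hz.le), abs_le.1 ((abs_im_le_norm z).trans hz.le)⟩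
  let s := fun n => (hs n).some
  choose f hf hfs using fun n => T.exists_act (s n) (T.res (hB n.le_succ) (s (n + 1)))
  -- The function `f (n + 1)`, holomorphic on the ball of radius `n + 2`, is approximated by the
  -- entire `p n` on the ball of radius `n + 1`, up to an error `h n`. As `f (n + 1) = p n + h n`,
  -- the sections `s (n + 1)` become compatible once corrected by the tails `u n` of `∑ h` and by
  -- the partial sums `P n` of `∑ p`.
  choose p hp hfp using fun n : ℕ => exists_entire_approx (r := n + 1) (R := (n + 1 : ℕ) + 1)
    (by positivity) (by push_cast; linarith) (hf (n + 1)) (ε := (1 / 2) ^ n) (by positivity)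
  let h : ℕ → ℂ → E := fun n z => f (n + 1) z - p n z
  have hd : ∀ n, DifferentiableOn ℂ (h n) (B n) := fun n =>
    ((hf (n + 1)).mono (hB n.le_succ)).sub (hp n).differentiableOn
  let P : ℕ → ℂ → E := fun n z => ∑ m ∈ Finset.range n, p m z
  have hP : ∀ n, Differentiable ℂ (P n) := fun n => Differentiable.fun_sum fun m _ => hp m
  let u : ℕ → ℂ → E := fun n z => ∑' m, h (n + m) z
  have hbound : ∀ n m, ∀ z ∈ B n, ‖h (n + m) z‖ ≤ (1 / 2) ^ m := fun n m z hz =>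
    (hfp (n + m) z (hB (n.le_add_right m) hz)).trans
      (pow_le_pow_of_le_one (by norm_num) (by norm_num) (Nat.le_add_left m n))
  have hsum : Summable fun m : ℕ => ((1 : ℝ) / 2) ^ m := summable_geometric_two
  have hu : ∀ n, DifferentiableOn ℂ (u n) (B n) := fun n =>
    differentiableOn_tsum_of_summable_norm hsum
      (fun m => (hd (n + m)).mono (hB (n.le_add_right m))) (B n).isOpen (hbound n)
  have hrec : ∀ n, ∀ z ∈ B n, u n z = h n z + u (n + 1) z := fun n z hz => by
    have := (Summable.of_norm_bounded hsum fun m => hbound n m z hz).tsum_eq_zero_add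
    refine this.trans ?_
    simp only [add_zero, u, add_assoc, add_comm 1]
  let t : ∀ n, T.sec (B n) := fun n =>
    T.act (u n - P n) ((hu n).sub (hP n).differentiableOn) (T.res (hB n.le_succ) (s (n + 1)))
  have hstep : ∀ n, T.res (hB n.le_succ) (t (n + 1)) = t n := fun n => by
    have e := congrArg (T.res (hB n.le_succ)) (hfs (n + 1))
    rw [T.res_act, T.res_res] at e
    simp only [t]
    rw [T.res_act, T.res_res, ← e, T.act_act]
    refine T.act_congr _ _ _ _ (fun z hz => ?_) _
    simp only [Pi.add_apply, Pi.sub_apply, hrec n z hz, h, P, Finset.sum_range_succ]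
    abel
  have hle : ∀ n m (hnm : n ≤ m), T.res (hB hnm) (t m) = t n := fun n m hnm => by
    induction m, hnm using Nat.le_induction with
    | base =>
      have := congrArg (T.res (le_refl (B n))) (hstep n)
      rw [T.res_res] at this
      rw [← hstep n, T.res_res]
    | succ m hm ih => rw [← ih, ← hstep m, T.res_res]
  obtain ⟨r, -⟩ := T.exists_glue B t fun i j => by
    rcases le_total i j with hij | hij
    · rw [← hle i j hij, T.res_res]
    · rw [← hle j i hij, T.res_res]
  refine ⟨T.res (fun z _ => ?_) r⟩
  obtain ⟨n, hn⟩ := exists_nat_gt ‖z‖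
  exact Opens.mem_iSup.2 ⟨n, by simpa [B] using hn.trans (lt_add_one _)⟩

end HolTorsor
end SuperCP1

end

/-! ### Laurent decompositions on the punctured plane -/

section

open Complex MeasureTheory Set Filter Topology

namespace SuperCP1

section Laurent

variable {E : Type*} [NormedAddCommGroup E] [NormedSpace ℂ E]

/-- The Cauchy integral formula for an annulus. -/
lemma cauchy_formula_annulus [CompleteSpace E] {f : ℂ → E}
    (hf : DifferentiableOn ℂ f {0}ᶜ) {r R : ℝ}
    (hr : 0 < r) {z : ℂ} (hrz : r < ‖z‖) (hzR : ‖z‖ < R) :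
    (2 * Real.pi * I) • f z =
      (∮ w in C(0, R), (w - z)⁻¹ • f w) - ∮ w in C(0, r), (w - z)⁻¹ • f w := by
  have hz0 : z ≠ 0 := norm_pos_iff.1 (hr.trans hrz)
  have hds : DifferentiableOn ℂ (dslope f z) {0}ᶜ :=
    (differentiableOn_dslope (isOpen_compl_singleton.mem_nhds hz0)).2 hf
  have hR : 0 < R := hr.trans (hrz.trans hzR)
  have h0 := circleIntegral_eq_of_differentiable_on_annulus_off_countable (c := 0) hr
    (hrz.trans hzR).le (s := ∅) countable_empty (f := dslope f z)
    (hds.continuousOn.mono fun w hw h => by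
      rw [mem_singleton_iff.1 h] at hw
      exact hw.2 (Metric.mem_ball_self hr))
    (fun w hw => hds.differentiableAt (isOpen_compl_singleton.mem_nhds fun h => by
      rw [mem_singleton_iff.1 h] at hw
      exact hw.1.2 (Metric.mem_closedBall_self hr.le)))
  -- On a circle avoiding `z` the integral of the difference quotient is split.
  have hsplit : ∀ ρ : ℝ, 0 < ρ → ρ ≠ ‖z‖ → (∮ w in C(0, ρ), (w - z)⁻¹ • f w) =
      (∮ w in C(0, ρ), dslope f z w) + (∮ w in C(0, ρ), (w - z)⁻¹) • f z := by
    intro ρ hρ hne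
    have hS : ∀ w ∈ Metric.sphere (0 : ℂ) ρ, w ≠ z ∧ w ≠ 0 := fun w hw => by
      rw [mem_sphere_zero_iff_norm] at hw
      exact ⟨fun h => hne (by rw [← hw, h]), norm_pos_iff.1 (hw ▸ hρ)⟩
    rw [← circleIntegral.integral_smul_const, ← circleIntegral.integral_add]
    · refine circleIntegral.integral_congr hρ.le fun w hw => ?_
      simp only [dslope_of_ne _ (hS w hw).1, slope_def_module, ← smul_add, sub_add_cancel]
    · exact (hds.continuousOn.mono fun w hw => (hS w hw).2).circleIntegrable hρ.le
    · exact (((continuousOn_id.sub continuousOn_const).inv₀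
        fun w hw => sub_ne_zero.2 (hS w hw).1).smul continuousOn_const).circleIntegrable hρ.le
  have hin : (∮ w in C(0, r), (w - z)⁻¹) = 0 := by
    refine circleIntegral_eq_zero_of_differentiable_on_off_countable hr.le countable_empty
      (ContinuousOn.inv₀ (by fun_prop) fun w hw => ?_) fun w hw => ?_
    · rintro h
      rw [sub_eq_zero.1 h, mem_closedBall_zero_iff] at hw
      linarith
    · refine DifferentiableAt.fun_inv (by fun_prop) fun h => ?_
      rw [sub_eq_zero.1 h] at hw
      have := mem_ball_zero_iff.1 hw.1
      linarith
  rw [hsplit R hR hzR.ne', hsplit r hr hrz.ne, h0, hin,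
    circleIntegral.integral_sub_inv_of_mem_ball (mem_ball_zero_iff.2 hzR)]
  simp

/-- A holomorphic function on the punctured plane is the sum of an entire function of `x` and of
an entire function of `1 / x`. -/
lemma exists_laurent_split [CompleteSpace E] {f : ℂ → E} (hf : DifferentiableOn ℂ f {0}ᶜ) :
    ∃ f₀ F : ℂ → E, Differentiable ℂ f₀ ∧ Differentiable ℂ F ∧ F 0 = 0 ∧
      ∀ x, x ≠ 0 → f x = f₀ x + F x⁻¹ := by
  have hpi : (2 * Real.pi * I : ℂ) ≠ 0 := by simp [Real.pi_ne_zero]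
  let A : ℝ → ℂ → E := fun R z => (2 * Real.pi * I : ℂ)⁻¹ • ∮ w in C(0, R), (w - z)⁻¹ • f w
  have hint : ∀ R : ℝ, 0 < R → CircleIntegrable f 0 R := fun R hR =>
    (hf.continuousOn.mono fun w hw h => by
      rw [mem_singleton_iff.1 h, mem_sphere_zero_iff_norm, norm_zero] at hw
      linarith).circleIntegrable hR.le
  have hA : ∀ R : ℝ, 0 < R → DifferentiableOn ℂ (A R) (Metric.ball 0 R) := fun R hR => by
    lift R to NNReal using hR.le
    have := (hasFPowerSeriesOn_cauchy_integral (hint R hR) (by exact_mod_cast hR)).differentiableOn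
    rwa [Metric.eball_coe] at this
  have hform : ∀ (r R : ℝ) (z : ℂ), 0 < r → r < ‖z‖ → ‖z‖ < R → f z = A R z - A r z := by
    intro r R z hr h1 h2
    rw [← smul_sub, ← cauchy_formula_annulus hf hr h1 h2, inv_smul_smul₀ hpi]
  -- The Cauchy integrals over circles around `z` agree.
  have hind : ∀ (z : ℂ) (R R' : ℝ), ‖z‖ < R → R ≤ R' → A R' z = A R z := by
    intro z R R' h1 h2
    have hR : 0 < R := (norm_nonneg z).trans_lt h1
    have hne : ∀ w : ℂ, R ≤ ‖w‖ → w - z ≠ 0 ∧ w ≠ 0 := fun w hw =>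
      ⟨fun h => by rw [sub_eq_zero.1 h] at hw; linarith, norm_pos_iff.1 (hR.trans_le hw)⟩
    have hd : ∀ w : ℂ, R ≤ ‖w‖ → DifferentiableAt ℂ (fun w => (w - z)⁻¹ • f w) w := fun w hw =>
      (((differentiableAt_id (x := w)).sub_const z).fun_inv (hne w hw).1).smul
        (hf.differentiableAt (x := w) (isOpen_compl_singleton.mem_nhds (hne w hw).2))
    simp only [A]
    rw [circleIntegral_eq_of_differentiable_on_annulus_off_countable hR h2 countable_empty]
    · intro w hw
      refine (hd w ?_).continuousAt.continuousWithinAt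
      simpa using hw.2
    · intro w hw
      refine hd w ?_
      have := hw.1.2
      rw [mem_closedBall_zero_iff, not_le] at this
      exact this.le
  let f₀ : ℂ → E := fun z => A (‖z‖ + 1) z
  have hf₀ : ∀ R : ℝ, 0 < R → ∀ z ∈ Metric.ball (0 : ℂ) R, f₀ z = A R z := fun R hR z hz => by
    rw [mem_ball_zero_iff] at hz
    rcases le_total R (‖z‖ + 1) with h | h
    · exact hind z R _ hz h
    · exact (hind z _ R (lt_add_one _) h).symm
  have hd₀ : Differentiable ℂ f₀ := fun z => by
    have hz : z ∈ Metric.ball (0 : ℂ) (‖z‖ + 1) := by simp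
    have hR : 0 < ‖z‖ + 1 := by positivity
    exact ((hA _ hR).congr (hf₀ _ hR)).differentiableAt (Metric.isOpen_ball.mem_nhds hz)
  -- The remaining part is the Cauchy integral over the unit circle, which decays at infinity.
  have hrem : ∀ z : ℂ, 1 < ‖z‖ → f z - f₀ z = -A 1 z := fun z hz => by
    rw [hform 1 (‖z‖ + 1) z one_pos hz (lt_add_one _)]
    simp [f₀]
  obtain ⟨M, hM⟩ := (isCompact_sphere (0 : ℂ) 1).exists_bound_of_continuousOn
    (hf.continuousOn.mono fun w hw h => by
      rw [mem_singleton_iff.1 h, mem_sphere_zero_iff_norm, norm_zero] at hw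
      exact zero_ne_one hw)
  have hM0 : 0 ≤ M := (norm_nonneg _).trans (hM 1 (by simp))
  have hbd : ∀ z : ℂ, 1 < ‖z‖ → ‖A 1 z‖ ≤ (‖z‖ - 1)⁻¹ * M := fun z hz => by
    have := circleIntegral.norm_two_pi_i_inv_smul_integral_le_of_norm_le_const (c := 0)
      (R := 1) (f := fun w => (w - z)⁻¹ • f w) (C := (‖z‖ - 1)⁻¹ * M) zero_le_one
      fun w hw => by
        rw [norm_smul, norm_inv]
        have h1 : ‖z‖ - 1 ≤ ‖w - z‖ := by
          have := norm_sub_norm_le z w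
          rw [mem_sphere_zero_iff_norm.1 hw, norm_sub_rev] at this
          exact this
        have h2 : 0 < ‖z‖ - 1 := by linarith
        gcongr
        exact hM w hw
    simpa [A] using this
  let F : ℂ → E := Function.update (fun y => f y⁻¹ - f₀ y⁻¹) 0 0
  have hF0 : F 0 = 0 := Function.update_self ..
  have hFne : ∀ y, y ≠ 0 → F y = f y⁻¹ - f₀ y⁻¹ := fun y hy => Function.update_of_ne hy ..
  have hFd : ∀ y : ℂ, y ≠ 0 → DifferentiableAt ℂ F y := fun y hy => by
    have h1 : DifferentiableAt ℂ (fun y => f y⁻¹ - f₀ y⁻¹) y := by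
      refine DifferentiableAt.sub ?_ ?_
      · exact (hf.differentiableAt (isOpen_compl_singleton.mem_nhds (inv_ne_zero hy))).comp y
          (differentiableAt_inv hy)
      · exact (hd₀ _).comp y (differentiableAt_inv hy)
    refine h1.congr_of_eventuallyEq ?_
    filter_upwards [isOpen_ne.mem_nhds hy] with w hw using hFne w hw
  have hFc : ContinuousAt F 0 := by
    rw [continuousAt_iff_punctured_nhds, hF0]
    have hinv : Tendsto (fun y : ℂ => ‖y⁻¹‖) (𝓝[≠] 0) atTop :=
      tendsto_norm_inv_nhdsNE_zero_atTop
    have hlim : Tendsto (fun y : ℂ => (‖y⁻¹‖ - 1)⁻¹ * M) (𝓝[≠] 0) (𝓝 0) := by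
      have := (tendsto_inv_atTop_zero.comp (tendsto_atTop_add_const_right _ (-1) hinv)).mul_const M
      simpa [sub_eq_add_neg] using this
    refine squeeze_zero_norm' ?_ hlim
    filter_upwards [self_mem_nhdsWithin, hinv.eventually_gt_atTop 1] with y hy hy1
    rw [hFne y hy, hrem _ hy1, norm_neg]
    exact hbd _ hy1
  refine ⟨f₀, F, hd₀, fun y => ?_, hF0, fun x hx => ?_⟩
  · by_cases hy : y = 0
    · subst hy
      refine AnalyticAt.differentiableAt
        (analyticAt_of_differentiable_on_punctured_nhds_of_continuousAt ?_ hFc)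
      filter_upwards [self_mem_nhdsWithin] with y hy using hFd y hy
    · exact hFd y hy
  · rw [hFne _ (inv_ne_zero hx), inv_inv]
    abel

lemma exists_eq_smul_of_apply_zero [CompleteSpace E] {F : ℂ → E} (hF : Differentiable ℂ F)
    (h0 : F 0 = 0) :
    ∃ G : ℂ → E, Differentiable ℂ G ∧ ∀ y, F y = y • G y := by
  refine ⟨dslope F 0, fun y => ?_, fun y => ?_⟩
  · exact ((differentiableOn_dslope (s := univ) univ_mem).2 hF.differentiableOn).differentiableAt
      univ_mem
  · simpa [h0] using (sub_smul_dslope F 0 y).symm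

/-- The Taylor expansion of an entire function at zero, with remainder. -/
lemma exists_taylor [CompleteSpace E] (n : ℕ) {F : ℂ → E} (hF : Differentiable ℂ F) :
    ∃ (c : Fin n → E) (G : ℂ → E), Differentiable ℂ G ∧
      ∀ y, F y = ∑ j : Fin n, y ^ (j : ℕ) • c j + y ^ n • G y := by
  induction n with
  | zero => exact ⟨Fin.elim0, F, hF, fun y => by simp⟩
  | succ n ih =>
    obtain ⟨c, G, hG, h⟩ := ih
    obtain ⟨G', hG', h'⟩ := exists_eq_smul_of_apply_zero (F := fun y => G y - G 0)
      (hG.sub_const _) (sub_self _)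
    refine ⟨Fin.snoc c (G 0), G', hG', fun y => ?_⟩
    have e : G y = G 0 + y • G' y := by rw [← h' y]; abel
    rw [h y, Fin.sum_univ_castSucc]
    simp only [Fin.val_castSucc, Fin.snoc_castSucc, Fin.val_last, Fin.snoc_last]
    rw [e, smul_add, smul_smul, pow_succ, add_assoc]

/-- The Laurent expansion on the punctured plane, with only finitely many coefficients made
explicit. -/
lemma exists_laurent [CompleteSpace E] (n : ℕ) {f : ℂ → E} (hf : DifferentiableOn ℂ f {0}ᶜ) :
    ∃ (f₀ : ℂ → E) (c : Fin n → E) (F : ℂ → E), Differentiable ℂ f₀ ∧ Differentiable ℂ F ∧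
      ∀ x, x ≠ 0 → f x = f₀ x + ∑ j : Fin n, x⁻¹ ^ (j + 1 : ℕ) • c j + x⁻¹ ^ (n + 1) • F x⁻¹ := by
  obtain ⟨f₀, F, hf₀, hF, hF0, h⟩ := exists_laurent_split hf
  obtain ⟨G, hG, hFG⟩ := exists_eq_smul_of_apply_zero hF hF0
  obtain ⟨c, H, hH, hGH⟩ := exists_taylor n hG
  refine ⟨f₀, c, H, hf₀, hH, fun x hx => ?_⟩
  rw [h x hx, hFG, hGH, smul_add, Finset.smul_sum]
  simp only [smul_smul, ← pow_succ', add_assoc]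

lemma eq_zero_of_taylor_eq_zero (n : ℕ) {c : Fin n → E} {F : ℂ → E} (hF : Continuous F)
    (h : ∀ y, y ≠ 0 → ∑ j : Fin n, y ^ (j : ℕ) • c j + y ^ n • F y = 0) : c = 0 := by
  induction n with
  | zero => exact Subsingleton.elim _ _
  | succ n ih =>
    have hc : Continuous fun y : ℂ =>
        ∑ j : Fin (n + 1), y ^ (j : ℕ) • c j + y ^ (n + 1) • F y := by fun_prop
    have h0 : c 0 = 0 := by
      have h1 : ∑ j : Fin (n + 1), (0 : ℂ) ^ (j : ℕ) • c j + (0 : ℂ) ^ (n + 1) • F 0 = 0 :=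
        congrFun (hc.ext_on (dense_compl_singleton (0 : ℂ)) continuous_const
          fun y hy => h y hy) 0
      simpa [Fin.sum_univ_succ] using h1
    have h1 : (fun j => c (Fin.succ j)) = 0 := ih fun y hy => by
      have := h y hy
      simp only [Fin.sum_univ_succ, h0, smul_zero, zero_add, Fin.val_succ, pow_succ', mul_smul,
        ← Finset.smul_sum, ← smul_add] at this
      exact (smul_eq_zero.1 this).resolve_left hy
    funext j
    exact Fin.cases h0 (congrFun h1) j

/-- Uniqueness of the Laurent expansion: by Liouville's theorem an entire function of `x` which
is an entire function of `1 / x` vanishing at `∞` is zero. -/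
lemma laurent_unique [CompleteSpace E] (n : ℕ) {f₀ : ℂ → E} {c : Fin n → E} {F : ℂ → E}
    (hf₀ : Differentiable ℂ f₀) (hF : Differentiable ℂ F)
    (h : ∀ x, x ≠ 0 → f₀ x = ∑ j : Fin n, x⁻¹ ^ (j + 1 : ℕ) • c j + x⁻¹ ^ (n + 1) • F x⁻¹) :
    c = 0 ∧ f₀ = 0 := by
  have hc : Continuous fun y : ℂ => ∑ j : Fin n, y ^ (j + 1 : ℕ) • c j + y ^ (n + 1) • F y := by
    have := hF.continuous
    fun_prop
  have hlim : Tendsto f₀ (cocompact ℂ) (𝓝 0) := by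
    have h1 := (hc.tendsto 0).comp (tendsto_inv₀_cobounded (α := ℂ))
    rw [Metric.cobounded_eq_cocompact] at h1
    simp only [ne_eq, Nat.add_eq_zero_iff, one_ne_zero, and_false,
      not_false_eq_true, zero_pow, zero_smul, Finset.sum_const_zero, add_zero] at h1
    refine h1.congr' ?_
    have : ({0}ᶜ : Set ℂ) ∈ cocompact ℂ := (isCompact_singleton (x := (0 : ℂ))).compl_mem_cocompact
    filter_upwards [this] with x hx using (h x hx).symm
  have hz : f₀ = 0 := funext fun x => hf₀.apply_eq_of_tendsto_cocompact x hlim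
  refine ⟨eq_zero_of_taylor_eq_zero n hF.continuous fun y hy => ?_, hz⟩
  have := h y⁻¹ (inv_ne_zero hy)
  simp only [hz, Pi.zero_apply, inv_inv, pow_succ', mul_smul, ← Finset.smul_sum,
    ← smul_add] at this
  exact (smul_eq_zero.1 this.symm).resolve_left hy

end Laurent
end SuperCP1

end

/-! ### First cohomology of abelian sheaves through free sheaves -/

noncomputable section

open Limits Abelian

namespace SuperCP1

section Cohomology

variable {X : TopCat.{0}}

/-- The abelian sheaf freely generated by a section over `U`; it represents `F ↦ F(U)`. -/
abbrev freeSheaf (U : Opens X) : Sheaf (Opens.grothendieckTopology X) AddCommGrpCat.{0} :=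
  (presheafToSheaf (Opens.grothendieckTopology X) AddCommGrpCat.{0}).obj
    (yoneda.obj U ⋙ AddCommGrpCat.free)

variable {F G : Sheaf (Opens.grothendieckTopology X) AddCommGrpCat.{0}}

/-- The morphisms from the free sheaf on `U` to `F` are the sections of `F` over `U`. -/
def homFreeEquiv (U : Opens X) (F : Sheaf (Opens.grothendieckTopology X) AddCommGrpCat.{0}) :
    (freeSheaf U ⟶ F) ≃ F.obj.obj (op U) :=
  (((sheafificationAdjunction _ _).homEquiv _ _).trans
    ((AddCommGrpCat.adj.whiskerRight (Opens X)ᵒᵖ).homEquiv _ _)).trans yonedaEquiv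

/-- The tautological section of the free sheaf on `U`. -/
def freeGen (U : Opens X) : (freeSheaf U).obj.obj (op U) := homFreeEquiv U _ (𝟙 _)

lemma homFreeEquiv_comp (U : Opens X) (f : freeSheaf U ⟶ F) (g : F ⟶ G) :
    homFreeEquiv U G (f ≫ g) = (g.hom.app (op U)).hom (homFreeEquiv U F f) := by
  rfl

lemma homFreeEquiv_eq (U : Opens X) (f : freeSheaf U ⟶ F) :
    homFreeEquiv U F f = (f.hom.app (op U)).hom (freeGen U) := by
  rw [freeGen, ← homFreeEquiv_comp, Category.id_comp]

lemma homFreeEquiv_add (U : Opens X) (f g : freeSheaf U ⟶ F) :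
    homFreeEquiv U F (f + g) = homFreeEquiv U F f + homFreeEquiv U F g := by
  simp only [homFreeEquiv_eq]
  rfl

/-- The morphism of free sheaves induced by an inclusion of open sets. -/
abbrev freeMap {U V : Opens X} (i : U ⟶ V) : freeSheaf U ⟶ freeSheaf V :=
  (presheafToSheaf _ _).map (Functor.whiskerRight (yoneda.map i) _)

lemma homFreeEquiv_freeMap {U V : Opens X} (i : U ⟶ V) (f : freeSheaf V ⟶ F) :
    homFreeEquiv U F (freeMap i ≫ f) = (F.obj.map i.op).hom (homFreeEquiv V F f) := by
  have e₁ : (sheafificationAdjunction _ _).homEquiv _ _ (freeMap i ≫ f) =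
      Functor.whiskerRight (yoneda.map i) AddCommGrpCat.free ≫
        (sheafificationAdjunction (Opens.grothendieckTopology X) _).homEquiv _ _ f :=
    Adjunction.homEquiv_naturality_left _ _ _
  have e₂ := (AddCommGrpCat.adj.whiskerRight (Opens X)ᵒᵖ).homEquiv_naturality_left (yoneda.map i)
    ((sheafificationAdjunction (Opens.grothendieckTopology X) _).homEquiv _ _ f)
  refine (congrArg (fun g => yonedaEquiv ((AddCommGrpCat.adj.whiskerRight (Opens X)ᵒᵖ).homEquiv
    _ _ g)) e₁).trans ((congrArg yonedaEquiv e₂).trans ?_)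
  exact (yonedaEquiv_naturality _ _).symm

/-- The constant sheaf `ℤ` is the free sheaf on the whole space. -/
def constIsoFree (X : TopCat.{0}) :
    (constantSheaf (Opens.grothendieckTopology X) AddCommGrpCat.{0}).obj
      (AddCommGrpCat.of (ULift ℤ)) ≅ freeSheaf (⊤ : Opens X) :=
  (presheafToSheaf (Opens.grothendieckTopology X) AddCommGrpCat.{0}).mapIso
    (NatIso.ofComponents (fun V =>
      letI : Unique (V.unop ⟶ (⊤ : Opens X)) := ⟨⟨homOfLE le_top⟩, fun _ => Subsingleton.elim _ _⟩
      (AddEquiv.ulift.trans (FreeAbelianGroup.uniqueEquiv (V.unop ⟶ ⊤)).symm).toAddCommGrpIso)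
      (fun f => by
        ext n
        exact (map_zsmul (FreeAbelianGroup.map (yoneda.obj (⊤ : Opens X) |>.map f))
          n.down (FreeAbelianGroup.of (homOfLE le_top))).symm))

/-- If every section over `U` of a quotient of an embedding of `F` lifts, then `H¹(U, F) = 0`. -/
lemma ext_freeSheaf_eq_zero (U : Opens X)
    (h : ∀ S : ShortComplex (Sheaf (Opens.grothendieckTopology X) AddCommGrpCat.{0}),
      S.ShortExact → S.X₁ = F → Function.Surjective (S.g.hom.app (op U)).hom)
    (x : Ext (freeSheaf U) F 1) : x = 0 := by
  let S : ShortComplex (Sheaf (Opens.grothendieckTopology X) AddCommGrpCat.{0}) :=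
    ShortComplex.mk (Injective.ι F) (cokernel.π (Injective.ι F)) (cokernel.condition _)
  have hS : S.ShortExact :=
    { exact := ShortComplex.exact_cokernel _
      mono_f := inferInstanceAs (Mono (Injective.ι F))
      epi_g := inferInstanceAs (Epi (cokernel.π (Injective.ι F))) }
  have : Injective S.X₂ := inferInstanceAs (Injective (Injective.under F))
  obtain ⟨q, hq⟩ := Ext.covariant_sequence_exact₁ _ hS x (Ext.eq_zero_of_injective _) (n₀ := 0) rfl
  obtain ⟨q, rfl⟩ := (Ext.mk₀_bijective _ _).2 q
  obtain ⟨s, hs⟩ := h S hS rfl (homFreeEquiv U _ q)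
  have e : q = (homFreeEquiv U _).symm s ≫ S.g := by
    apply (homFreeEquiv U _).injective
    rw [homFreeEquiv_comp, Equiv.apply_symm_apply]
    exact hs.symm
  rw [← hq, e, ← Ext.mk₀_comp_mk₀, Ext.comp_assoc_of_second_deg_zero, hS.comp_extClass,
    Ext.comp_zero]

variable {U₀ U₁ : Opens X} (hU : U₀ ⊔ U₁ = ⊤)

/-- The Mayer-Vietoris square of a cover by two open sets. -/
def mvSquare : (Opens.grothendieckTopology X).MayerVietorisSquare :=
  Opens.mayerVietorisSquare'
    { X₁ := U₀ ⊓ U₁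
      X₂ := U₀
      X₃ := U₁
      X₄ := ⊤
      f₁₂ := homOfLE inf_le_left
      f₁₃ := homOfLE inf_le_right
      f₂₄ := homOfLE le_top
      f₃₄ := homOfLE le_top
      fac := Subsingleton.elim _ _ } hU.symm rfl

/-- The class of the extension `0 → ℤ[U₀ ∩ U₁] → ℤ[U₀] ⊞ ℤ[U₁] → ℤ[X] → 0`. -/
def mvClass : Ext (freeSheaf (⊤ : Opens X)) (freeSheaf (U₀ ⊓ U₁)) 1 :=
  (mvSquare hU).shortComplex_shortExact.extClass

lemma mvClass_comp_eq_zero_iff (f : freeSheaf (U₀ ⊓ U₁) ⟶ F) :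
    (mvClass hU).comp (Ext.mk₀ f) (add_zero 1) = 0 ↔
      ∃ (f₀ : freeSheaf U₀ ⟶ F) (f₁ : freeSheaf U₁ ⟶ F),
        f = freeMap (homOfLE inf_le_left) ≫ f₀ - freeMap (homOfLE inf_le_right) ≫ f₁ := by
  have hg : ∀ (f₀ : freeSheaf U₀ ⟶ F) (f₁ : freeSheaf U₁ ⟶ F),
      (biprod.lift (freeMap (homOfLE inf_le_left)) (-freeMap (homOfLE inf_le_right)) :
        freeSheaf (U₀ ⊓ U₁) ⟶ freeSheaf U₀ ⊞ freeSheaf U₁) ≫ biprod.desc f₀ f₁ =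
      freeMap (homOfLE inf_le_left) ≫ f₀ - freeMap (homOfLE inf_le_right) ≫ f₁ := fun f₀ f₁ => by
    rw [biprod.lift_desc, Preadditive.neg_comp, sub_eq_add_neg]
  constructor
  · intro h
    obtain ⟨x, hx⟩ := Ext.contravariant_sequence_exact₁ (mvSquare hU).shortComplex_shortExact F
      _ (add_zero 1) h
    obtain ⟨g, rfl⟩ := (Ext.mk₀_bijective _ _).2 x
    rw [Ext.mk₀_comp_mk₀] at hx
    have h1 := (Ext.mk₀_bijective _ _).1 hx
    refine ⟨(biprod.inl : freeSheaf U₀ ⟶ freeSheaf U₀ ⊞ freeSheaf U₁) ≫ g,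
      (biprod.inr : freeSheaf U₁ ⟶ freeSheaf U₀ ⊞ freeSheaf U₁) ≫ g, ?_⟩
    rw [← hg, ← h1]
    exact congrArg (fun g' => (mvSquare hU).shortComplex.f ≫ g')
      (biprod.hom_ext' (X := freeSheaf U₀) (Y := freeSheaf U₁) _ _ (by simp) (by simp))
  · rintro ⟨f₀, f₁, rfl⟩
    rw [← hg, ← Ext.mk₀_comp_mk₀]
    have := (mvSquare hU).shortComplex_shortExact.extClass_comp
    exact (Ext.comp_assoc_of_third_deg_zero ..).symm.trans
      ((congrArg (fun y => Ext.comp y (Ext.mk₀ (biprod.desc f₀ f₁)) (add_zero 1)) this).trans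
        (Ext.zero_comp ..))

lemma exists_mvClass_comp_eq (h₀ : ∀ x : Ext (freeSheaf U₀) F 1, x = 0)
    (h₁ : ∀ x : Ext (freeSheaf U₁) F 1, x = 0) (x : Ext (freeSheaf (⊤ : Opens X)) F 1) :
    ∃ f : freeSheaf (U₀ ⊓ U₁) ⟶ F, (mvClass hU).comp (Ext.mk₀ f) (add_zero 1) = x := by
  obtain ⟨y, hy⟩ := Ext.contravariant_sequence_exact₃ (mvSquare hU).shortComplex_shortExact F x
    (Ext.biprodAddEquiv.injective (Prod.ext ((h₀ _).trans (h₀ _).symm)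
      ((h₁ _).trans (h₁ _).symm))) (n₀ := 0) rfl
  obtain ⟨f, rfl⟩ := (Ext.mk₀_bijective _ _).2 y
  exact ⟨f, hy⟩

/-- The connecting homomorphism `F(U₀ ∩ U₁) → H¹(X, F)` of a cover by two open sets. -/
def connecting (F : Sheaf (Opens.grothendieckTopology X) AddCommGrpCat.{0}) :
    F.obj.obj (op (U₀ ⊓ U₁)) →+ Sheaf.H F 1 where
  toFun s := (Ext.mk₀ (constIsoFree X).hom).comp ((mvClass hU).comp
    (Ext.mk₀ ((homFreeEquiv (U₀ ⊓ U₁) F).symm s)) (add_zero 1)) (zero_add 1)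
  map_zero' := by
    have h : (homFreeEquiv (U₀ ⊓ U₁) F).symm 0 = 0 := by
      rw [Equiv.symm_apply_eq, homFreeEquiv_eq]
      rfl
    rw [h, Ext.mk₀_zero, Ext.comp_zero, Ext.comp_zero]
  map_add' s t := by
    have h : (homFreeEquiv (U₀ ⊓ U₁) F).symm (s + t) =
        (homFreeEquiv (U₀ ⊓ U₁) F).symm s + (homFreeEquiv (U₀ ⊓ U₁) F).symm t := by
      rw [Equiv.symm_apply_eq, homFreeEquiv_add, Equiv.apply_symm_apply, Equiv.apply_symm_apply]
    rw [h, Ext.mk₀_add, Ext.comp_add, Ext.comp_add]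

lemma connecting_apply (s : F.obj.obj (op (U₀ ⊓ U₁))) : connecting hU F s =
    (Ext.mk₀ (constIsoFree X).hom).comp ((mvClass hU).comp
      (Ext.mk₀ ((homFreeEquiv (U₀ ⊓ U₁) F).symm s)) (add_zero 1)) (zero_add 1) := rfl

lemma map_connecting (φ : F ⟶ F) (s : F.obj.obj (op (U₀ ⊓ U₁))) :
    Sheaf.H.map φ 1 (connecting hU F s) = connecting hU F ((φ.hom.app _).hom s) := by
  have h : (homFreeEquiv (U₀ ⊓ U₁) F).symm ((φ.hom.app _).hom s) =
      (homFreeEquiv (U₀ ⊓ U₁) F).symm s ≫ φ := by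
    rw [Equiv.symm_apply_eq, homFreeEquiv_comp, Equiv.apply_symm_apply]
  rw [Sheaf.H.map_apply, connecting_apply, connecting_apply, h, ← Ext.mk₀_comp_mk₀,
    Ext.comp_assoc_of_third_deg_zero, Ext.comp_assoc_of_third_deg_zero]

lemma connecting_surjective (h₀ : ∀ x : Ext (freeSheaf U₀) F 1, x = 0)
    (h₁ : ∀ x : Ext (freeSheaf U₁) F 1, x = 0) : Function.Surjective (connecting hU F) := by
  intro c
  obtain ⟨f, hf⟩ := exists_mvClass_comp_eq hU h₀ h₁
    ((Ext.mk₀ (constIsoFree X).inv).comp c (zero_add 1))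
  refine ⟨homFreeEquiv _ _ f, ?_⟩
  rw [connecting_apply, Equiv.symm_apply_apply, hf, ← Ext.comp_assoc_of_second_deg_zero,
    Ext.mk₀_comp_mk₀, Iso.hom_inv_id, Ext.mk₀_id_comp]

lemma connecting_eq_zero_iff (s : F.obj.obj (op (U₀ ⊓ U₁))) : connecting hU F s = 0 ↔
    ∃ (s₀ : F.obj.obj (op U₀)) (s₁ : F.obj.obj (op U₁)),
      s = (F.obj.map (homOfLE inf_le_left).op).hom s₀ -
        (F.obj.map (homOfLE inf_le_right).op).hom s₁ := by
  have h1 : connecting hU F s = 0 ↔ (mvClass hU).comp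
      (Ext.mk₀ ((homFreeEquiv (U₀ ⊓ U₁) F).symm s)) (add_zero 1) = 0 := by
    rw [connecting_apply]
    constructor
    · intro h
      have h2 := congrArg (fun y => (Ext.mk₀ (constIsoFree X).inv).comp y (zero_add 1)) h
      simp only [Ext.comp_zero] at h2
      rwa [← Ext.comp_assoc_of_second_deg_zero, Ext.mk₀_comp_mk₀, Iso.inv_hom_id,
        Ext.mk₀_id_comp] at h2
    · intro h
      rw [h, Ext.comp_zero]
  have hsub : ∀ f g : freeSheaf (U₀ ⊓ U₁) ⟶ F, homFreeEquiv _ F (f - g) =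
      homFreeEquiv _ F f - homFreeEquiv _ F g := fun f g => by
    rw [eq_sub_iff_add_eq, ← homFreeEquiv_add, sub_add_cancel]
  rw [h1, mvClass_comp_eq_zero_iff]
  constructor
  · rintro ⟨f₀, f₁, h⟩
    rw [Equiv.symm_apply_eq, hsub, homFreeEquiv_freeMap, homFreeEquiv_freeMap] at h
    exact ⟨_, _, h⟩
  · rintro ⟨s₀, s₁, h⟩
    refine ⟨(homFreeEquiv _ _).symm s₀, (homFreeEquiv _ _).symm s₁, ?_⟩
    rw [Equiv.symm_apply_eq, hsub, homFreeEquiv_freeMap, homFreeEquiv_freeMap,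
      Equiv.apply_symm_apply, Equiv.apply_symm_apply, h]

end Cohomology
end SuperCP1

end

/-! ### The exterior algebra of the typical fibre -/

noncomputable section

namespace SuperCP1

section Fibre

/-- The generators `ξ_i` of the exterior algebra. -/
def gen (i : Fin 3) : FibL := ExteriorAlgebra.ι ℂ (Pi.single i 1)

/-- The top form `ξ_1 ξ_2 ξ_3`. -/
def topForm : FibL := gen 0 * gen 1 * gen 2

/-- The bivector `w` with `w ξ_i = f_i ξ_1 ξ_2 ξ_3`. -/
def bivector (f : FibE) : FibL :=
  f 0 • (gen 1 * gen 2) + f 1 • (gen 2 * gen 0) + f 2 • (gen 0 * gen 1)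

lemma ι_eq_sum_gen (u : FibE) :
    ExteriorAlgebra.ι ℂ u = u 0 • gen 0 + u 1 • gen 1 + u 2 • gen 2 := by
  have h : u = u 0 • Pi.single 0 1 + u 1 • Pi.single 1 1 + u 2 • Pi.single 2 1 := by
    ext i
    fin_cases i <;> simp
  conv_lhs => rw [h]
  simp [gen]

lemma gen_mul_self (i : Fin 3) : gen i * gen i = 0 := ExteriorAlgebra.ι_sq_zero _

lemma gen_mul_swap (i j : Fin 3) : gen i * gen j = -(gen j * gen i) :=
  eq_neg_of_add_eq_zero_left (ExteriorAlgebra.ι_add_mul_swap _ _)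

lemma ι_mul_ι (u v : FibE) : ExteriorAlgebra.ι ℂ u * ExteriorAlgebra.ι ℂ v =
    bivector (crossProduct u v) := by
  simp only [ι_eq_sum_gen, bivector, cross_apply, mul_add, add_mul, smul_mul_smul_comm,
    gen_mul_self, gen_mul_swap 1 0, gen_mul_swap 2 1, gen_mul_swap 0 2, Matrix.cons_val]
  module

lemma gen_mul_mul_self (i j : Fin 3) : gen i * gen j * gen j = 0 := by
  rw [mul_assoc, gen_mul_self, mul_zero]

lemma gen_mul_mul_self' (i j : Fin 3) : gen i * gen j * gen i = 0 := by
  rw [gen_mul_swap i j, neg_mul, gen_mul_mul_self, neg_zero]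

lemma gen_rotate (i j l : Fin 3) : gen i * gen j * gen l = gen j * gen l * gen i := by
  rw [mul_assoc (gen j), gen_mul_swap l i, mul_neg, ← mul_assoc, gen_mul_swap j i, neg_mul, neg_neg]

lemma bivector_mul_ι (f u : FibE) : bivector f * ExteriorAlgebra.ι ℂ u = (f ⬝ᵥ u) • topForm := by
  have h1 : gen 1 * gen 2 * gen 0 = topForm := (gen_rotate 0 1 2).symm
  have h2 : gen 2 * gen 0 * gen 1 = topForm := (gen_rotate 2 0 1)
  have h3 : gen 0 * gen 1 * gen 2 = topForm := rfl
  simp only [ι_eq_sum_gen, bivector, mul_add, add_mul, smul_mul_smul_comm, h1, h2, h3,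
    gen_mul_mul_self, gen_mul_mul_self', dotProduct, Fin.sum_univ_three]
  module

lemma ι_mul_bivector (f u : FibE) : ExteriorAlgebra.ι ℂ u * bivector f = (f ⬝ᵥ u) • topForm := by
  rw [← bivector_mul_ι]
  simp only [ι_eq_sum_gen, bivector, mul_add, add_mul, smul_mul_smul_comm, ← mul_assoc]
  rw [gen_rotate 0 1 2, gen_rotate 0 2 0, gen_rotate 0 0 1, gen_rotate 1 1 2, gen_rotate 1 2 0,
    gen_rotate 1 0 1, gen_rotate 2 1 2, gen_rotate 2 2 0, gen_rotate 2 0 1]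
  module

lemma bivector_mul_comm (f : FibE) (a : FibL) : bivector f * a = a * bivector f := by
  induction a using ExteriorAlgebra.induction with
  | algebraMap r => exact (Algebra.commutes r _).symm
  | ι x => rw [bivector_mul_ι, ι_mul_bivector]
  | mul a b ha hb => rw [← mul_assoc, ha, mul_assoc, hb, mul_assoc]
  | add a b ha hb => rw [mul_add, ha, hb, add_mul]

lemma topForm_mul_ι (u : FibE) : topForm * ExteriorAlgebra.ι ℂ u = 0 := by
  have h : topForm * gen 1 = 0 := by
    rw [topForm, mul_assoc, gen_mul_swap 2 1, mul_neg, ← mul_assoc, gen_mul_mul_self, zero_mul,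
      neg_zero]
  have h2 : topForm * gen 2 = 0 := by
    rw [topForm, mul_assoc, gen_mul_self, mul_zero]
  have h0 : topForm * gen 0 = 0 := by
    rw [topForm, gen_rotate 0 1 2, mul_assoc, gen_mul_self, mul_zero]
  simp [ι_eq_sum_gen, mul_add, h, h0, h2]

lemma ι_mul_topForm (u : FibE) : ExteriorAlgebra.ι ℂ u * topForm = 0 := by
  have h0 : gen 0 * topForm = 0 := by
    rw [topForm, ← mul_assoc, ← mul_assoc, gen_mul_self, zero_mul, zero_mul]
  have h1 : gen 1 * topForm = 0 := by
    rw [topForm, ← mul_assoc, ← mul_assoc, gen_mul_mul_self', zero_mul]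
  have h2 : gen 2 * topForm = 0 := by
    rw [topForm, gen_rotate, gen_rotate, ← mul_assoc, ← mul_assoc, gen_mul_self, zero_mul, zero_mul]
  simp [ι_eq_sum_gen, add_mul, h1, h0, h2]

/-- The component of degree `0`, an algebra homomorphism. -/
abbrev degZero : FibL →ₐ[ℂ] ℂ := ExteriorAlgebra.algebraMapInv

lemma degZero_ι (u : FibE) : degZero (ExteriorAlgebra.ι ℂ u) = 0 := by
  simp [ExteriorAlgebra.algebraMapInv]

/-- The component of degree `1`. -/
abbrev degOne : FibL →ₗ[ℂ] FibE := ExteriorAlgebra.ιInv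

lemma degOne_ι (u : FibE) : degOne (ExteriorAlgebra.ι ℂ u) = u :=
  ExteriorAlgebra.ι_leftInverse u

lemma topForm_mul (a : FibL) : topForm * a = degZero a • topForm := by
  induction a using ExteriorAlgebra.induction with
  | algebraMap r => simp [ExteriorAlgebra.algebraMapInv, Algebra.algebraMap_eq_smul_one]
  | ι x => rw [topForm_mul_ι, degZero_ι, zero_smul]
  | mul a b ha hb => rw [← mul_assoc, ha, smul_mul_assoc, hb, smul_smul, map_mul]
  | add a b ha hb => rw [mul_add, ha, hb, map_add, add_smul]

lemma mul_topForm (a : FibL) : a * topForm = degZero a • topForm := by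
  induction a using ExteriorAlgebra.induction with
  | algebraMap r => simp [ExteriorAlgebra.algebraMapInv, Algebra.algebraMap_eq_smul_one]
  | ι x => rw [ι_mul_topForm, degZero_ι, zero_smul]
  | mul a b ha hb => rw [mul_assoc, hb, mul_smul_comm, ha, smul_smul, map_mul, mul_comm]
  | add a b ha hb => rw [add_mul, ha, hb, map_add, add_smul]

lemma _root_.ExteriorAlgebra.ιInv_mul {R M : Type*} [CommRing R] [AddCommGroup M] [Module R M]
    (a b : ExteriorAlgebra R M) : ExteriorAlgebra.ιInv (a * b) =
      ExteriorAlgebra.algebraMapInv a • ExteriorAlgebra.ιInv b +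
        ExteriorAlgebra.algebraMapInv b • ExteriorAlgebra.ιInv a := by
  let : Module Rᵐᵒᵖ M := Module.compHom _ ((RingHom.id R).fromOpposite mul_comm)
  have : IsCentralScalar R M := ⟨fun r m => rfl⟩
  have h : (TrivSqZeroExt.fstHom R R M).comp ExteriorAlgebra.toTrivSqZeroExt =
      ExteriorAlgebra.algebraMapInv :=
    ExteriorAlgebra.hom_ext (LinearMap.ext fun x => by simp [ExteriorAlgebra.algebraMapInv])
  have hz : ∀ a, (ExteriorAlgebra.toTrivSqZeroExt a : TrivSqZeroExt R M).fst =
      ExteriorAlgebra.algebraMapInv a := fun a => DFunLike.congr_fun h a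
  have ho : ∀ a, (ExteriorAlgebra.toTrivSqZeroExt a : TrivSqZeroExt R M).snd =
      ExteriorAlgebra.ιInv a := fun a => rfl
  rw [← ho, map_mul, TrivSqZeroExt.snd_mul, hz, hz, ho, ho]
  rfl

/-- The component of degree `1` is a derivation over the component of degree `0`. -/
lemma degOne_mul (a b : FibL) : degOne (a * b) = degZero a • degOne b + degZero b • degOne a :=
  ExteriorAlgebra.ιInv_mul a b

lemma degOne_one : degOne (1 : FibL) = 0 := by
  have := degOne_mul 1 1
  simpa using this

/-- The coefficient of the top form. -/
def topCoeff : FibL →ₗ[ℂ] ℂ :=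
  ExteriorAlgebra.liftAlternating
    (Function.update (fun _ => 0) 3 (Pi.basisFun ℂ (Fin 3)).det)

lemma topCoeff_ιMulti (v : Fin 3 → FibE) :
    topCoeff (ExteriorAlgebra.ιMulti ℂ 3 v) = (Pi.basisFun ℂ (Fin 3)).det v := by
  rw [topCoeff, ExteriorAlgebra.liftAlternating_apply_ιMulti, Function.update_self]

lemma topForm_eq_ιMulti : topForm = ExteriorAlgebra.ιMulti ℂ 3 (Pi.basisFun ℂ (Fin 3)) := by
  simp only [topForm, gen, ExteriorAlgebra.ιMulti_apply, List.ofFn_succ, List.ofFn_zero,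
    List.prod_cons, List.prod_nil, mul_one, mul_assoc, Pi.basisFun_apply]
  rfl

lemma topCoeff_topForm : topCoeff topForm = 1 := by
  rw [topForm_eq_ιMulti, topCoeff_ιMulti, Module.Basis.det_self]

lemma topForm_ne_zero : topForm ≠ 0 := fun h => by
  simpa [h] using topCoeff_topForm

lemma bivector_mem (f : FibE) : bivector f ∈ ⋀[ℂ]^2 FibE := by
  have h : ∀ i j : Fin 3, gen i * gen j ∈ ⋀[ℂ]^2 FibE := fun i j => by
    rw [ExteriorAlgebra.exteriorPower, pow_two]
    exact Submodule.mul_mem_mul ⟨_, rfl⟩ ⟨_, rfl⟩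
  exact add_mem (add_mem (Submodule.smul_mem _ _ (h _ _)) (Submodule.smul_mem _ _ (h _ _)))
    (Submodule.smul_mem _ _ (h _ _))

lemma topForm_mem : topForm ∈ ⋀[ℂ]^3 FibE := by
  rw [topForm_eq_ιMulti]
  exact ExteriorAlgebra.ιMulti_range ℂ 3 ⟨_, rfl⟩

lemma exists_bivector {w : FibL} (hw : w ∈ ⋀[ℂ]^2 FibE) : ∃ f, w = bivector f := by
  rw [ExteriorAlgebra.exteriorPower, pow_two] at hw
  refine Submodule.mul_induction_on hw (fun a ha b hb => ?_) (fun a b ha hb => ?_)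
  · obtain ⟨u, rfl⟩ := ha
    obtain ⟨v, rfl⟩ := hb
    exact ⟨_, ι_mul_ι u v⟩
  · obtain ⟨f, rfl⟩ := ha
    obtain ⟨g, rfl⟩ := hb
    exact ⟨f + g, by simp only [bivector, Pi.add_apply]; module⟩

lemma eq_topCoeff_smul {w : FibL} (hw : w ∈ ⋀[ℂ]^3 FibE) : w = topCoeff w • topForm := by
  rw [ExteriorAlgebra.exteriorPower, pow_succ] at hw
  refine Submodule.mul_induction_on hw (fun a ha b hb => ?_) (fun a b ha hb => ?_)
  · obtain ⟨f, rfl⟩ := exists_bivector ha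
    obtain ⟨v, rfl⟩ := hb
    rw [bivector_mul_ι, map_smul, topCoeff_topForm, smul_eq_mul, mul_one]
  · rw [map_add, add_smul, ← ha, ← hb]

lemma degZero_eq_zero_of_mem {q : ℕ} {a : FibL} (ha : a ∈ ⋀[ℂ]^(q + 1) FibE) : degZero a = 0 := by
  rw [ExteriorAlgebra.exteriorPower, pow_succ] at ha
  refine Submodule.mul_induction_on ha (fun a _ b hb => ?_) (fun a b ha hb => ?_)
  · obtain ⟨v, rfl⟩ := hb
    rw [map_mul, degZero_ι, mul_zero]
  · rw [map_add, ha, hb, add_zero]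

lemma degOne_eq_zero_of_mem {q : ℕ} (hq : q ≠ 1) {a : FibL} (ha : a ∈ ⋀[ℂ]^q FibE) :
    degOne a = 0 := by
  match q with
  | 0 =>
    rw [ExteriorAlgebra.exteriorPower, pow_zero] at ha
    obtain ⟨r, rfl⟩ := Submodule.mem_one.1 ha
    rw [Algebra.algebraMap_eq_smul_one, map_smul, degOne_one, smul_zero]
  | 1 => exact absurd rfl hq
  | q + 2 =>
    rw [ExteriorAlgebra.exteriorPower, pow_succ] at ha
    refine Submodule.mul_induction_on ha (fun a ha b hb => ?_) (fun a b ha hb => ?_)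
    · obtain ⟨v, rfl⟩ := hb
      rw [degOne_mul, degZero_ι, degZero_eq_zero_of_mem ha, zero_smul, zero_smul, add_zero]
    · rw [map_add, ha, hb, add_zero]

lemma mul_mem_exteriorPower {p q : ℕ} {a b : FibL} (ha : a ∈ ⋀[ℂ]^p FibE)
    (hb : b ∈ ⋀[ℂ]^q FibE) : a * b ∈ ⋀[ℂ]^(p + q) FibE := by
  rw [ExteriorAlgebra.exteriorPower, pow_add]
  exact Submodule.mul_mem_mul ha hb

lemma topCoeff_bivector_mul_gen (f : FibE) (i : Fin 3) : topCoeff (bivector f * gen i) = f i := by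
  rw [gen, bivector_mul_ι, map_smul, topCoeff_topForm]
  simp

/-- The linear operator `a ↦ w a' + γ(a) ξ_1 ξ_2 ξ_3`, where `w` is the bivector with coordinates
`f` and `γ` is the linear form on `E` with coordinates `g`, for the value `a` and the derivative
`a'` of a section. -/
def fibreOp (f g : FibE) (a a' : FibL) : FibL := bivector f * a' + (g ⬝ᵥ degOne a) • topForm

/-- The Leibniz rule in a fibre, with `a' b + a b'` as the derivative of `a b`. -/
lemma fibreOp_mul (f g : FibE) (a b a' b' : FibL) : fibreOp f g (a * b) (a' * b + a * b') =
    fibreOp f g a a' * b + a * fibreOp f g b b' := by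
  simp only [fibreOp, degOne_mul, mul_add, add_mul, smul_mul_assoc, mul_smul_comm, topForm_mul,
    mul_topForm, dotProduct_add, dotProduct_smul, add_smul, smul_smul, smul_eq_mul]
  rw [← mul_assoc (bivector f) a, bivector_mul_comm f a, mul_assoc, mul_assoc]
  rw [mul_comm (degZero a), mul_comm (degZero b)]
  abel

lemma fibreOp_mem (f g : FibE) {q : ℕ} {a a' : FibL} (ha : a ∈ ⋀[ℂ]^q FibE)
    (ha' : a' ∈ ⋀[ℂ]^q FibE) : fibreOp f g a a' ∈ ⋀[ℂ]^(2 + q) FibE := by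
  refine add_mem (mul_mem_exteriorPower (bivector_mem f) ha') ?_
  by_cases hq : q = 1
  · subst hq
    exact Submodule.smul_mem _ _ topForm_mem
  · rw [degOne_eq_zero_of_mem hq ha, dotProduct_zero, zero_smul]
    exact zero_mem _

lemma map_mem_exteriorPower (A : FibE →ₗ[ℂ] FibE) {q : ℕ} {a : FibL} (ha : a ∈ ⋀[ℂ]^q FibE) :
    ExteriorAlgebra.map A a ∈ ⋀[ℂ]^q FibE := by
  have h : (⋀[ℂ]^q FibE).map (ExteriorAlgebra.map A).toLinearMap ≤ ⋀[ℂ]^q FibE := by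
    rw [ExteriorAlgebra.exteriorPower, Submodule.map_pow]
    refine pow_le_pow_left' ?_ q
    rintro _ ⟨_, ⟨v, rfl⟩, rfl⟩
    exact ⟨A v, by simp⟩
  exact h ⟨_, ha, rfl⟩

lemma map_topForm (A : Matrix (Fin 3) (Fin 3) ℂ) :
    ExteriorAlgebra.map (Matrix.toLin' A) topForm = A.det • topForm := by
  rw [eq_topCoeff_smul (map_mem_exteriorPower _ topForm_mem), topForm_eq_ιMulti,
    ExteriorAlgebra.map_apply_ιMulti, topCoeff_ιMulti, Module.Basis.det_comp,
    LinearMap.det_toLin', Module.Basis.det_self, mul_one]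

lemma smul_topForm_injective {r s : ℂ} (h : r • topForm = s • topForm) : r = s :=
  smul_left_injective ℂ topForm_ne_zero h

/-- On bivectors, identified with row vectors through the pairing with `E`, a linear
automorphism `A` of `E` acts by `det A • A⁻ᵀ`. -/
lemma map_bivector (A : Matrix (Fin 3) (Fin 3) ℂ) (hA : IsUnit A.det) (f : FibE) :
    ExteriorAlgebra.map (Matrix.toLin' A) (bivector f) =
      bivector ((A.det • A⁻¹.transpose).mulVec f) := by
  obtain ⟨f', hf'⟩ := exists_bivector (map_mem_exteriorPower (Matrix.toLin' A) (bivector_mem f))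
  have h : ∀ u, f' ⬝ᵥ A.mulVec u = A.det * (f ⬝ᵥ u) := fun u => by
    have h1 := congrArg (ExteriorAlgebra.map (Matrix.toLin' A)) (bivector_mul_ι f u)
    rw [map_mul, hf', ExteriorAlgebra.map_apply_ι, Matrix.toLin'_apply, bivector_mul_ι, map_smul,
      map_topForm, smul_smul, mul_comm] at h1
    exact smul_topForm_injective h1
  rw [hf']
  congr 1
  refine dotProduct_eq _ _ fun u => ?_
  have h1 := h (A⁻¹.mulVec u)
  rw [Matrix.mulVec_mulVec, Matrix.mul_nonsing_inv _ hA, Matrix.one_mulVec] at h1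
  rw [h1, Matrix.smul_mulVec, smul_dotProduct, Matrix.mulVec_transpose, smul_eq_mul,
    ← Matrix.dotProduct_mulVec]

lemma scaleE_eq (c : ℂ) : scaleE c = Matrix.toLin' (c • (1 : Matrix (Fin 3) (Fin 3) ℂ)) := by
  ext; simp [scaleE]

lemma scaleL_topForm (c : ℂ) : scaleL c topForm = c ^ 3 • topForm := by
  rw [scaleL, scaleE_eq, AlgHom.toLinearMap_apply, map_topForm]
  simp

lemma scaleL_ι (c : ℂ) (u : FibE) :
    scaleL c (ExteriorAlgebra.ι ℂ u) = c • ExteriorAlgebra.ι ℂ u := by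
  simp [scaleL, scaleE]

lemma scaleL_mul (c : ℂ) (a b : FibL) : scaleL c (a * b) = scaleL c a * scaleL c b := by
  simp [scaleL]

lemma scaleL_bivector (c : ℂ) (f : FibE) : scaleL c (bivector f) = c ^ 2 • bivector f := by
  simp only [bivector, gen, map_add, map_smul, scaleL_mul, scaleL_ι, smul_mul_smul_comm, ← pow_two]
  module

lemma scaleL_scaleL (c d : ℂ) (a : FibL) : scaleL c (scaleL d a) = scaleL (c * d) a := by
  have h : scaleE c ∘ₗ scaleE d = scaleE (c * d) := by
    ext; simp [scaleE, mul_assoc]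
  rw [scaleL, scaleL, scaleL, ← h, ← ExteriorAlgebra.map_comp_map]
  rfl

lemma scaleL_one (a : FibL) : scaleL 1 a = a := by
  have h : scaleE 1 = LinearMap.id := one_smul _ _
  rw [scaleL, h, ExteriorAlgebra.map_id]
  rfl

end Fibre
end SuperCP1

end

/-! ### Derivatives, charts and vector fields of degree two in a chart -/

noncomputable section

namespace SuperCP1

section Derivative

variable {F : Type} [AddCommGroup F] [Module ℂ F]

/-- The map `s` has derivative `d` at `z`, tested against linear forms. -/
def HasHolDeriv (s : ℂ → F) (d : F) (z : ℂ) : Prop :=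
  ∀ l : Module.Dual ℂ F, HasDerivAt (fun w => l (s w)) (l d) z

lemma HasHolDeriv.unique {s : ℂ → F} {d d' : F} {z : ℂ} (h : HasHolDeriv s d z)
    (h' : HasHolDeriv s d' z) : d = d' :=
  sub_eq_zero.1 <| (Module.forall_dual_apply_eq_zero_iff ℂ _).1 fun l => by
    rw [map_sub, (h l).unique (h' l), sub_self]

lemma HasHolDeriv.congr {s t : ℂ → F} {d : F} {z : ℂ} (h : HasHolDeriv s d z) {W : Set ℂ}
    (hW : IsOpen W) (hz : z ∈ W) (hst : ∀ w ∈ W, t w = s w) : HasHolDeriv t d z := fun l =>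
  (h l).congr_of_eventuallyEq <| Filter.mem_of_superset (hW.mem_nhds hz) fun w hw =>
    congrArg l (hst w hw)

lemma HasHolDeriv.add {s t : ℂ → F} {d e : F} {z : ℂ} (hs : HasHolDeriv s d z)
    (ht : HasHolDeriv t e z) : HasHolDeriv (fun w => s w + t w) (d + e) z := fun l => by
  simpa only [map_add] using (hs l).fun_add (ht l)

lemma HasHolDeriv.smul {c : ℂ → ℂ} {s : ℂ → F} {c' : ℂ} {d : F} {z : ℂ} (hc : HasDerivAt c c' z)
    (hs : HasHolDeriv s d z) : HasHolDeriv (fun w => c w • s w) (c' • s z + c z • d) z :=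
  fun l => by
    simpa only [map_add, map_smul, smul_eq_mul] using hc.fun_mul (hs l)

lemma hasHolDeriv_const (v : F) (z : ℂ) : HasHolDeriv (fun _ => v) 0 z := fun l => by
  simpa using hasDerivAt_const z (l v)

lemma HasHolDeriv.smul_const {c : ℂ → ℂ} {c' z : ℂ} (hc : HasDerivAt c c' z) (v : F) :
    HasHolDeriv (fun w => c w • v) (c' • v) z := by
  simpa using HasHolDeriv.smul hc (hasHolDeriv_const v z)

/-- The derivative of a map with values in the exterior algebra, computed in a basis. -/
def holDeriv (s : ℂ → FibL) (z : ℂ) : FibL :=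
  ∑ i, deriv (fun w => (Module.finBasis ℂ FibL).coord i (s w)) z • Module.finBasis ℂ FibL i

lemma finBasis_expand (a : FibL) :
    a = ∑ i, (Module.finBasis ℂ FibL).coord i a • Module.finBasis ℂ FibL i :=
  ((Module.finBasis ℂ FibL).sum_repr a).symm

lemma HolOn.hasHolDeriv {s : ℂ → FibL} {W : Set ℂ} (hs : HolOn s W) (hW : IsOpen W) {z : ℂ}
    (hz : z ∈ W) : HasHolDeriv s (holDeriv s z) z := fun l => by
  have h : (fun w => l (s w)) = fun w => ∑ i, (Module.finBasis ℂ FibL).coord i (s w) *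
      l (Module.finBasis ℂ FibL i) := funext fun w => by
    conv_lhs => rw [finBasis_expand (s w)]
    simp only [map_sum, map_smul, smul_eq_mul]
  rw [h, holDeriv]
  simp only [map_sum, map_smul, smul_eq_mul]
  exact HasDerivAt.fun_sum fun i _ =>
    (((hs _).differentiableAt (hW.mem_nhds hz)).hasDerivAt).mul_const _

lemma HasHolDeriv.holDeriv_eq {s : ℂ → FibL} {d : FibL} {z : ℂ} (h : HasHolDeriv s d z) :
    holDeriv s z = d := by
  rw [holDeriv]
  simp only [(h _).deriv]
  exact (finBasis_expand d).symm

lemma HolOn.holDeriv {s : ℂ → FibL} {W : Set ℂ} (hs : HolOn s W) (hW : IsOpen W) :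
    HolOn (holDeriv s) W :=
  HolOn.sum _ fun _ _ => HolOn.smul ((hs _).deriv hW) (holOn_const _ _)

lemma HasHolDeriv.mul {s t : ℂ → FibL} {d e : FibL} {z : ℂ} (hs : HasHolDeriv s d z)
    (ht : HasHolDeriv t e z) : HasHolDeriv (fun w => s w * t w) (d * t z + s z * e) z := fun l => by
  have h : ∀ a b : FibL, l (a * b) = ∑ i, (Module.finBasis ℂ FibL).coord i a *
      (l ∘ₗ LinearMap.mulLeft ℂ (Module.finBasis ℂ FibL i)) b := fun a b => by
    conv_lhs => rw [finBasis_expand a]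
    simp only [Finset.sum_mul, smul_mul_assoc, map_sum, map_smul, smul_eq_mul,
      LinearMap.comp_apply, LinearMap.mulLeft_apply]
  rw [map_add, h, h, ← Finset.sum_add_distrib]
  simp only [h]
  exact HasDerivAt.fun_sum fun i _ => (hs _).fun_mul (ht _)

/-- The derivative of a section of a subbundle of constant fibre `⋀^q E` stays in that fibre. -/
lemma holDeriv_mem {s : ℂ → FibL} {W : Set ℂ} (hs : HolOn s W) (hW : IsOpen W) {q : ℕ}
    (h : ∀ z ∈ W, s z ∈ ⋀[ℂ]^q FibE) {z : ℂ} (hz : z ∈ W) :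
    SuperCP1.holDeriv s z ∈ ⋀[ℂ]^q FibE := by
  by_contra hn
  obtain ⟨l, hl, hl'⟩ := Submodule.exists_le_ker_of_notMem hn
  refine hl ?_
  have h1 := (hs.hasHolDeriv hW hz) l
  have h2 : HasDerivAt (fun w => l (s w)) 0 z :=
    (hasDerivAt_const z 0).congr_of_eventuallyEq <|
      Filter.mem_of_superset (hW.mem_nhds hz) fun w hw => hl' (h w hw)
  exact h1.unique h2

end Derivative

section Charts

/-- A local trivialization of the supermanifold over the complex plane: a chart `φ` of the
underlying space, and the factor `c` relating the frame in which sections are written at a point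
to the frame of the trivialization. -/
structure SuperChart (k : ℤ) where
  φ : ℂ → CP1
  isOpenEmbedding : Topology.IsOpenEmbedding φ
  c : ℂ → ℂ
  c_ne : ∀ z, c z ≠ 0
  isHolSection_iff : ∀ (U : Opens CP1), (U : Set CP1) ⊆ Set.range φ → ∀ s : U → FibL,
    IsHolSection scaleL k s ↔ HolOn (fun z => scaleL (c z) (extendZero s (φ z))) (φ ⁻¹' U)

namespace SuperChart

variable {k : ℤ} (C : SuperChart k) {U V W : Opens CP1}

/-- The domain of a chart. -/
def dom : Opens CP1 := ⟨Set.range C.φ, C.isOpenEmbedding.isOpen_range⟩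

/-- The open subset of the plane corresponding to an open subset of the sphere. -/
def pre (U : Opens CP1) : Opens ℂ := ⟨C.φ ⁻¹' U, U.isOpen.preimage C.isOpenEmbedding.continuous⟩

/-- The local expression of a section in a chart. -/
def loc (s : StrSheaf k U) (z : ℂ) : FibL := scaleL (C.c z) (extendZero s.1 (C.φ z))

lemma loc_of_mem (s : StrSheaf k U) {z : ℂ} (hz : z ∈ C.pre U) :
    C.loc s z = scaleL (C.c z) (s.1 ⟨C.φ z, hz⟩) := by
  rw [loc, extendZero_of_mem _ hz]

lemma scaleL_inv_loc (s : StrSheaf k U) {z : ℂ} (hz : z ∈ C.pre U) :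
    scaleL (C.c z)⁻¹ (C.loc s z) = s.1 ⟨C.φ z, hz⟩ := by
  rw [loc_of_mem C s hz, scaleL_scaleL, inv_mul_cancel₀ (C.c_ne z), scaleL_one]

lemma holOn_loc (hU : U ≤ C.dom) (s : StrSheaf k U) : HolOn (C.loc s) (C.pre U) :=
  (C.isHolSection_iff U hU s.1).1 s.2

lemma ext_loc (hU : U ≤ C.dom) {s t : StrSheaf k U} (h : ∀ z ∈ C.pre U, C.loc s z = C.loc t z) :
    s = t := by
  refine Subtype.ext (funext fun ⟨p, hp⟩ => ?_)
  obtain ⟨z, rfl⟩ := hU hp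
  rw [← C.scaleL_inv_loc s hp, ← C.scaleL_inv_loc t hp, h z hp]

/-- The section with a given local expression `h`. The inverse `Function.invFun C.φ` of the chart
is only meaningful on its domain, which contains `U`. -/
def ofLoc (hU : U ≤ C.dom) (h : ℂ → FibL) (hh : HolOn h (C.pre U)) : StrSheaf k U :=
  ⟨fun p => scaleL (C.c (Function.invFun C.φ p))⁻¹ (h (Function.invFun C.φ p)),
    (C.isHolSection_iff U hU _).2 <| hh.congr fun z hz => by
      rw [extendZero_of_mem _ hz]
      simp only [Function.leftInverse_invFun C.isOpenEmbedding.injective z]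
      rw [scaleL_scaleL, mul_inv_cancel₀ (C.c_ne z), scaleL_one]⟩

lemma loc_ofLoc (hU : U ≤ C.dom) (h : ℂ → FibL) (hh : HolOn h (C.pre U)) {z : ℂ}
    (hz : z ∈ C.pre U) : C.loc (C.ofLoc hU h hh) z = h z := by
  rw [C.loc_of_mem _ hz]
  simp only [ofLoc, Function.leftInverse_invFun C.isOpenEmbedding.injective z]
  rw [scaleL_scaleL, mul_inv_cancel₀ (C.c_ne z), scaleL_one]

lemma loc_add (s t : StrSheaf k U) {z : ℂ} (hz : z ∈ C.pre U) :
    C.loc (s + t) z = C.loc s z + C.loc t z := by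
  simp only [C.loc_of_mem _ hz, ← map_add]
  rfl

lemma loc_smul (r : ℂ) (s : StrSheaf k U) {z : ℂ} (hz : z ∈ C.pre U) :
    C.loc (r • s) z = r • C.loc s z := by
  simp only [C.loc_of_mem _ hz, ← map_smul]
  rfl

lemma loc_mul (s t : StrSheaf k U) {z : ℂ} (hz : z ∈ C.pre U) :
    C.loc (s * t) z = C.loc s z * C.loc t z := by
  simp only [C.loc_of_mem _ hz, ← scaleL_mul]
  rfl

lemma loc_res (h : V ≤ U) (s : StrSheaf k U) {z : ℂ} (hz : z ∈ C.pre V) :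
    C.loc (res k h s) z = C.loc s z := by
  rw [C.loc_of_mem _ hz, C.loc_of_mem _ (show z ∈ C.pre U from h hz)]
  rfl

lemma scaleL_mem (c : ℂ) {q : ℕ} {a : FibL} (ha : a ∈ ⋀[ℂ]^q FibE) : scaleL c a ∈ ⋀[ℂ]^q FibE :=
  map_mem_exteriorPower _ ha

lemma mem_strDeg_iff (hU : U ≤ C.dom) (s : StrSheaf k U) (q : ℕ) :
    s ∈ StrDeg k q U ↔ ∀ z ∈ C.pre U, C.loc s z ∈ ⋀[ℂ]^q FibE := by
  constructor
  · intro h z hz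
    rw [C.loc_of_mem s hz]
    exact scaleL_mem _ (h _)
  · rintro h ⟨p, hp⟩
    obtain ⟨z, rfl⟩ := hU hp
    rw [← C.scaleL_inv_loc s hp]
    exact scaleL_mem _ (h z hp)

/-- The pairs `(f, g)` of vector valued functions describing vector fields of degree two. -/
abbrev Pair : Type := (Fin 3 → ℂ) × (Fin 3 → ℂ)

/-- The local expression of the derivation with `x ↦ w` and `ξ_i ↦ g_i ξ_1 ξ_2 ξ_3`, where
`a = (f, g)` and `w` is the bivector with coordinates `f`. -/
def locOp (a : ℂ → Pair) (s : ℂ → FibL) (z : ℂ) : FibL :=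
  fibreOp (a z).1 (a z).2 (s z) (holDeriv s z)

lemma holOn_locOp {a : ℂ → Pair} {s : ℂ → FibL} {S : Set ℂ} (hS : IsOpen S)
    (ha : DifferentiableOn ℂ a S) (hs : HolOn s S) : HolOn (locOp a s) S := by
  have h1 : ∀ i, DifferentiableOn ℂ (fun z => (a z).1 i) S := fun i =>
    differentiableOn_pi.1 ha.fst i
  have h2 : ∀ i, DifferentiableOn ℂ (fun z => (a z).2 i) S := fun i =>
    differentiableOn_pi.1 ha.snd i
  refine HolOn.add (HolOn.mul ?_ (hs.holDeriv hS)) (HolOn.smul ?_ (holOn_const _ _))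
  · exact (((holOn_const _ _).smul (h1 0)).add ((holOn_const _ _).smul (h1 1))).add
      ((holOn_const _ _).smul (h1 2))
  · simp only [dotProduct, Fin.sum_univ_three]
    have h3 : ∀ i, DifferentiableOn ℂ (fun z => degOne (s z) i) S := fun i =>
      hs (LinearMap.proj i ∘ₗ degOne)
    exact (((h2 0).mul (h3 0)).add ((h2 1).mul (h3 1))).add ((h2 2).mul (h3 2))

lemma locOp_congr {a b : ℂ → Pair} {s t : ℂ → FibL} {S : Set ℂ} (hS : IsOpen S)
    (hs : HolOn s S) (hst : ∀ z ∈ S, t z = s z) {z : ℂ} (hab : a z = b z) (hz : z ∈ S) :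
    locOp a s z = locOp b t z := by
  have h := ((hs.hasHolDeriv hS hz).congr hS hz hst).holDeriv_eq
  rw [locOp, locOp, h, hab, hst z hz]

lemma locOp_add {a : ℂ → Pair} {s t : ℂ → FibL} {S : Set ℂ} (hS : IsOpen S)
    (hs : HolOn s S) (ht : HolOn t S) {z : ℂ} (hz : z ∈ S) :
    locOp a (fun w => s w + t w) z = locOp a s z + locOp a t z := by
  have h := ((hs.hasHolDeriv hS hz).add (ht.hasHolDeriv hS hz)).holDeriv_eq
  simp only [locOp, fibreOp, h, map_add, mul_add, dotProduct_add, add_smul]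
  abel

lemma locOp_smul {a : ℂ → Pair} (r : ℂ) {s : ℂ → FibL} {S : Set ℂ} (hS : IsOpen S)
    (hs : HolOn s S) {z : ℂ} (hz : z ∈ S) :
    locOp a (fun w => r • s w) z = r • locOp a s z := by
  have h := (HasHolDeriv.smul (hasDerivAt_const z r) (hs.hasHolDeriv hS hz)).holDeriv_eq
  simp only [locOp, fibreOp, h, map_smul, zero_smul, zero_add, mul_smul_comm, dotProduct_smul,
    smul_add, smul_smul, smul_eq_mul]

lemma locOp_mul {a : ℂ → Pair} {s t : ℂ → FibL} {S : Set ℂ} (hS : IsOpen S)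
    (hs : HolOn s S) (ht : HolOn t S) {z : ℂ} (hz : z ∈ S) :
    locOp a (fun w => s w * t w) z = locOp a s z * t z + s z * locOp a t z := by
  have h := ((hs.hasHolDeriv hS hz).mul (ht.hasHolDeriv hS hz)).holDeriv_eq
  rw [locOp, h, fibreOp_mul]
  rfl

/-- The linear map with local expression `locOp a`. -/
def opLin (hW : W ≤ C.dom) (a : ℂ → Pair) (ha : DifferentiableOn ℂ a (C.pre W)) :
    StrSheaf k W →ₗ[ℂ] StrSheaf k W where
  toFun s := C.ofLoc hW (locOp a (C.loc s)) (holOn_locOp (C.pre W).isOpen ha (C.holOn_loc hW s))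
  map_add' s t := C.ext_loc hW fun z hz => by
    rw [C.loc_add _ _ hz, C.loc_ofLoc _ _ _ hz, C.loc_ofLoc _ _ _ hz, C.loc_ofLoc _ _ _ hz,
      ← locOp_add (C.pre W).isOpen (C.holOn_loc hW s) (C.holOn_loc hW t) hz]
    exact locOp_congr (C.pre W).isOpen (C.holOn_loc hW _) (fun w hw => (C.loc_add s t hw).symm)
      rfl hz
  map_smul' r s := C.ext_loc hW fun z hz => by
    rw [RingHom.id_apply, C.loc_smul _ _ hz, C.loc_ofLoc _ _ _ hz, C.loc_ofLoc _ _ _ hz,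
      ← locOp_smul r (C.pre W).isOpen (C.holOn_loc hW s) hz]
    exact locOp_congr (C.pre W).isOpen (C.holOn_loc hW _) (fun w hw => (C.loc_smul r s hw).symm)
      rfl hz

lemma loc_opLin (hW : W ≤ C.dom) (a : ℂ → Pair) (ha : DifferentiableOn ℂ a (C.pre W))
    (s : StrSheaf k W) {z : ℂ} (hz : z ∈ C.pre W) :
    C.loc (C.opLin hW a ha s) z = locOp a (C.loc s) z :=
  C.loc_ofLoc hW _ (holOn_locOp (C.pre W).isOpen ha (C.holOn_loc hW s)) hz

/-- The vector field of degree two over `V` with local expression `locOp a`. -/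
def field (hV : V ≤ C.dom) (a : ℂ → Pair) (ha : DifferentiableOn ℂ a (C.pre V)) :
    VecFields k 2 V := by
  refine ⟨fun W => C.opLin (W.2.trans hV) a (ha.mono fun z hz => W.2 hz), ?_, ?_, ?_⟩
  · intro W W' h f
    refine C.ext_loc (W'.2.trans hV) fun z hz => ?_
    rw [C.loc_res h _ hz, C.loc_opLin _ _ _ _ hz, C.loc_opLin _ _ _ _ (h hz)]
    exact locOp_congr (C.pre W'.1).isOpen (C.holOn_loc (W'.2.trans hV) _)
      (fun w hw => (C.loc_res h f hw).symm) rfl hz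
  · intro W q f hf
    rw [C.mem_strDeg_iff (W.2.trans hV)] at hf ⊢
    intro z hz
    rw [C.loc_opLin _ _ _ _ hz]
    exact fibreOp_mem _ _ (hf z hz)
      (holDeriv_mem (C.holOn_loc (W.2.trans hV) f) (C.pre W.1).isOpen hf hz)
  · intro W q f _ g
    refine C.ext_loc (W.2.trans hV) fun z hz => ?_
    have e : (-1 : ℂ) ^ (2 * q) = 1 := by rw [pow_mul]; norm_num
    rw [e, one_smul, C.loc_add _ _ hz, C.loc_mul _ _ hz, C.loc_mul _ _ hz,
      C.loc_opLin _ _ _ _ hz, C.loc_opLin _ _ _ _ hz, C.loc_opLin _ _ _ _ hz,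
      ← locOp_mul (C.pre W.1).isOpen (C.holOn_loc (W.2.trans hV) f)
        (C.holOn_loc (W.2.trans hV) g) hz]
    exact locOp_congr (C.pre W.1).isOpen (C.holOn_loc (W.2.trans hV) _)
      (fun w hw => (C.loc_mul f g hw).symm) rfl hz

lemma loc_field (hV : V ≤ C.dom) (a : ℂ → Pair) (ha : DifferentiableOn ℂ a (C.pre V))
    (W : {W : Opens CP1 // W ≤ V}) (s : StrSheaf k W.1) {z : ℂ} (hz : z ∈ C.pre W.1) :
    C.loc ((C.field hV a ha).1 W s) z = locOp a (C.loc s) z :=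
  C.loc_opLin (W.2.trans hV) _ (ha.mono fun _ hz => W.2 hz) _ hz

end SuperChart
end Charts
end SuperCP1

end

/-! ### Coordinates of vector fields of degree two -/

noncomputable section

namespace SuperCP1
namespace SuperChart

variable {k : ℤ} (C : SuperChart k) {U V W : Opens CP1}

/-- The section whose local expression is constant. -/
def cst (hW : W ≤ C.dom) (b : FibL) : StrSheaf k W := C.ofLoc hW (fun _ => b) (holOn_const _ _)

lemma loc_cst (hW : W ≤ C.dom) (b : FibL) {z : ℂ} (hz : z ∈ C.pre W) :
    C.loc (C.cst hW b) z = b := C.loc_ofLoc hW _ (holOn_const _ _) hz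

/-- The section of degree zero given by a holomorphic function in the coordinate of the chart. -/
def scal (hW : W ≤ C.dom) (φ : ℂ → ℂ) (hφ : DifferentiableOn ℂ φ (C.pre W)) : StrSheaf k W :=
  C.ofLoc hW (fun z => φ z • 1) (HolOn.smul hφ (holOn_const _ _))

lemma loc_scal (hW : W ≤ C.dom) (φ : ℂ → ℂ) (hφ : DifferentiableOn ℂ φ (C.pre W)) {z : ℂ}
    (hz : z ∈ C.pre W) : C.loc (C.scal hW φ hφ) z = φ z • 1 :=
  C.loc_ofLoc hW _ (HolOn.smul hφ (holOn_const _ _)) hz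

lemma smul_one_mem (r : ℂ) : r • (1 : FibL) ∈ ⋀[ℂ]^0 FibE := by
  rw [ExteriorAlgebra.exteriorPower, pow_zero]
  exact Submodule.smul_mem _ _ (Submodule.one_le.1 le_rfl)

lemma ι_mem (u : FibE) : ExteriorAlgebra.ι ℂ u ∈ ⋀[ℂ]^1 FibE := by
  rw [ExteriorAlgebra.exteriorPower, pow_one]
  exact ⟨u, rfl⟩

lemma loc_zero (z : ℂ) : C.loc (0 : StrSheaf k U) z = 0 := by
  rw [loc]
  have : extendZero (0 : StrSheaf k U).1 (C.φ z) = 0 := by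
    unfold extendZero
    split_ifs <;> rfl
  rw [this, map_zero]

/-- The Leibniz rule for an even derivation, applied to a homogeneous left factor. -/
def IsEvenDerivation (D : StrSheaf k W →ₗ[ℂ] StrSheaf k W) : Prop :=
  ∀ (q : ℕ), ∀ f ∈ StrDeg k q W, ∀ g, D (f * g) = D f * g + f * D g

lemma apply_cst_one {D : StrSheaf k W →ₗ[ℂ] StrSheaf k W} (hD : IsEvenDerivation D)
    (hW : W ≤ C.dom) : D (C.cst hW 1) = 0 := by
  have h1 : C.cst hW 1 = 1 := C.ext_loc hW fun z hz => by
    rw [C.loc_cst hW _ hz, C.loc_of_mem _ hz]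
    exact (map_one (ExteriorAlgebra.map (scaleE (C.c z)))).symm
  have hd : C.cst hW 1 ∈ StrDeg k 0 W := (C.mem_strDeg_iff hW _ _).2 fun z hz => by
    rw [C.loc_cst hW _ hz, ← one_smul ℂ (1 : FibL)]
    exact smul_one_mem 1
  have h2 := hD 0 _ hd (C.cst hW 1)
  rw [h1, mul_one, mul_one, one_mul] at h2
  rw [h1]
  exact left_eq_add.1 h2

/-- The constant sections are generated by those with values `ξ_i`. -/
lemma apply_cst {D : StrSheaf k W →ₗ[ℂ] StrSheaf k W} (hD : IsEvenDerivation D)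
    (hW : W ≤ C.dom) (h : ∀ i, D (C.cst hW (gen i)) = 0) (b : FibL) :
    D (C.cst hW b) = 0 := by
  have hι : ∀ u : FibE, D (C.cst hW (ExteriorAlgebra.ι ℂ u)) = 0 := fun u => by
    have e : C.cst hW (ExteriorAlgebra.ι ℂ u) = ∑ i, u i • C.cst hW (gen i) := by
      rw [Fin.sum_univ_three]
      refine C.ext_loc hW fun z hz => ?_
      rw [C.loc_add _ _ hz, C.loc_add _ _ hz, C.loc_smul _ _ hz, C.loc_smul _ _ hz,
        C.loc_smul _ _ hz, C.loc_cst hW _ hz, C.loc_cst hW _ hz, C.loc_cst hW _ hz,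
        C.loc_cst hW _ hz, ι_eq_sum_gen]
    rw [e, map_sum]
    refine Finset.sum_eq_zero fun i _ => ?_
    rw [map_smul, h, smul_zero]
  induction b using CliffordAlgebra.left_induction with
  | algebraMap r =>
    have e : C.cst hW (algebraMap ℂ FibL r) = r • C.cst hW 1 := C.ext_loc hW fun z hz => by
      rw [C.loc_smul _ _ hz, C.loc_cst hW _ hz, C.loc_cst hW _ hz,
        Algebra.algebraMap_eq_smul_one]
    exact (congrArg D e).trans (by rw [map_smul, C.apply_cst_one hD hW, smul_zero])
  | add a b ha hb =>
    have e : C.cst hW (a + b) = C.cst hW a + C.cst hW b := C.ext_loc hW fun z hz => by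
      rw [C.loc_add _ _ hz, C.loc_cst hW _ hz, C.loc_cst hW _ hz, C.loc_cst hW _ hz]
    exact (congrArg D e).trans (by rw [map_add, ha, hb, add_zero])
  | ι_mul b u hb =>
    have e : C.cst hW (ExteriorAlgebra.ι ℂ u * b) =
        C.cst hW (ExteriorAlgebra.ι ℂ u) * C.cst hW b := C.ext_loc hW fun z hz => by
      rw [C.loc_mul _ _ hz, C.loc_cst hW _ hz, C.loc_cst hW _ hz, C.loc_cst hW _ hz]
    have hd : C.cst hW (ExteriorAlgebra.ι ℂ u) ∈ StrDeg k 1 W :=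
      (C.mem_strDeg_iff hW _ _).2 fun z hz => by
        rw [C.loc_cst hW _ hz]
        exact ι_mem u
    refine (congrArg D e).trans ?_
    rw [hD 1 _ hd, hι, hb, zero_mul, mul_zero, add_zero]

lemma apply_scal {D : StrSheaf k W →ₗ[ℂ] StrSheaf k W} (hD : IsEvenDerivation D)
    (hW : W ≤ C.dom) (h : D (C.scal hW id differentiableOn_id) = 0)
    (φ : ℂ → ℂ) (hφ : DifferentiableOn ℂ φ (C.pre W)) : D (C.scal hW φ hφ) = 0 := by
  refine C.ext_loc hW fun z hz => ?_
  -- `φ w = φ z + (w - z) ψ w` with `ψ` holomorphic reduces the claim to the coordinate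
  have hψ : DifferentiableOn ℂ (dslope φ z) (C.pre W) :=
    (Complex.differentiableOn_dslope ((C.pre W).isOpen.mem_nhds hz)).2 hφ
  have hz' : DifferentiableOn ℂ (fun w => w - z) (C.pre W) := differentiableOn_id.sub_const z
  have hXd : C.scal hW _ hz' ∈ StrDeg k 0 W := (C.mem_strDeg_iff hW _ _).2 fun w hw => by
    rw [C.loc_scal hW _ _ hw]
    exact smul_one_mem _
  have eX : C.scal hW _ hz' = C.scal hW id differentiableOn_id + (-z) • C.cst hW 1 :=
    C.ext_loc hW fun w hw => by
      rw [C.loc_add _ _ hw, C.loc_smul _ _ hw, C.loc_cst hW _ hw, C.loc_scal hW _ _ hw,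
        C.loc_scal hW _ _ hw, ← add_smul, id, sub_eq_add_neg]
  have hvX : D (C.scal hW _ hz') = 0 := by
    rw [eX, map_add, map_smul, C.apply_cst_one hD hW, h, smul_zero, add_zero]
  have e : C.scal hW φ hφ = φ z • C.cst hW 1 + C.scal hW _ hz' * C.scal hW _ hψ :=
    C.ext_loc hW fun w hw => by
      rw [C.loc_add _ _ hw, C.loc_smul _ _ hw, C.loc_mul _ _ hw, C.loc_scal hW _ _ hw,
        C.loc_scal hW _ _ hw, C.loc_scal hW _ _ hw, C.loc_cst hW _ hw, smul_mul_smul_comm,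
        one_mul, ← add_smul, ← smul_eq_mul, sub_smul_dslope, add_sub_cancel]
  rw [e, map_add, map_smul, C.apply_cst_one hD hW, hD 0 _ hXd, hvX, smul_zero, zero_mul,
    zero_add, zero_add, C.loc_mul _ _ hz, C.loc_scal hW _ _ hz, sub_self, zero_smul, zero_mul,
    C.loc_zero]

lemma eq_sum_scal_mul_cst (hW : W ≤ C.dom) (s : StrSheaf k W) :
    s = ∑ i, C.scal hW _ (C.holOn_loc hW s ((Module.finBasis ℂ FibL).coord i)) *
      C.cst hW (Module.finBasis ℂ FibL i) := by
  have hsum : ∀ (t : Finset (Fin (Module.finrank ℂ FibL)))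
      (S : Fin (Module.finrank ℂ FibL) → StrSheaf k W) {z : ℂ}, z ∈ C.pre W →
      C.loc (∑ i ∈ t, S i) z = ∑ i ∈ t, C.loc (S i) z := by
    intro t S z hz
    induction t using Finset.cons_induction with
    | empty => exact C.loc_zero z
    | cons i t hi ih => rw [Finset.sum_cons, Finset.sum_cons, C.loc_add _ _ hz, ih]
  refine C.ext_loc hW fun z hz => ?_
  rw [hsum _ _ hz]
  conv_lhs => rw [finBasis_expand (C.loc s z)]
  refine Finset.sum_congr rfl fun i _ => ?_
  rw [C.loc_mul _ _ hz, C.loc_scal hW _ _ hz, C.loc_cst hW _ hz, smul_mul_assoc, one_mul]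

/-- An even derivation that annihilates the coordinates `x, ξ_1, ξ_2, ξ_3` vanishes. -/
lemma IsEvenDerivation.eq_zero {D : StrSheaf k W →ₗ[ℂ] StrSheaf k W} (hD : IsEvenDerivation D)
    (hW : W ≤ C.dom) (h0 : D (C.scal hW id differentiableOn_id) = 0)
    (h1 : ∀ i, D (C.cst hW (gen i)) = 0) : D = 0 := by
  refine LinearMap.ext fun s => ?_
  rw [C.eq_sum_scal_mul_cst hW s, map_sum]
  refine Finset.sum_eq_zero fun i _ => ?_
  have hd : C.scal hW _ (C.holOn_loc hW s ((Module.finBasis ℂ FibL).coord i)) ∈ StrDeg k 0 W :=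
    (C.mem_strDeg_iff hW _ _).2 fun z hz => by
      rw [C.loc_scal hW _ _ hz]
      exact smul_one_mem _
  rw [hD 0 _ hd, C.apply_scal hD hW h0, C.apply_cst hD hW h1, zero_mul, mul_zero, add_zero]

lemma isEvenDerivation (v : VecFields k 2 V) (W : {W : Opens CP1 // W ≤ V}) :
    IsEvenDerivation (v.1 W) := fun q f hf g => by
  rw [v.2.2.2 W q f hf g, pow_mul]
  norm_num

/-- Two vector fields of degree two that agree on the coordinates are equal. -/
lemma eq_of_coordinates (hV : V ≤ C.dom) (v w : VecFields k 2 V)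
    (h0 : v.1 ⟨V, le_rfl⟩ (C.scal hV id differentiableOn_id) =
      w.1 ⟨V, le_rfl⟩ (C.scal hV id differentiableOn_id))
    (h1 : ∀ i, v.1 ⟨V, le_rfl⟩ (C.cst hV (gen i)) = w.1 ⟨V, le_rfl⟩ (C.cst hV (gen i))) :
    v = w := by
  refine Subtype.ext (funext fun W => ?_)
  have hW : W.1 ≤ C.dom := W.2.trans hV
  have e0 : C.scal hW id differentiableOn_id =
      res k W.2 (C.scal hV id differentiableOn_id) := C.ext_loc hW fun z hz => by
    rw [C.loc_res W.2 _ hz, C.loc_scal hW _ _ hz, C.loc_scal hV _ _ (W.2 hz)]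
  have e1 : ∀ i, C.cst hW (gen i) = res k W.2 (C.cst hV (gen i)) := fun i =>
    C.ext_loc hW fun z hz => by
      rw [C.loc_res W.2 _ hz, C.loc_cst hW _ hz, C.loc_cst hV _ (W.2 hz)]
  have hd : IsEvenDerivation (v.1 W - w.1 W) := fun q f hf g => by
    simp only [LinearMap.sub_apply, isEvenDerivation v W q f hf g,
      isEvenDerivation w W q f hf g, sub_mul, mul_sub]
    abel
  refine sub_eq_zero.1 (IsEvenDerivation.eq_zero C hd hW ?_ fun i => ?_)
  · rw [LinearMap.sub_apply, e0, v.2.1 ⟨V, le_rfl⟩ W W.2, w.2.1 ⟨V, le_rfl⟩ W W.2, h0, sub_self]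
  · rw [LinearMap.sub_apply, e1, v.2.1 ⟨V, le_rfl⟩ W W.2, w.2.1 ⟨V, le_rfl⟩ W W.2, h1, sub_self]

/-- The coordinates `(f, g)` of a vector field of degree two: `x ↦ ∑ f_i ∂(ξ_1 ξ_2 ξ_3)/∂ξ_i` and
`ξ_i ↦ g_i ξ_1 ξ_2 ξ_3`. -/
def coords (hV : V ≤ C.dom) (v : VecFields k 2 V) (z : ℂ) : Pair :=
  (fun i => topCoeff (C.loc (v.1 ⟨V, le_rfl⟩ (C.scal hV id differentiableOn_id)) z * gen i),
    fun i => topCoeff (C.loc (v.1 ⟨V, le_rfl⟩ (C.cst hV (gen i))) z))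

lemma differentiableOn_coords (hV : V ≤ C.dom) (v : VecFields k 2 V) :
    DifferentiableOn ℂ (C.coords hV v) (C.pre V) :=
  .prodMk (differentiableOn_pi.2 fun i =>
      C.holOn_loc hV _ (topCoeff ∘ₗ LinearMap.mulRight ℂ (gen i)))
    (differentiableOn_pi.2 fun _ => C.holOn_loc hV _ topCoeff)

lemma locOp_scal (hV : V ≤ C.dom) (a : ℂ → Pair) {z : ℂ} (hz : z ∈ C.pre V) :
    locOp a (C.loc (C.scal hV id differentiableOn_id)) z = bivector (a z).1 := by
  have h : HasHolDeriv (C.loc (C.scal hV id differentiableOn_id)) ((1 : ℂ) • 1) z :=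
    (HasHolDeriv.smul_const (hasDerivAt_id z) 1).congr (C.pre V).isOpen hz
      fun w hw => C.loc_scal hV _ _ hw
  rw [locOp, h.holDeriv_eq, C.loc_scal hV _ _ hz, fibreOp, map_smul, degOne_one, one_smul, mul_one,
    smul_zero, dotProduct_zero, zero_smul, add_zero]

lemma locOp_cst (hV : V ≤ C.dom) (a : ℂ → Pair) (i : Fin 3) {z : ℂ} (hz : z ∈ C.pre V) :
    locOp a (C.loc (C.cst hV (gen i))) z = (a z).2 i • topForm := by
  have h : HasHolDeriv (C.loc (C.cst hV (gen i))) 0 z :=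
    (hasHolDeriv_const (gen i) z).congr (C.pre V).isOpen hz fun w hw => C.loc_cst hV _ hw
  rw [locOp, h.holDeriv_eq, C.loc_cst hV _ hz, fibreOp, mul_zero, zero_add, gen, degOne_ι]
  simp

lemma coords_of_loc (hV : V ≤ C.dom) (v : VecFields k 2 V) (a : ℂ → Pair) {z : ℂ}
    (hz : z ∈ C.pre V)
    (h : ∀ s : StrSheaf k V, C.loc (v.1 ⟨V, le_rfl⟩ s) z = locOp a (C.loc s) z) :
    C.coords hV v z = a z := by
  rw [coords, h, C.locOp_scal hV a hz]
  refine Prod.ext (funext fun i => topCoeff_bivector_mul_gen _ i) (funext fun i => ?_)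
  simp only
  rw [h, C.locOp_cst hV a i hz, map_smul, topCoeff_topForm, smul_eq_mul, mul_one]

lemma coords_field (hV : V ≤ C.dom) (a : ℂ → Pair) (ha : DifferentiableOn ℂ a (C.pre V)) {z : ℂ}
    (hz : z ∈ C.pre V) : C.coords hV (C.field hV a ha) z = a z :=
  C.coords_of_loc hV _ a hz fun s => C.loc_field hV a ha ⟨V, le_rfl⟩ s hz

/-- A vector field of degree two is recovered from its coordinates: its value on `x` is a
bivector and its values on the `ξ_i` are multiples of the top form. -/
lemma field_coords (hV : V ≤ C.dom) (v : VecFields k 2 V) :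
    C.field hV _ (C.differentiableOn_coords hV v) = v := by
  have ha := C.differentiableOn_coords hV v
  refine Eq.symm (C.eq_of_coordinates hV _ _ (C.ext_loc hV fun z hz => ?_)
    fun i => C.ext_loc hV fun z hz => ?_)
  · rw [C.loc_field hV _ ha ⟨V, le_rfl⟩ _ hz, C.locOp_scal hV _ hz]
    have hd : v.1 ⟨V, le_rfl⟩ (C.scal hV id differentiableOn_id) ∈ StrDeg k (2 + 0) V :=
      v.2.2.1 ⟨V, le_rfl⟩ 0 _ <| (C.mem_strDeg_iff hV _ _).2 fun w hw => by
        rw [C.loc_scal hV _ _ hw]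
        exact smul_one_mem _
    obtain ⟨f, hf⟩ := exists_bivector ((C.mem_strDeg_iff hV _ _).1 hd z hz)
    simp only [coords]
    rw [hf]
    simp only [topCoeff_bivector_mul_gen]
  · rw [C.loc_field hV _ ha ⟨V, le_rfl⟩ _ hz, C.locOp_cst hV _ i hz]
    have hd : v.1 ⟨V, le_rfl⟩ (C.cst hV (gen i)) ∈ StrDeg k (2 + 1) V :=
      v.2.2.1 ⟨V, le_rfl⟩ 1 _ <| (C.mem_strDeg_iff hV _ _).2 fun w hw => by
        rw [C.loc_cst hV _ hw]
        exact ι_mem _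
    exact eq_topCoeff_smul ((C.mem_strDeg_iff hV _ _).1 hd z hz)

/-- A vector field of degree two acts in a chart through its coordinates. -/
lemma loc_apply (hV : V ≤ C.dom) (v : VecFields k 2 V) (W : {W : Opens CP1 // W ≤ V})
    (s : StrSheaf k W.1) {z : ℂ} (hz : z ∈ C.pre W.1) :
    C.loc (v.1 W s) z = locOp (C.coords hV v) (C.loc s) z := by
  have h := C.loc_field hV _ (C.differentiableOn_coords hV v) W s hz
  rwa [C.field_coords hV v] at h

lemma ext_coords (hV : V ≤ C.dom) {v w : VecFields k 2 V}
    (h : ∀ z ∈ C.pre V, C.coords hV v z = C.coords hV w z) : v = w := by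
  refine Subtype.ext (funext fun W => LinearMap.ext fun s =>
    C.ext_loc (W.2.trans hV) fun z hz => ?_)
  rw [C.loc_apply hV v W s hz, C.loc_apply hV w W s hz, locOp, locOp, h z (W.2 hz)]

lemma coords_resVec (hV : V ≤ C.dom) (h : W ≤ V) (v : VecFields k 2 V) {z : ℂ}
    (hz : z ∈ C.pre W) : C.coords (h.trans hV) (resVec k 2 h v) z = C.coords hV v z :=
  C.coords_of_loc _ _ _ hz fun s => C.loc_apply hV v ⟨W, h⟩ s hz

lemma coords_add (hV : V ≤ C.dom) (v w : VecFields k 2 V) {z : ℂ} (hz : z ∈ C.pre V) :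
    C.coords hV (v + w) z = C.coords hV v z + C.coords hV w z := by
  refine Prod.ext (funext fun i => ?_) (funext fun i => ?_)
  · refine (congrArg (fun a => topCoeff (a * gen i)) (C.loc_add _ _ hz)).trans ?_
    rw [add_mul, map_add]
    rfl
  · refine (congrArg topCoeff (C.loc_add _ _ hz)).trans ?_
    rw [map_add]
    rfl

lemma coords_smul (hV : V ≤ C.dom) (r : ℂ) (v : VecFields k 2 V) {z : ℂ} (hz : z ∈ C.pre V) :
    C.coords hV (r • v) z = r • C.coords hV v z := by
  refine Prod.ext (funext fun i => ?_) (funext fun i => ?_)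
  · refine (congrArg (fun a => topCoeff (a * gen i)) (C.loc_smul _ _ hz)).trans ?_
    rw [smul_mul_assoc, map_smul]
    rfl
  · refine (congrArg topCoeff (C.loc_smul _ _ hz)).trans ?_
    rw [map_smul]
    rfl

end SuperChart
end SuperCP1

end

/-! ### Vanishing of the first cohomology of a chart -/

noncomputable section

namespace SuperCP1

section SheafSections

variable {X : TopCat.{0}} {F G : Sheaf (Opens.grothendieckTopology X) AddCommGrpCat.{0}}
  {U V W : Opens X}

/-- Restriction of sections of an abelian sheaf. -/
def secRes (F : Sheaf (Opens.grothendieckTopology X) AddCommGrpCat.{0}) (h : V ≤ U) :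
    F.obj.obj (op U) →+ F.obj.obj (op V) := (F.obj.map (homOfLE h).op).hom

/-- The map on sections over `U` given by a morphism of abelian sheaves. -/
def secMap (f : F ⟶ G) (U : Opens X) : F.obj.obj (op U) →+ G.obj.obj (op U) :=
  (f.hom.app (op U)).hom

lemma secRes_secRes (h : W ≤ V) (h' : V ≤ U) (s : F.obj.obj (op U)) :
    secRes F h (secRes F h' s) = secRes F (h.trans h') s := by
  have e := F.obj.map_comp (homOfLE h').op (homOfLE h).op
  exact (congrArg (fun m => m.hom s) e).symm

lemma secRes_secMap (f : F ⟶ G) (h : V ≤ U) (s : F.obj.obj (op U)) :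
    secRes G h (secMap f U s) = secMap f V (secRes F h s) :=
  (congrArg (fun m => m.hom s) (f.hom.naturality (homOfLE h).op)).symm

lemma exists_secGlue {ι : Type} (U : ι → Opens X) (hV : V ≤ iSup U) (hU : ∀ i, U i ≤ V)
    (s : ∀ i, F.obj.obj (op (U i)))
    (h : ∀ i j, secRes F (inf_le_left : U i ⊓ U j ≤ U i) (s i) = secRes F inf_le_right (s j)) :
    ∃ t : F.obj.obj (op V), ∀ i, secRes F (hU i) t = s i :=
  (TopCat.Sheaf.existsUnique_gluing' (F := F) U V (fun i => homOfLE (hU i)) hV s h).exists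

lemma secRes_ext {ι : Type} (U : ι → Opens X) (hV : V ≤ iSup U) (hU : ∀ i, U i ≤ V)
    {s t : F.obj.obj (op V)} (h : ∀ i, secRes F (hU i) s = secRes F (hU i) t) : s = t :=
  TopCat.Sheaf.eq_of_locally_eq' (F := F) U V (fun i => homOfLE (hU i)) hV s t h

variable {S : ShortComplex (Sheaf (Opens.grothendieckTopology X) AddCommGrpCat.{0})}

lemma exists_secMap_eq_of_shortExact (hS : S.ShortExact) {t : S.X₂.obj.obj (op U)}
    (ht : secMap S.g U t = 0) : ∃ s, secMap S.f U s = t :=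
  TopCat.Sheaf.sections_exact_of_left_exact hS.1 hS.2 t ht

lemma secMap_secMap_of_complex (s : S.X₁.obj.obj (op U)) : secMap S.g U (secMap S.f U s) = 0 :=
  congrArg (fun f : S.X₁ ⟶ S.X₃ => secMap f U s) S.zero

lemma exists_local_lift (hS : S.ShortExact) (q : S.X₃.obj.obj (op U)) {x : X} (hx : x ∈ U) :
    ∃ (V : Opens X) (hV : V ≤ U) (t : S.X₂.obj.obj (op V)), x ∈ V ∧
      secMap S.g V t = secRes S.X₃ hV q := by
  have := (TopCat.Sheaf.isLocallySurjective_iff_epi S.g).mpr hS.epi_g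
  obtain ⟨W, hW, ⟨t, ht⟩, hx⟩ :=
    (TopCat.Presheaf.isLocallySurjective_iff S.g.hom).mp this U q x hx
  exact ⟨W, hW, t, hx, ht⟩

end SheafSections

namespace SuperChart

variable {k : ℤ} (C : SuperChart k) {U V W : Opens CP1}

lemma field_add (hV : V ≤ C.dom) (a b : ℂ → Pair) (ha : DifferentiableOn ℂ a (C.pre V))
    (hb : DifferentiableOn ℂ b (C.pre V)) :
    C.field hV (a + b) (ha.add hb) = C.field hV a ha + C.field hV b hb :=
  C.ext_coords hV fun z hz => by
    rw [C.coords_add hV _ _ hz, C.coords_field hV _ _ hz, C.coords_field hV _ _ hz,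
      C.coords_field hV _ _ hz, Pi.add_apply]

lemma field_congr (hV : V ≤ C.dom) {a b : ℂ → Pair} (ha : DifferentiableOn ℂ a (C.pre V))
    (hb : DifferentiableOn ℂ b (C.pre V)) (h : ∀ z ∈ C.pre V, a z = b z) :
    C.field hV a ha = C.field hV b hb :=
  C.ext_coords hV fun z hz => by
    rw [C.coords_field hV _ _ hz, C.coords_field hV _ _ hz, h z hz]

/-- The open subset of the sphere corresponding to an open subset of the plane. -/
def img (W : Opens ℂ) : Opens CP1 := ⟨C.φ '' W, C.isOpenEmbedding.isOpenMap _ W.isOpen⟩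

lemma img_mono {W W' : Opens ℂ} (h : W ≤ W') : C.img W ≤ C.img W' := Set.image_mono h

lemma img_le_dom (W : Opens ℂ) : C.img W ≤ C.dom := Set.image_subset_range _ _

lemma dom_le_img_top : C.dom ≤ C.img ⊤ := by
  rintro _ ⟨z, rfl⟩
  exact ⟨z, trivial, rfl⟩

lemma pre_img (W : Opens ℂ) : (C.pre (C.img W) : Set ℂ) = W :=
  Set.preimage_image_eq _ C.isOpenEmbedding.injective

lemma img_inf_le (W W' : Opens ℂ) : C.img W ⊓ C.img W' ≤ C.img (W ⊓ W') := by
  rintro _ ⟨⟨z, hz, rfl⟩, z', hz', h⟩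
  rw [C.isOpenEmbedding.injective h] at hz'
  exact ⟨z, ⟨hz, hz'⟩, rfl⟩

lemma img_iSup_le {ι : Type} (W : ι → Opens ℂ) : C.img (iSup W) ≤ ⨆ i, C.img (W i) := by
  rintro _ ⟨z, hz, rfl⟩
  obtain ⟨i, hi⟩ := Opens.mem_iSup.1 hz
  exact Opens.mem_iSup.2 ⟨i, z, hi, rfl⟩

/-- The vector field of degree two on the image of `W` with coordinates `a`. -/
def fieldImg (W : Opens ℂ) (a : ℂ → Pair) (ha : DifferentiableOn ℂ a W) :
    VecFields k 2 (C.img W) :=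
  C.field (C.img_le_dom W) a (by rwa [C.pre_img])

variable {G H : Sheaf (Opens.grothendieckTopology CP1) AddCommGrpCat.{0}} (f : vecSheaf k 2 ⟶ G)
  (g : G ⟶ H) (w : f ≫ g = 0) (hS : (ShortComplex.mk f g w).ShortExact)

/-- The local lifts to `G` of a section of the quotient `H` of `G` by the sheaf `T_2` form a torsor
under the holomorphic functions that are the coordinates of vector fields. -/
def liftTorsor (q : H.obj.obj (op C.dom)) : HolTorsor Pair where
  sec W := {t : G.obj.obj (op (C.img W)) //
    secMap g _ t = secRes H (C.img_le_dom W) q}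
  res h s := ⟨secRes G (C.img_mono h) s.1, by rw [← secRes_secMap, s.2, secRes_secRes]⟩
  res_res h h' s := Subtype.ext (secRes_secRes _ _ _)
  act {W} a ha s := ⟨s.1 + secMap f (C.img W) (C.fieldImg W a ha), by
    rw [map_add, s.2]
    exact add_eq_left.2 (secMap_secMap_of_complex (S := ShortComplex.mk f g w) _)⟩
  res_act {V W} h a ha s := Subtype.ext <| by
    simp only [map_add]
    exact congrArg _ (secRes_secMap f (C.img_mono h) (C.fieldImg W a ha))
  act_act {W} a b ha hb s := Subtype.ext <| by
    have e : C.fieldImg W (a + b) (ha.add hb) = C.fieldImg W a ha + C.fieldImg W b hb :=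
      C.field_add _ _ _ _ _
    simp only [e]
    rw [add_assoc]
    congr 1
    rw [add_comm]
    exact (map_add (secMap f (C.img W)) _ _).symm
  act_congr {W} a b ha hb h s := Subtype.ext <| by
    have e : C.fieldImg W a ha = C.fieldImg W b hb := C.field_congr _ _ _ fun z hz => by
      rw [← SetLike.mem_coe, C.pre_img] at hz
      exact h hz
    simp only [e]
  exists_act {W} s t := by
    have h0 : secMap g _ (t.1 - s.1) = 0 := by rw [map_sub, s.2, t.2, sub_self]
    obtain ⟨v, hv⟩ := exists_secMap_eq_of_shortExact hS h0
    have hd : DifferentiableOn ℂ (C.coords (C.img_le_dom W) v) W := by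
      have := C.differentiableOn_coords (C.img_le_dom W) v
      rwa [C.pre_img] at this
    refine ⟨_, hd, Subtype.ext ?_⟩
    have e : C.fieldImg W _ hd = v := C.field_coords (C.img_le_dom W) v
    simp only [e]
    exact (congrArg (s.1 + ·) hv).trans (add_sub_cancel _ _)
  exists_glue {ι} U s h := by
    obtain ⟨t, ht⟩ := exists_secGlue (F := G) (fun i => C.img (U i)) (C.img_iSup_le U)
      (fun i => C.img_mono (le_iSup U i)) (fun i => (s i).1) fun i j => by
        have e := congrArg (secRes G (C.img_inf_le (U i) (U j))) (congrArg Subtype.val (h i j))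
        rwa [secRes_secRes, secRes_secRes] at e
    refine ⟨⟨t, ?_⟩, fun i => Subtype.ext (ht i)⟩
    refine secRes_ext (fun i => C.img (U i)) (C.img_iSup_le U)
      (fun i => C.img_mono (le_iSup U i)) fun i => ?_
    rw [secRes_secMap, ht, (s i).2, secRes_secRes]
  locally_nonempty z := by
    obtain ⟨V, hV, t, hz, ht⟩ := exists_local_lift hS q (x := C.φ z) ⟨z, rfl⟩
    refine ⟨C.pre V, hz, ⟨secRes G ?_ t, ?_⟩⟩
    · rintro _ ⟨w, hw, rfl⟩
      exact hw
    · rw [← secRes_secMap]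
      exact (congrArg _ ht).trans (secRes_secRes _ _ _)

/-- The sheaf `T_2` has no first cohomology over the domain of a chart. -/
lemma ext_freeSheaf_dom_eq_zero (x : Abelian.Ext (freeSheaf C.dom) (vecSheaf k 2) 1) : x = 0 := by
  refine ext_freeSheaf_eq_zero C.dom (fun S hS hF q => ?_) x
  obtain @⟨X₁, G, H, f, g, w⟩ := S
  subst hF
  obtain ⟨t, ht⟩ := (C.liftTorsor f g w hS q).nonempty_sec_top
  refine ⟨secRes G C.dom_le_img_top t, ?_⟩
  change secMap g _ _ = q
  rw [← secRes_secMap, ht, secRes_secRes]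
  exact congrArg (fun m => m.hom q) (H.obj.map_id _)

end SuperChart
end SuperCP1

end

/-! ### The two standard charts and the change of coordinates -/

noncomputable section

namespace SuperCP1

section StandardCharts

lemma chartInf_of_ne {y : ℂ} (hy : y ≠ 0) : chartInf y = chartZero y⁻¹ := if_neg hy

lemma chartInf_zero : chartInf 0 = OnePoint.infty := if_pos rfl

lemma chartInf_inv {x : ℂ} (hx : x ≠ 0) : chartInf x⁻¹ = chartZero x := by
  rw [chartInf_of_ne (inv_ne_zero hx), inv_inv]

lemma chartZero_injective : Function.Injective chartZero := OnePoint.coe_injective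

lemma chartZero_ne_infty (x : ℂ) : chartZero x ≠ OnePoint.infty := OnePoint.coe_ne_infty x

lemma chartInf_injective : Function.Injective chartInf := by
  intro y y' h
  by_cases hy : y = 0 <;> by_cases hy' : y' = 0
  · rw [hy, hy']
  · rw [hy, chartInf_zero, chartInf_of_ne hy'] at h
    exact absurd h.symm (chartZero_ne_infty _)
  · rw [hy', chartInf_zero, chartInf_of_ne hy] at h
    exact absurd h (chartZero_ne_infty _)
  · rw [chartInf_of_ne hy, chartInf_of_ne hy'] at h
    exact inv_injective (chartZero_injective h)

lemma chartInf_eq_chartZero_iff {x y : ℂ} : chartInf y = chartZero x ↔ x ≠ 0 ∧ y = x⁻¹ := by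
  constructor
  · intro h
    by_cases hy : y = 0
    · rw [hy, chartInf_zero] at h
      exact absurd h.symm (chartZero_ne_infty _)
    · rw [chartInf_of_ne hy] at h
      have := chartZero_injective h
      exact ⟨this ▸ inv_ne_zero hy, by rw [← this, inv_inv]⟩
  · rintro ⟨hx, rfl⟩
    exact chartInf_inv hx

lemma isOpenMap_chartInf : IsOpenMap chartInf := by
  intro S hS
  have hpre : ((↑) : ℂ → OnePoint ℂ) ⁻¹' (chartInf '' S) = {0}ᶜ ∩ (fun x : ℂ => x⁻¹) ⁻¹' S := by
    ext x
    constructor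
    · rintro ⟨y, hy, h⟩
      obtain ⟨hx, rfl⟩ := chartInf_eq_chartZero_iff.1 h
      exact ⟨hx, hy⟩
    · rintro ⟨hx, hy⟩
      exact ⟨x⁻¹, hy, chartInf_inv hx⟩
  have hopen : IsOpen (((↑) : ℂ → OnePoint ℂ) ⁻¹' (chartInf '' S)) := by
    rw [hpre]
    exact continuousOn_inv₀.isOpen_inter_preimage isOpen_compl_singleton hS
  by_cases h : OnePoint.infty ∈ chartInf '' S
  · refine (OnePoint.isOpen_iff_of_mem h).2 ⟨hopen.isClosed_compl, ?_⟩
    obtain ⟨y, hy, hy0⟩ := h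
    rw [← chartInf_zero] at hy0
    rw [chartInf_injective hy0] at hy
    obtain ⟨ε, hε, hball⟩ := Metric.isOpen_iff.1 hS 0 hy
    refine (isCompact_closedBall (0 : ℂ) ε⁻¹).of_isClosed_subset hopen.isClosed_compl
      fun x hx => ?_
    by_contra hn
    rw [mem_closedBall_zero_iff, not_le] at hn
    refine hx ?_
    rw [hpre]
    refine ⟨fun h0 => ?_, hball ?_⟩
    · rw [Set.mem_singleton_iff.1 h0, norm_zero] at hn
      exact absurd hn (not_lt.2 (inv_pos.2 hε).le)
    · rw [mem_ball_zero_iff, norm_inv]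
      exact inv_lt_of_inv_lt₀ hε hn
  · exact (OnePoint.isOpen_iff_of_notMem h).2 hopen

lemma isOpenEmbedding_chartInf : Topology.IsOpenEmbedding chartInf :=
  .of_continuous_injective_isOpenMap continuous_chartInf chartInf_injective isOpenMap_chartInf

lemma HolOn.comp_inv {F : Type} [AddCommGroup F] [Module ℂ F] {s : ℂ → F} {S T : Set ℂ}
    (hs : HolOn s S) (h0 : ∀ z ∈ T, z ≠ 0) (h : ∀ z ∈ T, z⁻¹ ∈ S) :
    HolOn (fun z => s z⁻¹) T := fun l =>
  (hs l).comp (fun z hz => (differentiableAt_inv (h0 z hz)).differentiableWithinAt) h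

lemma HolOn.scaleL {c : ℂ → ℂ} {s : ℂ → FibL} {S : Set ℂ} (hs : HolOn s S)
    (hc : DifferentiableOn ℂ c S) : HolOn (fun z => SuperCP1.scaleL (c z) (s z)) S :=
  hs.exteriorMap (fun z => scaleE (c z)) fun v => HolOn.smul hc (holOn_const v S)

lemma differentiableOn_zpow_of_ne {S : Set ℂ} (h : ∀ z ∈ S, z ≠ 0) (n : ℤ) :
    DifferentiableOn ℂ (fun z : ℂ => z ^ n) S := fun z hz =>
  (differentiableAt_zpow.2 (Or.inl (h z hz))).differentiableWithinAt

lemma frameFactor_inv (k : ℤ) {x : ℂ} (hx : x ≠ 0) : frameFactor k x⁻¹ = x ^ k := by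
  rw [frameFactor, if_neg (inv_ne_zero hx), inv_zpow', neg_neg]

lemma frameFactor_ne_zero (k : ℤ) (y : ℂ) : frameFactor k y ≠ 0 := by
  rw [frameFactor]
  split_ifs with h
  · exact one_ne_zero
  · exact zpow_ne_zero _ h

/-- The chart with coordinate `x` and frame `ξ`. -/
def zeroChart (k : ℤ) : SuperChart k where
  φ := chartZero
  isOpenEmbedding := OnePoint.isOpenEmbedding_coe
  c _ := 1
  c_ne _ := one_ne_zero
  isHolSection_iff U hU s := by
    simp only [scaleL_one]
    refine ⟨fun h => h.1, fun h => ⟨h, ?_⟩⟩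
    have h0 : ∀ y ∈ chartInf ⁻¹' (U : Set CP1), y ≠ 0 := by
      rintro y hy rfl
      obtain ⟨x, hx⟩ := hU hy
      exact chartZero_ne_infty x (hx.trans chartInf_zero)
    have h1 := (h.comp_inv (T := chartInf ⁻¹' (U : Set CP1)) h0 fun y hy => by
      rw [Set.mem_preimage, ← chartInf_of_ne (h0 y hy)]
      exact hy).scaleL (differentiableOn_zpow_of_ne h0 (-k))
    refine h1.congr fun y hy => ?_
    rw [chartInf_of_ne (h0 y hy), frameFactor, if_neg (h0 y hy)]

/-- The chart with coordinate `y = 1 / x` and frame `η`. -/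
def infChart (k : ℤ) : SuperChart k where
  φ := chartInf
  isOpenEmbedding := isOpenEmbedding_chartInf
  c := frameFactor k
  c_ne := frameFactor_ne_zero k
  isHolSection_iff U hU s := by
    refine ⟨fun h => h.2, fun h => ⟨?_, h⟩⟩
    have h0 : ∀ x ∈ chartZero ⁻¹' (U : Set CP1), x ≠ 0 := by
      rintro x hx rfl
      obtain ⟨y, hy⟩ := hU hx
      exact (chartInf_eq_chartZero_iff.1 hy).1 rfl
    have h1 := (h.comp_inv (T := chartZero ⁻¹' (U : Set CP1)) h0 fun x hx => by
      rw [Set.mem_preimage, chartInf_inv (h0 x hx)]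
      exact hx).scaleL (differentiableOn_zpow_of_ne h0 (-k))
    refine h1.congr fun x hx => ?_
    rw [chartInf_inv (h0 x hx), frameFactor_inv k (h0 x hx), scaleL_scaleL,
      ← zpow_add₀ (h0 x hx), neg_add_cancel, zpow_zero, scaleL_one]

variable {k : ℤ}

lemma dom_sup_dom : (zeroChart k).dom ⊔ (infChart k).dom = ⊤ := by
  refine top_unique fun p _ => ?_
  induction p using OnePoint.rec with
  | infty => exact Or.inr ⟨0, chartInf_zero⟩
  | coe x => exact Or.inl ⟨x, rfl⟩

variable {V : Opens CP1}

lemma pre_zero_dom : ((zeroChart k).pre (zeroChart k).dom : Set ℂ) = Set.univ :=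
  Set.eq_univ_of_forall fun x => ⟨x, rfl⟩

lemma pre_inf_dom : ((infChart k).pre (infChart k).dom : Set ℂ) = Set.univ :=
  Set.eq_univ_of_forall fun x => ⟨x, rfl⟩

lemma mem_pre_zero_overlap {x : ℂ} :
    x ∈ (zeroChart k).pre ((zeroChart k).dom ⊓ (infChart k).dom) ↔ x ≠ 0 := by
  constructor
  · rintro ⟨-, y, hy⟩
    exact (chartInf_eq_chartZero_iff.1 hy).1
  · exact fun hx => ⟨⟨x, rfl⟩, x⁻¹, chartInf_inv hx⟩

lemma pre_zero_overlap :
    ((zeroChart k).pre ((zeroChart k).dom ⊓ (infChart k).dom) : Set ℂ) = {0}ᶜ :=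
  Set.ext fun _ => mem_pre_zero_overlap

lemma loc_zero_eq (s : StrSheaf k V) {x : ℂ} (hx : x ≠ 0) :
    (zeroChart k).loc s x = scaleL (x ^ (-k)) ((infChart k).loc s x⁻¹) := by
  change scaleL 1 (extendZero s.1 (chartZero x)) =
    scaleL (x ^ (-k)) (scaleL (frameFactor k x⁻¹) (extendZero s.1 (chartInf x⁻¹)))
  rw [chartInf_inv hx, frameFactor_inv k hx, scaleL_scaleL, ← zpow_add₀ hx, neg_add_cancel,
    zpow_zero]

lemma loc_inf_eq (s : StrSheaf k V) {y : ℂ} (hy : y ≠ 0) :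
    (infChart k).loc s y = scaleL (y ^ (-k)) ((zeroChart k).loc s y⁻¹) := by
  rw [loc_zero_eq s (inv_ne_zero hy), scaleL_scaleL, inv_inv, inv_zpow', neg_neg, ← zpow_add₀ hy,
    neg_add_cancel, zpow_zero, scaleL_one]

open SuperChart

/-- The change of coordinates of vector fields of degree two from the chart at infinity to the
chart at zero. -/
def transition (k : ℤ) (x : ℂ) (b : Pair) : Pair :=
  (-x ^ (2 - 2 * k) • b.1, x ^ (-2 * k) • b.2 - (k * x ^ (1 - 2 * k)) • b.1)

/-- The coordinates in the two charts are compared by evaluating the vector field on `x` and on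
the `ξ_i`, which are `y⁻¹` and `y ^ (-k) η_i` in the chart at infinity. -/
lemma coords_zero_eq (h0 : V ≤ (zeroChart k).dom) (h1 : V ≤ (infChart k).dom)
    (v : VecFields k 2 V) {x : ℂ} (hx : x ∈ (zeroChart k).pre V) :
    (zeroChart k).coords h0 v x = transition k x ((infChart k).coords h1 v x⁻¹) := by
  have hne : ∀ y ∈ (infChart k).pre V, y ≠ 0 := by
    rintro y hy rfl
    obtain ⟨x, hx⟩ := h0 hy
    exact chartZero_ne_infty x (hx.trans chartInf_zero)
  have hx0 : x ≠ 0 := (mem_pre_zero_overlap (k := k)).1 ⟨h0 hx, h1 hx⟩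
  have hpre : ∀ y ∈ (infChart k).pre V, y⁻¹ ∈ (zeroChart k).pre V := fun y hy => by
    change chartZero y⁻¹ ∈ V
    rw [← chartInf_of_ne (hne y hy)]
    exact hy
  have hxi : x⁻¹ ∈ (infChart k).pre V := by
    change chartInf x⁻¹ ∈ V
    rw [chartInf_inv hx0]
    exact hx
  set b := (infChart k).coords h1 v with hb
  have key : ∀ s : StrSheaf k V, (zeroChart k).loc (v.1 ⟨V, le_rfl⟩ s) x =
      scaleL (x ^ (-k)) (fibreOp (b x⁻¹).1 (b x⁻¹).2 ((infChart k).loc s x⁻¹)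
        (holDeriv ((infChart k).loc s) x⁻¹)) := fun s => by
    rw [loc_zero_eq _ hx0, (infChart k).loc_apply h1 v ⟨V, le_rfl⟩ s hxi]
    rfl
  have e1 : ∀ y ∈ (infChart k).pre V,
      (infChart k).loc ((zeroChart k).scal h0 id differentiableOn_id) y = y⁻¹ • 1 := fun y hy => by
    rw [loc_inf_eq _ (hne y hy), (zeroChart k).loc_scal h0 _ _ (hpre y hy), id, map_smul]
    congr 1
    exact map_one (ExteriorAlgebra.map (scaleE _))
  have d1 : holDeriv ((infChart k).loc ((zeroChart k).scal h0 id differentiableOn_id)) x⁻¹ =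
      (-x ^ 2) • 1 := by
    have h := (HasHolDeriv.smul_const (hasDerivAt_inv (inv_ne_zero hx0)) (1 : FibL)).congr
      ((infChart k).pre V).isOpen hxi e1
    rw [h.holDeriv_eq, inv_pow, inv_inv]
  have e2 : ∀ i, ∀ y ∈ (infChart k).pre V,
      (infChart k).loc ((zeroChart k).cst h0 (gen i)) y = y ^ (-k) • gen i := fun i y hy => by
    rw [loc_inf_eq _ (hne y hy), (zeroChart k).loc_cst h0 _ (hpre y hy), gen, scaleL_ι]
  have d2 : ∀ i, holDeriv ((infChart k).loc ((zeroChart k).cst h0 (gen i))) x⁻¹ =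
      (-k * x ^ (k + 1)) • gen i := fun i => by
    have h := (HasHolDeriv.smul_const (hasDerivAt_zpow (-k) x⁻¹ (Or.inl (inv_ne_zero hx0)))
      (gen i)).congr ((infChart k).pre V).isOpen hxi (e2 i)
    rw [h.holDeriv_eq, inv_zpow', neg_sub, sub_neg_eq_add, add_comm 1 k]
    push_cast
    rfl
  refine Prod.ext (funext fun i => ?_) (funext fun i => ?_)
  · change topCoeff (_ * gen i) = (-x ^ (2 - 2 * k) • (b x⁻¹).1) i
    rw [key, d1, e1 _ hxi, inv_inv, fibreOp, map_smul, degOne_one, smul_zero, dotProduct_zero,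
      zero_smul, add_zero, mul_smul_comm, mul_one, map_smul, scaleL_bivector, smul_smul,
      smul_mul_assoc, map_smul, topCoeff_bivector_mul_gen, Pi.smul_apply, smul_eq_mul,
      smul_eq_mul, ← zpow_natCast x 2, ← zpow_natCast _ 2, ← zpow_mul, neg_mul, ← zpow_add₀ hx0]
    congr 3
    push_cast
    ring
  · change topCoeff _ = (x ^ (-2 * k) • (b x⁻¹).2 - (k * x ^ (1 - 2 * k)) • (b x⁻¹).1) i
    have e3 : x ^ k ≠ 0 := zpow_ne_zero _ hx0
    rw [key, d2, e2 i _ hxi, inv_zpow', neg_neg, fibreOp, map_smul, gen, degOne_ι,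
      mul_smul_comm, bivector_mul_ι, map_add, map_smul, map_smul, map_smul, scaleL_topForm]
    simp only [map_add, map_smul, topCoeff_topForm, dotProduct_smul, dotProduct_single, mul_one,
      Pi.sub_apply, Pi.smul_apply, smul_eq_mul]
    have p1 : x ^ (1 - 2 * k) = x * ((x ^ k)⁻¹) ^ 2 := by
      rw [zpow_sub₀ hx0, zpow_one, mul_comm 2 k, zpow_mul, div_eq_mul_inv, inv_pow]
      norm_cast
    have p2 : x ^ (-2 * k) = ((x ^ k)⁻¹) ^ 2 := by
      rw [neg_mul, zpow_neg, mul_comm 2 k, zpow_mul, inv_pow]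
      norm_cast
    rw [p1, p2, zpow_neg, zpow_add₀ hx0, zpow_one]
    field_simp
    ring

end StandardCharts
end SuperCP1

end

/-! ### Automorphisms of the bundle and their action on coordinates -/

noncomputable section

namespace SuperCP1

section Automorphisms

variable {k : ℤ}

lemma tendsto_inv_cocompact : Filter.Tendsto (fun x : ℂ => x⁻¹) (Filter.cocompact ℂ) (nhds 0) :=
  Filter.tendsto_inv₀_cobounded.mono_left (Metric.cobounded_eq_cocompact (α := ℂ)).ge

/-- By Liouville's theorem the matrix of an automorphism of `E` is constant. -/
lemma AutE.apply_eq_infty (A : AutE k) (p : CP1) : A.1 p = A.1 OnePoint.infty := by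
  refine LinearEquiv.ext fun v => funext fun i => ?_
  induction p using OnePoint.rec with
  | infty => rfl
  | coe x =>
    have hd : Differentiable ℂ fun x => A.1 (chartZero x) v i :=
      differentiableOn_univ.1 (AutE.hol_zero A v (LinearMap.proj i))
    have hc : ContinuousAt (fun y => A.1 (chartInf y) v i) 0 :=
      (differentiableOn_univ.1 (AutE.hol_inf A v (LinearMap.proj i))).continuous.continuousAt
    have ht : Filter.Tendsto (fun x => A.1 (chartZero x) v i) (Filter.cocompact ℂ)
        (nhds (A.1 (chartInf 0) v i)) := by
      refine (hc.tendsto.comp tendsto_inv_cocompact).congr' ?_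
      have h0 : ({0}ᶜ : Set ℂ) ∈ Filter.cocompact ℂ := isCompact_singleton.compl_mem_cocompact
      filter_upwards [h0] with x hx
      rw [Function.comp_apply, chartInf_inv hx]
    have h := hd.apply_eq_of_tendsto_cocompact x ht
    rwa [chartInf_zero] at h

/-- A constant endomorphism of the typical fibre preserves holomorphic sections, since it commutes
with the scalar transition functions of `E`. -/
lemma IsHolSection.map_const {U : Opens CP1} {s : U → FibE} (hs : IsHolSection scaleE k s)
    (L : FibE →ₗ[ℂ] FibE) : IsHolSection scaleE k fun x => L (s x) := by
  refine ⟨(hs.1.linear L).congr fun z hz => ?_, (hs.2.linear L).congr fun z hz => ?_⟩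
  · rw [extendZero_of_mem _ (show chartZero z ∈ U from hz),
      extendZero_of_mem _ (show chartZero z ∈ U from hz)]
  · rw [extendZero_of_mem _ (show chartInf z ∈ U from hz),
      extendZero_of_mem _ (show chartInf z ∈ U from hz)]
    simp [scaleE]

/-- Automorphisms of `E` are the same as automorphisms of the typical fibre, through evaluation at
any point, here the point at infinity. -/
def autEquiv (k : ℤ) : AutE k ≃* (FibE ≃ₗ[ℂ] FibE) where
  toFun A := A.1 OnePoint.infty
  invFun L := ⟨fun _ => L, fun U s => ⟨fun h => by
      simpa using h.map_const L.symm.toLinearMap, fun h => h.map_const L.toLinearMap⟩⟩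
  left_inv A := Subtype.ext (funext fun p => (AutE.apply_eq_infty A p).symm)
  right_inv _ := rfl
  map_mul' _ _ := rfl

/-- Automorphisms of `E` are given by constant invertible matrices. -/
def autMatrix (k : ℤ) : AutE k ≃* GL (Fin 3) ℂ :=
  (autEquiv k).trans (Matrix.GeneralLinearGroup.toLin.trans
    (LinearMap.GeneralLinearGroup.generalLinearEquiv ℂ FibE)).symm

lemma toLinearMap_eq_toLin' (A : AutE k) (p : CP1) :
    (A.1 p).toLinearMap = Matrix.toLin' (autMatrix k A : Matrix (Fin 3) (Fin 3) ℂ) := by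
  have h : (Matrix.GeneralLinearGroup.toLin.trans
      (LinearMap.GeneralLinearGroup.generalLinearEquiv ℂ FibE)) (autMatrix k A) =
      A.1 OnePoint.infty := MulEquiv.apply_symm_apply _ _
  rw [AutE.apply_eq_infty A p, ← h]
  rfl

lemma apply_eq_mulVec (A : AutE k) (p : CP1) (v : FibE) :
    A.1 p v = (autMatrix k A : Matrix (Fin 3) (Fin 3) ℂ).mulVec v := by
  rw [← LinearEquiv.coe_coe, toLinearMap_eq_toLin', Matrix.toLin'_apply]

/-- The matrix `det A • A⁻ᵀ`, as a homomorphism. -/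
def cofactorHom : GL (Fin 3) ℂ →* Matrix (Fin 3) (Fin 3) ℂ where
  toFun A := (A : Matrix (Fin 3) (Fin 3) ℂ).det • (A : Matrix (Fin 3) (Fin 3) ℂ)⁻¹.transpose
  map_one' := by simp
  map_mul' A B := by
    rw [Units.val_mul, Matrix.det_mul, Matrix.mul_inv_rev, Matrix.transpose_mul,
      Matrix.smul_mul, Matrix.mul_smul, smul_smul]

lemma surjective_cofactorHom : Function.Surjective cofactorHom.toHomUnits := by
  intro B
  have hB : (B : Matrix (Fin 3) (Fin 3) ℂ).det ≠ 0 := (Matrix.isUnits_det_units B).ne_zero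
  obtain ⟨t, ht⟩ := IsAlgClosed.exists_pow_nat_eq (B : Matrix (Fin 3) (Fin 3) ℂ).det
    (n := 2) (by norm_num)
  have ht0 : t ≠ 0 := by
    rintro rfl
    exact hB (by rw [← ht]; norm_num)
  -- `A = t • B⁻ᵀ` has determinant `t ^ 3 / det B = t`
  set M : Matrix (Fin 3) (Fin 3) ℂ := t • (B : Matrix (Fin 3) (Fin 3) ℂ)⁻¹.transpose with hM
  have hdet : M.det = t := by
    rw [hM, Matrix.det_smul, Matrix.det_transpose, Matrix.det_nonsing_inv, Ring.inverse_eq_inv',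
      Fintype.card_fin, ← ht]
    field_simp
  have hinv : M⁻¹ = t⁻¹ • (B : Matrix (Fin 3) (Fin 3) ℂ).transpose := by
    refine Matrix.inv_eq_right_inv ?_
    rw [hM, Matrix.smul_mul, Matrix.mul_smul, smul_smul, mul_inv_cancel₀ ht0, one_smul,
      ← Matrix.transpose_mul, Matrix.mul_nonsing_inv _ (Matrix.isUnits_det_units B),
      Matrix.transpose_one]
  refine ⟨Matrix.GeneralLinearGroup.mkOfDetNeZero M (by rwa [hdet]), Units.ext ?_⟩
  change M.det • M⁻¹.transpose = (B : Matrix (Fin 3) (Fin 3) ℂ)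
  rw [hdet, hinv, Matrix.transpose_smul, Matrix.transpose_transpose, smul_smul,
    mul_inv_cancel₀ ht0, one_smul]

/-- The homomorphism `A ↦ det A • A⁻ᵀ`. -/
def cofactor (k : ℤ) : AutE k →* GL (Fin 3) ℂ :=
  cofactorHom.toHomUnits.comp (autMatrix k).toMonoidHom

lemma coe_cofactor (A : AutE k) : (cofactor k A : Matrix (Fin 3) (Fin 3) ℂ) =
    (autMatrix k A : Matrix (Fin 3) (Fin 3) ℂ).det •
      (autMatrix k A : Matrix (Fin 3) (Fin 3) ℂ)⁻¹.transpose := rfl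

lemma surjective_cofactor (k : ℤ) : Function.Surjective (cofactor k) :=
  surjective_cofactorHom.comp (autMatrix k).surjective

lemma degZero_map (L : FibE →ₗ[ℂ] FibE) (a : FibL) :
    degZero (ExteriorAlgebra.map L a) = degZero a := by
  have h : degZero.comp (ExteriorAlgebra.map L) = degZero :=
    ExteriorAlgebra.hom_ext (LinearMap.ext fun u => by
      simp [ExteriorAlgebra.algebraMapInv])
  exact DFunLike.congr_fun h a

lemma degOne_map (L : FibE →ₗ[ℂ] FibE) (a : FibL) :
    degOne (ExteriorAlgebra.map L a) = L (degOne a) := by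
  induction a using ExteriorAlgebra.induction with
  | algebraMap r =>
    rw [AlgHom.commutes, Algebra.algebraMap_eq_smul_one, map_smul, degOne_one, smul_zero, map_zero]
  | ι x => rw [ExteriorAlgebra.map_apply_ι, degOne_ι, degOne_ι]
  | mul a b ha hb => rw [map_mul, degOne_mul, degOne_mul, ha, hb, degZero_map, degZero_map,
      map_add, map_smul, map_smul]
  | add a b ha hb => rw [map_add, map_add, ha, hb, map_add, map_add]

lemma map_fibreOp (A : Matrix (Fin 3) (Fin 3) ℂ) (hA : IsUnit A.det) (f g : FibE) (a a' : FibL) :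
    ExteriorAlgebra.map (Matrix.toLin' A) (fibreOp f g a a') =
      fibreOp ((A.det • A⁻¹.transpose).mulVec f) ((A.det • A⁻¹.transpose).mulVec g)
        (ExteriorAlgebra.map (Matrix.toLin' A) a) (ExteriorAlgebra.map (Matrix.toLin' A) a') := by
  rw [fibreOp, fibreOp, map_add, map_mul, map_smul, map_bivector A hA, map_topForm, degOne_map,
    Matrix.toLin'_apply, smul_smul, Matrix.smul_mulVec _ _ g, smul_dotProduct,
    Matrix.mulVec_transpose, ← Matrix.dotProduct_mulVec, Matrix.mulVec_mulVec,
    Matrix.nonsing_inv_mul _ hA, Matrix.one_mulVec, smul_eq_mul, mul_comm]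

lemma HasHolDeriv.linear {s : ℂ → FibL} {d : FibL} {z : ℂ} (h : HasHolDeriv s d z)
    (L : FibL →ₗ[ℂ] FibL) : HasHolDeriv (fun w => L (s w)) (L d) z := fun l => h (l ∘ₗ L)

namespace SuperChart

variable (C : SuperChart k) {V : Opens CP1}

lemma loc_act (A : AutE k) (s : StrSheaf k V) {z : ℂ} (hz : z ∈ C.pre V) :
    C.loc (act A V s) z = ExteriorAlgebra.map
      (Matrix.toLin' (autMatrix k A : Matrix (Fin 3) (Fin 3) ℂ)) (C.loc s z) := by
  rw [C.loc_of_mem _ hz, C.loc_of_mem _ hz, ← toLinearMap_eq_toLin' A (C.φ z), ← scaleL_comm]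
  rfl

/-- The pair of vectors obtained by applying a matrix to both components. -/
def pairMulVec (M : Matrix (Fin 3) (Fin 3) ℂ) (b : Pair) : Pair := (M.mulVec b.1, M.mulVec b.2)

/-- In every chart `Int A` acts on the coordinates of vector fields by `det A • A⁻ᵀ`. -/
lemma coords_intVec (hV : V ≤ C.dom) (A : AutE k) (v : VecFields k 2 V) {z : ℂ}
    (hz : z ∈ C.pre V) :
    C.coords hV (intVec A 2 V v) z = pairMulVec (cofactor k A) (C.coords hV v z) := by
  refine C.coords_of_loc hV _ (fun z => pairMulVec (cofactor k A) (C.coords hV v z)) hz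
    fun s => ?_
  have hs : s = act A V (act A⁻¹ V s) := (act_inv_act A V s).symm
  have hloc := C.holOn_loc hV (act A⁻¹ V s)
  have e : C.loc (act A V (v.1 ⟨V, le_rfl⟩ (act A⁻¹ V s))) z = _ := C.loc_act A _ hz
  refine e.trans ?_
  rw [C.loc_apply hV v ⟨V, le_rfl⟩ _ hz, locOp, map_fibreOp _ (Matrix.isUnits_det_units _)]
  have hd : holDeriv (C.loc s) z = ExteriorAlgebra.map
      (Matrix.toLin' (autMatrix k A : Matrix (Fin 3) (Fin 3) ℂ))
        (holDeriv (C.loc (act A⁻¹ V s)) z) := by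
    have h := ((hloc.hasHolDeriv (C.pre V).isOpen hz).linear (ExteriorAlgebra.map
      (Matrix.toLin' (autMatrix k A : Matrix (Fin 3) (Fin 3) ℂ))).toLinearMap).congr
      (C.pre V).isOpen hz (t := C.loc s) fun w hw => by
        conv_lhs => rw [hs]
        exact C.loc_act A _ hw
    exact h.holDeriv_eq
  rw [locOp, hd, ← C.loc_act A _ hz, ← hs]
  rfl

end SuperChart

end Automorphisms
end SuperCP1

end

/-! ### The cohomology of vector fields of degree two -/

noncomputable section

namespace SuperCP1

section Coboundaries

open SuperChart

variable (k : ℤ)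

/-- The pair `a` of functions on the punctured plane is a coboundary: it differs from an entire
pair by one that is holomorphic in the chart at infinity. -/
def IsCoboundary (a : ℂ → Pair) : Prop :=
  ∃ b₀ b : ℂ → Pair, Differentiable ℂ b₀ ∧ Differentiable ℂ b ∧
    ∀ x, x ≠ 0 → a x = b₀ x + transition k x (b x⁻¹)

/-- The polar part of a Laurent series. -/
def polar {n : ℕ} (c : Fin n → FibE) (x : ℂ) : FibE := ∑ j : Fin n, x⁻¹ ^ (j + 1 : ℕ) • c j

/-- The cocycles representing the cohomology classes for `n = 2k - 3`. The term
`(k * x⁻¹) • polar c x` follows the change of coordinates, in which a first component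
`-x ^ (2 - 2 * k) F` is accompanied by `k * x⁻¹` times itself in the second. -/
def cocycle {n : ℕ} (c : Fin n → FibE) (d : Fin (n + 2) → FibE) (x : ℂ) : Pair :=
  (polar c x, (k * x⁻¹) • polar c x + polar d x)

variable {k}

lemma differentiableOn_inv_pow (n : ℕ) : DifferentiableOn ℂ (fun x : ℂ => x⁻¹ ^ n) {0}ᶜ :=
  (differentiableOn_inv.mono fun _ h => h).pow n

lemma differentiableOn_comp_inv {F : ℂ → FibE} (hF : Differentiable ℂ F) :
    DifferentiableOn ℂ (fun x => F x⁻¹) {0}ᶜ :=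
  hF.comp_differentiableOn (differentiableOn_inv.mono fun _ h => h)

lemma differentiableOn_polar {n : ℕ} (c : Fin n → FibE) :
    DifferentiableOn ℂ (polar c) {0}ᶜ :=
  DifferentiableOn.fun_sum fun _ _ => (differentiableOn_inv_pow _).smul_const _

lemma differentiableOn_cocycle {n : ℕ} (c : Fin n → FibE) (d : Fin (n + 2) → FibE) :
    DifferentiableOn ℂ (cocycle k c d) {0}ᶜ := by
  have h : DifferentiableOn ℂ (fun x : ℂ => (k : ℂ) * x⁻¹) {0}ᶜ :=
    (differentiableOn_inv.mono fun _ h => h).const_mul _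
  exact (differentiableOn_polar c).prodMk
    ((h.smul (differentiableOn_polar c)).add (differentiableOn_polar d))

lemma transition_eq {n : ℕ} (hn : (n : ℤ) = 2 * k - 3) (x : ℂ) (b : Pair) :
    transition k x b = (-x⁻¹ ^ (n + 1) • b.1,
      x⁻¹ ^ (n + 3) • b.2 - (k * x⁻¹ ^ (n + 2)) • b.1) := by
  have h1 : x ^ (2 - 2 * k) = x⁻¹ ^ (n + 1) := by
    rw [← zpow_natCast, inv_zpow']
    congr 1
    push_cast
    lia
  have h2 : x ^ (-2 * k) = x⁻¹ ^ (n + 3) := by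
    rw [← zpow_natCast, inv_zpow']
    congr 1
    push_cast
    lia
  have h3 : x ^ (1 - 2 * k) = x⁻¹ ^ (n + 2) := by
    rw [← zpow_natCast, inv_zpow']
    congr 1
    push_cast
    lia
  rw [transition, h1, h2, h3]

/-- Every pair is cohomologous to a standard cocycle: the Laurent tail `F` of the first component
is removed by the chart at infinity, at the price of a term in `F` in the second component, whose
Laurent expansion is then taken up to order `n + 2`. -/
lemma exists_isCoboundary_sub_cocycle {n : ℕ} (hn : (n : ℤ) = 2 * k - 3) {a : ℂ → Pair}
    (ha : DifferentiableOn ℂ a {0}ᶜ) :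
    ∃ (c : Fin n → FibE) (d : Fin (n + 2) → FibE),
      IsCoboundary k fun x => a x - cocycle k c d x := by
  obtain ⟨f₀, c, F, hf₀, hF, hf⟩ := exists_laurent n ha.fst
  have hg : DifferentiableOn ℂ (fun x => (a x).2 - ((k * x⁻¹) • polar c x +
      (k * x⁻¹ ^ (n + 2)) • F x⁻¹)) {0}ᶜ := by
    have h1 : DifferentiableOn ℂ (fun x : ℂ => (k : ℂ) * x⁻¹) {0}ᶜ :=
      (differentiableOn_inv.mono fun _ h => h).const_mul _
    exact ha.snd.sub ((h1.smul (differentiableOn_polar c)).add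
      (((differentiableOn_inv_pow _).const_mul _).smul (differentiableOn_comp_inv hF)))
  obtain ⟨g₀, d, G, hg₀, hG, hg⟩ := exists_laurent (n + 2) hg
  refine ⟨c, d, fun x => (f₀ x, g₀ x), fun y => (-F y, G y), hf₀.prodMk hg₀, hF.neg.prodMk hG,
    fun x hx => ?_⟩
  have e1 := hf x hx
  have e2 := hg x hx
  rw [sub_eq_iff_eq_add] at e2
  rw [transition_eq hn]
  refine Prod.ext ?_ ?_
  · simp only [cocycle, polar, Prod.fst_sub, Prod.fst_add] at e1 ⊢
    rw [e1]
    module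
  · simp only [cocycle, polar, Prod.snd_sub, Prod.snd_add] at e2 ⊢
    rw [e2]
    module

/-- A standard cocycle that is a coboundary vanishes, by uniqueness of Laurent expansions. -/
lemma eq_zero_of_isCoboundary_cocycle {n : ℕ} (hn : (n : ℤ) = 2 * k - 3) {c : Fin n → FibE}
    {d : Fin (n + 2) → FibE} (h : IsCoboundary k (cocycle k c d)) : c = 0 ∧ d = 0 := by
  obtain ⟨b₀, b, hb₀, hb, h⟩ := h
  simp only [transition_eq hn] at h
  have h1 : ∀ x, x ≠ 0 → (b₀ x).1 = polar c x + x⁻¹ ^ (n + 1) • (b x⁻¹).1 := fun x hx => by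
    have e := congrArg Prod.fst (h x hx)
    simp only [cocycle, Prod.fst_add] at e
    rw [e]
    module
  obtain ⟨hc, hf₀⟩ := laurent_unique n hb₀.fst hb.fst h1
  have hp : ∀ x, polar c x = 0 := fun x => by simp [polar, hc]
  have hF : ∀ x, x ≠ 0 → (b x⁻¹).1 = 0 := fun x hx => by
    have e := h1 x hx
    rw [hp, zero_add, show (b₀ x).1 = 0 from congrFun hf₀ x] at e
    exact (smul_eq_zero.1 e.symm).resolve_left (pow_ne_zero _ (inv_ne_zero hx))
  have h2 : ∀ x, x ≠ 0 → (b₀ x).2 = polar d x + x⁻¹ ^ (n + 2 + 1) • -(b x⁻¹).2 := fun x hx => by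
    have e := congrArg Prod.snd (h x hx)
    simp only [cocycle, Prod.snd_add, hp, hF x hx, smul_zero, zero_add, sub_zero] at e
    rw [e]
    module
  exact ⟨hc, (laurent_unique (n + 2) hb₀.snd hb.snd.neg h2).1⟩

/-- For `k ≤ 1` the factors `x ^ (2 - 2 * k)` and `x ^ (-2 * k)` of the change of coordinates create
no gap between the Laurent series of the two charts, except for `1 / x` in the second component if
`k = 1`. -/
lemma isCoboundary_of_le_one (hk : k ≤ 1) {a : ℂ → Pair} (ha : DifferentiableOn ℂ a {0}ᶜ) :
    IsCoboundary k a := by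
  obtain ⟨f₀, F, hf₀, hF, -, hf⟩ := exists_laurent_split ha.fst
  rcases hk.eq_or_lt with rfl | hk
  · -- the residue of the second component is absorbed by a constant shifted between the
    -- two charts in the first one
    have hg : DifferentiableOn ℂ (fun x => (a x).2 - x⁻¹ ^ 1 • F x⁻¹) {0}ᶜ :=
      ha.snd.sub ((differentiableOn_inv_pow 1).smul (differentiableOn_comp_inv hF))
    obtain ⟨g₀, r, G, hg₀, hG, hg⟩ := exists_laurent 1 hg
    refine ⟨fun x => (f₀ x - r 0, g₀ x), fun y => (-(F y + r 0), G y),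
      (hf₀.sub_const _).prodMk hg₀, (hF.add_const _).neg.prodMk hG, fun x hx => ?_⟩
    have e1 := hf x hx
    have e2 := hg x hx
    rw [sub_eq_iff_eq_add] at e2
    have p1 : x ^ (2 - 2 * 1 : ℤ) = 1 := by norm_num
    have p2 : x ^ (-2 * 1 : ℤ) = x⁻¹ ^ 2 := by rw [inv_pow]; rfl
    have p3 : x ^ (1 - 2 * 1 : ℤ) = x⁻¹ := by norm_num
    rw [transition, p1, p2, p3]
    refine Prod.ext ?_ ?_
    · simp only [Prod.fst_add] at e1 ⊢
      rw [e1]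
      module
    · simp only [Prod.snd_add, Finset.univ_unique, Finset.sum_singleton, Fin.default_eq_zero,
        Fin.val_zero, zero_add, pow_one, Int.cast_one, one_mul] at e2 ⊢
      rw [e2]
      module
  · obtain ⟨m, hm⟩ : ∃ m : ℕ, (m : ℤ) = -2 * k := ⟨(-2 * k).toNat, by lia⟩
    have p1 : ∀ x : ℂ, x ^ (2 - 2 * k) = x ^ (m + 2) := fun x => by
      rw [← zpow_natCast]
      congr 1
      push_cast
      lia
    have p2 : ∀ x : ℂ, x ^ (-2 * k) = x ^ m := fun x => by rw [← zpow_natCast, hm]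
    have p3 : ∀ x : ℂ, x ^ (1 - 2 * k) = x ^ (m + 1) := fun x => by
      rw [← zpow_natCast]
      congr 1
      push_cast
      lia
    have hg : DifferentiableOn ℂ (fun x => (a x).2 - (k * x⁻¹ ^ 1) • F x⁻¹) {0}ᶜ :=
      ha.snd.sub (((differentiableOn_inv_pow 1).const_mul _).smul (differentiableOn_comp_inv hF))
    obtain ⟨g₀, G, hg₀, hG, -, hg⟩ := exists_laurent_split hg
    refine ⟨fun x => (f₀ x, g₀ x), fun y => (-(y ^ (m + 2) • F y), y ^ m • G y),
      hf₀.prodMk hg₀, ((differentiable_id.pow _).smul hF).neg.prodMk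
        ((differentiable_id.pow _).smul hG), fun x hx => ?_⟩
    have e1 := hf x hx
    have e2 := hg x hx
    rw [sub_eq_iff_eq_add] at e2
    have q1 : x ^ (m + 2) * x⁻¹ ^ (m + 2) = 1 := by
      rw [← mul_pow, mul_inv_cancel₀ hx, one_pow]
    have q2 : x ^ m * x⁻¹ ^ m = 1 := by rw [← mul_pow, mul_inv_cancel₀ hx, one_pow]
    have q3 : x ^ (m + 1) * x⁻¹ ^ (m + 2) = x⁻¹ := by
      rw [pow_succ x⁻¹ (m + 1), ← mul_assoc, ← mul_pow, mul_inv_cancel₀ hx, one_pow, one_mul]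
    rw [transition, p1, p2, p3]
    refine Prod.ext ?_ ?_
    · simp only [Prod.fst_add] at e1 ⊢
      rw [e1, neg_smul, smul_neg, neg_neg, smul_smul, q1, one_smul]
    · simp only [Prod.snd_add, pow_one] at e2 ⊢
      rw [e2, smul_neg, sub_neg_eq_add, smul_smul, smul_smul, q2, mul_assoc, q3, one_smul]
      abel

lemma polar_add {n : ℕ} (c c' : Fin n → FibE) (x : ℂ) :
    polar (c + c') x = polar c x + polar c' x := by
  simp only [polar, Pi.add_apply, smul_add, Finset.sum_add_distrib]

lemma polar_smul {n : ℕ} (r : ℂ) (c : Fin n → FibE) (x : ℂ) :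
    polar (r • c) x = r • polar c x := by
  simp only [polar, Pi.smul_apply, Finset.smul_sum, smul_comm r]

lemma polar_mulVec {n : ℕ} (M : Matrix (Fin 3) (Fin 3) ℂ) (c : Fin n → FibE) (x : ℂ) :
    polar (fun j => M.mulVec (c j)) x = M.mulVec (polar c x) := by
  simp only [polar, Matrix.mulVec_sum, Matrix.mulVec_smul]

lemma cocycle_add {n : ℕ} (c c' : Fin n → FibE) (d d' : Fin (n + 2) → FibE) (x : ℂ) :
    cocycle k (c + c') (d + d') x = cocycle k c d x + cocycle k c' d' x := by
  refine Prod.ext (polar_add _ _ _) ?_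
  simp only [cocycle, polar_add, Prod.snd_add]
  module

lemma cocycle_smul {n : ℕ} (r : ℂ) (c : Fin n → FibE) (d : Fin (n + 2) → FibE) (x : ℂ) :
    cocycle k (r • c) (r • d) x = r • cocycle k c d x := by
  refine Prod.ext (polar_smul _ _ _) ?_
  simp only [cocycle, polar_smul, Prod.smul_snd]
  module

lemma cocycle_mulVec {n : ℕ} (M : Matrix (Fin 3) (Fin 3) ℂ) (c : Fin n → FibE)
    (d : Fin (n + 2) → FibE) (x : ℂ) :
    cocycle k (fun j => M.mulVec (c j)) (fun j => M.mulVec (d j)) x =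
      pairMulVec M (cocycle k c d x) := by
  simp only [cocycle, polar_mulVec, pairMulVec, Matrix.mulVec_add, Matrix.mulVec_smul]

end Coboundaries

section Cohomology

open SuperChart

variable {k : ℤ}

lemma overlap_le : (zeroChart k).dom ⊓ (infChart k).dom ≤ (zeroChart k).dom := inf_le_left

/-- The vector field of degree two on the overlap of the two charts with coordinates `a` in the
chart at zero. -/
def overlapField (a : ℂ → Pair) (ha : DifferentiableOn ℂ a {0}ᶜ) :
    VecFields k 2 ((zeroChart k).dom ⊓ (infChart k).dom) :=
  (zeroChart k).field overlap_le a (by rwa [pre_zero_overlap])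

/-- The class in `H¹(CP1, T_2)` of a vector field on the overlap of the two charts. -/
def cohClass : VecFields k 2 ((zeroChart k).dom ⊓ (infChart k).dom) →+ H1T2 k :=
  connecting dom_sup_dom (vecSheaf k 2)

lemma surjective_cohClass : Function.Surjective (cohClass (k := k)) :=
  connecting_surjective dom_sup_dom (zeroChart k).ext_freeSheaf_dom_eq_zero
    (infChart k).ext_freeSheaf_dom_eq_zero

/-- The coordinates, in the chart at zero, of a vector field on the overlap of the charts. -/
def overlapCoords (v : VecFields k 2 ((zeroChart k).dom ⊓ (infChart k).dom)) (x : ℂ) : Pair :=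
  (zeroChart k).coords overlap_le v x

lemma overlapCoords_ext {v w : VecFields k 2 ((zeroChart k).dom ⊓ (infChart k).dom)}
    (h : ∀ x, x ≠ 0 → overlapCoords v x = overlapCoords w x) : v = w :=
  (zeroChart k).ext_coords overlap_le fun x hx => h x (mem_pre_zero_overlap.1 hx)

lemma overlapCoords_overlapField {a : ℂ → Pair} (ha : DifferentiableOn ℂ a {0}ᶜ) {x : ℂ}
    (hx : x ≠ 0) : overlapCoords (k := k) (overlapField a ha) x = a x :=
  (zeroChart k).coords_field overlap_le a _ (mem_pre_zero_overlap.2 hx)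

lemma overlapCoords_add (v w : VecFields k 2 ((zeroChart k).dom ⊓ (infChart k).dom)) {x : ℂ}
    (hx : x ≠ 0) : overlapCoords (v + w) x = overlapCoords v x + overlapCoords w x :=
  (zeroChart k).coords_add overlap_le v w (mem_pre_zero_overlap.2 hx)

lemma overlapCoords_smul (r : ℂ) (v : VecFields k 2 ((zeroChart k).dom ⊓ (infChart k).dom)) {x : ℂ}
    (hx : x ≠ 0) : overlapCoords (r • v) x = r • overlapCoords v x :=
  (zeroChart k).coords_smul overlap_le r v (mem_pre_zero_overlap.2 hx)

lemma overlapCoords_intVec (A : AutE k)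
    (v : VecFields k 2 ((zeroChart k).dom ⊓ (infChart k).dom)) {x : ℂ} (hx : x ≠ 0) :
    overlapCoords (intVec A 2 _ v) x = pairMulVec (cofactor k A) (overlapCoords v x) :=
  (zeroChart k).coords_intVec overlap_le A v (mem_pre_zero_overlap.2 hx)

lemma overlapCoords_res_zero (v : VecFields k 2 (zeroChart k).dom) {x : ℂ} (hx : x ≠ 0) :
    overlapCoords (resVec k 2 inf_le_left v) x = (zeroChart k).coords le_rfl v x :=
  (zeroChart k).coords_resVec le_rfl inf_le_left v (mem_pre_zero_overlap.2 hx)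

lemma overlapCoords_res_inf (v : VecFields k 2 (infChart k).dom) {x : ℂ} (hx : x ≠ 0) :
    overlapCoords (resVec k 2 inf_le_right v) x =
      transition k x ((infChart k).coords le_rfl v x⁻¹) := by
  have h := (mem_pre_zero_overlap (k := k)).2 hx
  refine (coords_zero_eq overlap_le inf_le_right _ h).trans (congrArg _ ?_)
  refine (infChart k).coords_resVec le_rfl inf_le_right v ?_
  change chartInf x⁻¹ ∈ ((zeroChart k).dom ⊓ (infChart k).dom : Opens CP1)
  rw [chartInf_inv hx]
  exact h

lemma exists_overlapField (v : VecFields k 2 ((zeroChart k).dom ⊓ (infChart k).dom)) :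
    ∃ a ha, overlapField a ha = v := by
  have ha := (zeroChart k).differentiableOn_coords overlap_le v
  rw [pre_zero_overlap] at ha
  exact ⟨_, ha, (zeroChart k).field_coords overlap_le v⟩

lemma cohClass_eq_zero_iff (v : VecFields k 2 ((zeroChart k).dom ⊓ (infChart k).dom)) :
    cohClass v = 0 ↔ ∃ (v₀ : VecFields k 2 (zeroChart k).dom) (v₁ : VecFields k 2 (infChart k).dom),
      v + resVec k 2 inf_le_right v₁ = resVec k 2 inf_le_left v₀ :=
  (connecting_eq_zero_iff dom_sup_dom (F := vecSheaf k 2) v).trans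
    (exists₂_congr fun _ _ => eq_sub_iff_add_eq)

lemma transition_neg (x : ℂ) (b : Pair) : transition k x (-b) = -transition k x b := by
  refine Prod.ext ?_ ?_
  · simp only [transition, Prod.fst_neg]
    module
  · simp only [transition, Prod.snd_neg, Prod.fst_neg]
    module

lemma cohClass_overlapField_eq_zero_iff (a : ℂ → Pair) (ha : DifferentiableOn ℂ a {0}ᶜ) :
    cohClass (k := k) (overlapField a ha) = 0 ↔ IsCoboundary k a := by
  rw [cohClass_eq_zero_iff]
  constructor
  · rintro ⟨v₀, v₁, h⟩
    have d₀ := (zeroChart k).differentiableOn_coords le_rfl v₀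
    have d₁ := (infChart k).differentiableOn_coords le_rfl v₁
    rw [pre_zero_dom, differentiableOn_univ] at d₀
    rw [pre_inf_dom, differentiableOn_univ] at d₁
    refine ⟨_, fun y => -(infChart k).coords le_rfl v₁ y, d₀, d₁.neg, fun x hx => ?_⟩
    have e := congrArg (fun v => overlapCoords v x) h
    simp only [overlapCoords_add _ _ hx] at e
    rw [overlapCoords_overlapField ha hx, overlapCoords_res_zero _ hx,
      overlapCoords_res_inf _ hx] at e
    rw [← e, transition_neg, add_neg_cancel_right]
  · rintro ⟨b₀, b, hb₀, hb, h⟩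
    refine ⟨(zeroChart k).field le_rfl b₀ hb₀.differentiableOn,
      (infChart k).field le_rfl (-b) hb.neg.differentiableOn, ?_⟩
    refine overlapCoords_ext fun x hx => (overlapCoords_add _ _ hx).trans ?_
    have e₀ := overlapCoords_res_zero ((zeroChart k).field le_rfl b₀ hb₀.differentiableOn) hx
    have e₁ := overlapCoords_res_inf ((infChart k).field le_rfl (-b) hb.neg.differentiableOn) hx
    have e₂ := (zeroChart k).coords_field le_rfl b₀ hb₀.differentiableOn (z := x) ⟨x, rfl⟩
    have e₃ := (infChart k).coords_field le_rfl (-b) hb.neg.differentiableOn (z := x⁻¹) ⟨x⁻¹, rfl⟩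
    refine (congrArg₂ (· + ·) (overlapCoords_overlapField ha hx)
      (e₁.trans (congrArg (transition k x) e₃))).trans (Eq.trans ?_ (e₀.trans e₂).symm)
    simp only [h x hx, Pi.neg_apply, transition_neg, add_neg_cancel_right]

lemma cohClass_add (v w : VecFields k 2 ((zeroChart k).dom ⊓ (infChart k).dom)) :
    cohClass (v + w) = cohClass v + cohClass w :=
  AddMonoidHom.map_add _ v w

lemma smul_cohClass (r : ℂ) (v : VecFields k 2 ((zeroChart k).dom ⊓ (infChart k).dom)) :
    r • cohClass v = cohClass (r • v) :=
  map_connecting dom_sup_dom (scalarEnd k 2 r) v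

lemma intRep_cohClass (A : AutE k) (v : VecFields k 2 ((zeroChart k).dom ⊓ (infChart k).dom)) :
    intRep k A (cohClass v) = cohClass (intVec A 2 _ v) :=
  map_connecting dom_sup_dom (intEnd k 2 A) v

/-- The cocycles, as vector fields on the overlap of the charts. -/
def cocycleField (k : ℤ) {n : ℕ} (c : Fin n → FibE) (d : Fin (n + 2) → FibE) :
    VecFields k 2 ((zeroChart k).dom ⊓ (infChart k).dom) :=
  overlapField (cocycle k c d) (differentiableOn_cocycle c d)

lemma overlapCoords_cocycleField {n : ℕ} (c : Fin n → FibE) (d : Fin (n + 2) → FibE) {x : ℂ}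
    (hx : x ≠ 0) : overlapCoords (cocycleField k c d) x = cocycle k c d x :=
  overlapCoords_overlapField _ hx

/-- The cohomology class of the standard cocycle with given coefficients, for `2k - 3 = n`. -/
def cocycleClass (k : ℤ) (n : ℕ) :
    (Fin n → FibE) × (Fin (n + 2) → FibE) →ₗ[ℂ] H1T2 k where
  toFun p := cohClass (cocycleField k p.1 p.2)
  map_add' p q := by
    refine Eq.trans (congrArg cohClass (overlapCoords_ext fun x hx => ?_)) (cohClass_add _ _)
    rw [overlapCoords_add _ _ hx, overlapCoords_cocycleField _ _ hx,
      overlapCoords_cocycleField _ _ hx, overlapCoords_cocycleField _ _ hx]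
    exact cocycle_add _ _ _ _ x
  map_smul' r p := by
    refine Eq.trans (congrArg cohClass (overlapCoords_ext fun x hx => ?_))
      (smul_cohClass r (cocycleField k p.1 p.2)).symm
    refine (overlapCoords_cocycleField (r • p).1 (r • p).2 hx).trans
      (Eq.trans ?_ (overlapCoords_smul r (cocycleField k p.1 p.2) hx).symm)
    rw [overlapCoords_cocycleField p.1 p.2 hx]
    exact cocycle_smul _ _ _ x

lemma intRep_cocycleClass (A : AutE k) {n : ℕ} (c : Fin n → FibE) (d : Fin (n + 2) → FibE) :
    intRep k A (cocycleClass k n (c, d)) =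
      cocycleClass k n (fun j => (cofactor k A : Matrix (Fin 3) (Fin 3) ℂ).mulVec (c j),
        fun j => (cofactor k A : Matrix (Fin 3) (Fin 3) ℂ).mulVec (d j)) := by
  refine (intRep_cohClass A _).trans (congrArg cohClass (overlapCoords_ext fun x hx => ?_))
  refine (overlapCoords_intVec A (cocycleField k c d) hx).trans
    (Eq.trans ?_ (overlapCoords_cocycleField _ _ hx).symm)
  rw [overlapCoords_cocycleField c d hx, cocycle_mulVec]

lemma bijective_cocycleClass {n : ℕ} (hn : (n : ℤ) = 2 * k - 3) :
    Function.Bijective (cocycleClass k n) := by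
  constructor
  · rw [← LinearMap.ker_eq_bot, LinearMap.ker_eq_bot']
    rintro ⟨c, d⟩ h
    obtain ⟨rfl, rfl⟩ := eq_zero_of_isCoboundary_cocycle hn
      ((cohClass_overlapField_eq_zero_iff _ _).1 h)
    rfl
  · intro y
    obtain ⟨v, rfl⟩ := surjective_cohClass y
    obtain ⟨a, ha, rfl⟩ := exists_overlapField v
    obtain ⟨c, d, h⟩ := exists_isCoboundary_sub_cocycle hn ha
    refine ⟨(c, d), ?_⟩
    have hd := ha.sub (differentiableOn_cocycle (k := k) c d)
    have h0 := (cohClass_overlapField_eq_zero_iff _ hd).2 h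
    have e : overlapField _ hd + cocycleField k c d = overlapField a ha :=
      overlapCoords_ext fun x hx => by
        rw [overlapCoords_add _ _ hx, overlapCoords_cocycleField _ _ hx,
          overlapCoords_overlapField _ hx, overlapCoords_overlapField _ hx]
        exact sub_add_cancel _ _
    refine Eq.trans ?_ (congrArg cohClass e)
    refine Eq.trans ?_ (cohClass_add _ _).symm
    exact (add_eq_right.2 h0).symm

lemma subsingleton_H1T2 (k : ℤ) (hk : k ≤ 1) : Subsingleton (H1T2 k) := by
  refine subsingleton_of_forall_eq (0 : H1T2 k) fun y => ?_
  obtain ⟨v, rfl⟩ := surjective_cohClass y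
  obtain ⟨a, ha, rfl⟩ := exists_overlapField v
  exact (cohClass_overlapField_eq_zero_iff a ha).2 (isCoboundary_of_le_one hk ha)

/-- A matrix is given by its first `n` and its last `m` columns. -/
def colEquiv {N n m : ℕ} (h : n + m = N) :
    Matrix (Fin 3) (Fin N) ℂ ≃ₗ[ℂ] (Fin n → FibE) × (Fin m → FibE) where
  toFun W := (fun j i => W i (Fin.cast h (Fin.castAdd m j)),
    fun j i => W i (Fin.cast h (Fin.natAdd n j)))
  invFun p := Matrix.of fun i j => Fin.append p.1 p.2 (Fin.cast h.symm j) i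
  map_add' _ _ := rfl
  map_smul' _ _ := rfl
  left_inv W := by
    subst h
    ext i j
    refine Fin.addCases (fun j => ?_) (fun j => ?_) j <;> simp
  right_inv p := by
    subst h
    refine Prod.ext ?_ ?_ <;> ext j i <;> simp

lemma colEquiv_mul {N n m : ℕ} (h : n + m = N) (M : Matrix (Fin 3) (Fin 3) ℂ)
    (W : Matrix (Fin 3) (Fin N) ℂ) : colEquiv h (M * W) =
      (fun j => M.mulVec ((colEquiv h W).1 j), fun j => M.mulVec ((colEquiv h W).2 j)) := rfl

end Cohomology
end SuperCP1

end

theorem proposition2 (k : ℤ) :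
    ∃ (e : SuperCP1.AutE k ≃* GL (Fin 3) ℂ)
      (Φ : SuperCP1.H1T2 k ≃ₗ[ℂ] Matrix (Fin 3) (Fin (4 * k - 4).toNat) ℂ)
      (D : SuperCP1.AutE k →* GL (Fin 3) ℂ),
      (∀ (A : SuperCP1.AutE k) (x : SuperCP1.CP1) (v : Fin 3 → ℂ),
        A.1 x v = (e A : Matrix (Fin 3) (Fin 3) ℂ).mulVec v) ∧
      Function.Surjective D ∧
      (∀ A : SuperCP1.AutE k, (D A : Matrix (Fin 3) (Fin 3) ℂ) =
        (e A : Matrix (Fin 3) (Fin 3) ℂ).det •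
          ((e A : Matrix (Fin 3) (Fin 3) ℂ)⁻¹).transpose) ∧
      (∀ (A : SuperCP1.AutE k) (c : SuperCP1.H1T2 k),
        Φ (SuperCP1.intRep k A c) = (D A : Matrix (Fin 3) (Fin 3) ℂ) * Φ c) := by
  open SuperCP1 in
  obtain ⟨Φ, hΦ⟩ : ∃ Φ : H1T2 k ≃ₗ[ℂ] Matrix (Fin 3) (Fin (4 * k - 4).toNat) ℂ,
      ∀ (A : AutE k) (c : H1T2 k),
        Φ (intRep k A c) = (cofactor k A : Matrix (Fin 3) (Fin 3) ℂ) * Φ c := by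
    rcases le_or_gt k 1 with hk | hk
    · have h0 : (4 * k - 4).toNat = 0 := by lia
      rw [h0]
      have := subsingleton_H1T2 k hk
      exact ⟨0, fun _ _ => Subsingleton.elim _ _⟩
    · obtain ⟨n, hn⟩ : ∃ n : ℕ, (n : ℤ) = 2 * k - 3 := ⟨(2 * k - 3).toNat, by lia⟩
      have hN : n + (n + 2) = (4 * k - 4).toNat := by lia
      let Ψ := (colEquiv hN).trans (LinearEquiv.ofBijective _ (bijective_cocycleClass hn))
      refine ⟨Ψ.symm, fun A c => ?_⟩
      obtain ⟨W, rfl⟩ := Ψ.surjective c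
      rw [LinearEquiv.symm_apply_apply, LinearEquiv.symm_apply_eq]
      refine (intRep_cocycleClass A _ _).trans ?_
      exact congrArg (cocycleClass k n) (colEquiv_mul hN _ W).symm
  exact ⟨SuperCP1.autMatrix k, Φ, SuperCP1.cofactor k, SuperCP1.apply_eq_mulVec,
    SuperCP1.surjective_cofactor k, SuperCP1.coe_cofactor, hΦ⟩
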